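/- **Setting.** Let $k\ge 5$ be odd, $d\ge k$, $N\ge 2$, and let $v_*,u\in\mathbb R^d$ be unit vectors with $\langle v_*,u\rangle\ne 0$. One observes $\mathbf T^{(t)}=\lambda v_*^{\otimes k}+\mathbf E^{(t)}$, $t=1,\dots,N$, where the noise tensors $\mathbf E^{(t)}\in\otimes^k\mathbb R^d$ are i.i.d. with mean zero and satisfy $\mathbb E\exp\langle x,\mathbf E^{(t)}\rangle\le\exp(\sigma^2\|x\|_2^2)$ for every $x\in\otimes^k\mathbb R^d$. Assume $c_\lambda\le\lambda\le C_\lambda d^{k/4}$ and $\sigma\ge c_\sigma$, where $c_\lambda,C_\lambda,c_\sigma>0$ are fixed constants. Write $g=\lambda|\langle v_*,u\rangle|$. **Algorithm (bi-threaded normalized stochastic gradient ascent).** Let $\mathbf T(u)=\big(\sum_{i_1}u_{i_1}\mathbf T_{i_1,i_2,\dots,i_k}\big)_{i_2,\dots,i_k}$, $\widehat{\mathsf R}^{(t)}(W)=\langle W^{\otimes (k-1)/2},\mathbf T^{(t)}(u)\rangle$ for $W\in\mathbb R^{d\times d}$, and $T_1=\lfloor N/\log N\rfloor$. For $s\in\{1,-1\}$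 start from $W^{(0)}=I_d$ and, for $t=0,\dots,N-1$, put $\eta_t=\eta_0 2^{-\lfloor t/T_1\rfloor}$ and $$W^{(t+1)}=\Big(1-\frac{\eta_t(k-5)}{2\|W^{(t)}\|_{\mathrm F}^{(k-1)/2}}\,s\widehat{\mathsf R}^{(t+1)}(W^{(t)})\Big)W^{(t)}+\frac{\eta_t}{\|W^{(t)}\|_{\mathrm F}^{(k-1)/2-2}}\,s\nabla_W\widehat{\mathsf R}^{(t+1)}(W^{(t)}).$$ The output of the thread is a unit eigenvector of $W^{(N)}+(W^{(N)})^\top$ for its largest eigenvalue; call it $\hat v^{(1)}$ for $s=1$ and $\hat v^{(2)}$ for $s=-1$. **Claim.** Given $c_\lambda,C_\lambda,c_\sigma$, there is $a>0$ such that for every $b\ge a$ there are constants $C_1,C_2>0$ and $p\in\mathbb N$, depending only on $c_\lambda,C_\lambda,c_\sigma,b$, with the following property. In the setting above let $\delta\in(0,1)$, and suppose $$N\ \ge\ C_1\max\{1,\sigma\}\cdot\Big(\max\Big\{\frac{\log N}{d^{\frac{k-1}4-1}},\log d\Big\}\Big)^2\cdot\frac{\sigma k\log^{7/2}\!\big(\frac{\sigma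 kNd}{\delta}\big)}{g^2}\cdot d^{\frac{k-1}2},$$ $$a\,S\le\eta_0\le b\,S,\qquad S=\max\Big\{\frac{\log N}{k-1},\frac{(k-1)d^{\frac{k-1}4-1}}{\max\{(k-1)(k-5),\log^{-1}d\}}\Big\}\cdot\frac{\lceil\log N\rceil}{gN},$$ and $\eta_0 g(k-1)\le 2e$. Then, with probability at least $1-\delta$, whichever top eigenvectors the two threads return, $$\min_{l\in\{1,2\}}\min\big\{\|\hat v^{(l)}-v_*\|^2,\|\hat v^{(l)}+v_*\|^2\big\}\le C_2\log^p\!\Big(e+\frac{\sigma kNd}{\delta}\Big)\Big[\Big(1-\frac{\eta_0 g(k-1)}{2e}\Big)^{\frac{\lfloor N/\log N\rfloor}2}\frac1{k\delta^{1/2}}+\frac{(g^2k+\sigma d^2)\,d^{\frac k8-\frac58}}{g^2k\,\delta^{1/2}N}+\frac{\sigma}{g\,\delta^{1/2}\sqrt N}\Big].$$ -/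

import Mathlib

open MeasureTheory ProbabilityTheory
open scoped Matrix

noncomputable section

/-- Real tensors of order `n` over `ℝ^d`, as arrays indexed by multi-indices. -/
abbrev Tensor (d n : ℕ) : Type := (Fin n → Fin d) → ℝ

/-- The entrywise inner product of two tensors. -/
def tensorInner {d n : ℕ} (A B : Tensor d n) : ℝ := ∑ i, A i * B i

/-- The `n`-fold outer product `v ⊗ ⋯ ⊗ v`. -/
def vecTensorPow {d : ℕ} (n : ℕ) (v : EuclideanSpace ℝ (Fin d)) : Tensor d n :=
  fun i => ∏ l, v (i l)

/-- For even `n`, the `n/2`-fold outer product `W ⊗ ⋯ ⊗ W` of a matrix, a tensor of order `n`: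
its entry at `(i_1, …, i_n)` is `W i_1 i_2 * W i_3 i_4 * ⋯ * W i_{n-1} i_n`. -/
def matTensorPow {d : ℕ} (n : ℕ) (W : Matrix (Fin d) (Fin d) ℝ) : Tensor d n :=
  fun i => ∏ l : Fin (n / 2),
    W (i ⟨2 * (l : ℕ), by omega⟩) (i ⟨2 * (l : ℕ) + 1, by omega⟩)

/-- `T(u)`: the vector `u` applied to the first mode of `T`. -/
def contractFirst {d n : ℕ} (T : Tensor d n) (u : EuclideanSpace ℝ (Fin d)) :
    Tensor d (n - 1) :=
  fun i => ∑ a, u a * T (fun r => if h : (r : ℕ) = 0 then a else i ⟨(r : ℕ) - 1, by omega⟩)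

/-- The Frobenius norm. -/
def frobNorm {d : ℕ} (W : Matrix (Fin d) (Fin d) ℝ) : ℝ := Real.sqrt (∑ a, ∑ b, W a b ^ 2)

/-- The gradient of a function of a matrix: the matrix of its partial derivatives. -/
def matGrad {d : ℕ} (R : Matrix (Fin d) (Fin d) ℝ → ℝ) (W : Matrix (Fin d) (Fin d) ℝ) :
    Matrix (Fin d) (Fin d) ℝ :=
  Matrix.of fun a b => deriv (fun s : ℝ => R (W + s • Matrix.single a b 1)) 0

/-- One normalized stochastic gradient ascent step with step-size `η` and reward `R`,
for tensors of even order `n ≥ 4`. -/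
def nsgaStep {d : ℕ} (n : ℕ) (η : ℝ) (R : Matrix (Fin d) (Fin d) ℝ → ℝ)
    (W : Matrix (Fin d) (Fin d) ℝ) : Matrix (Fin d) (Fin d) ℝ :=
  (1 - η * ((n : ℝ) - 4) / (2 * frobNorm W ^ (n / 2)) * R W) • W
    + (η / frobNorm W ^ (n / 2 - 2)) • matGrad R W

/-- The length `⌊N / log N⌋` of a phase of constant step-size. -/
def phaseLength (N : ℕ) : ℕ := ⌊(N : ℝ) / Real.log N⌋₊

/-- The iterates of NSGA (order `n`, initial step-size `η₀`) along the rewards `R 0, …, R (N-1)`,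
from the identity matrix. The step-size is halved at every positive multiple of the phase length,
so that step `t` uses `η₀ / 2 ^ (t / phaseLength N)`. -/
def nsga {d N : ℕ} (n : ℕ) (η₀ : ℝ) (R : Fin N → Matrix (Fin d) (Fin d) ℝ → ℝ) :
    ℕ → Matrix (Fin d) (Fin d) ℝ
  | 0 => 1
  | t + 1 =>
      if h : t < N then nsgaStep n (η₀ / 2 ^ (t / phaseLength N)) (R ⟨t, h⟩) (nsga n η₀ R t)
      else nsga n η₀ R t

/-- `v` is a unit eigenvector of `A` for the largest eigenvalue of `A`. -/
def IsTopEigenvector {d : ℕ} (A : Matrix (Fin d) (Fin d) ℝ) (v : EuclideanSpace ℝ (Fin d)) :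
    Prop :=
  ‖v‖ = 1 ∧ ∃ μ : ℝ, A *ᵥ v.ofLp = μ • v.ofLp ∧
    ∀ ν : ℝ, Module.End.HasEigenvalue (Matrix.toLin' A) ν → ν ≤ μ

/-- The reward `⟨W^{⊗(k-1)/2}, T(u)⟩` for a tensor `T` of odd order `k`. -/
def oddReward {d k : ℕ} (u : EuclideanSpace ℝ (Fin d)) (T : Tensor d k)
    (W : Matrix (Fin d) (Fin d) ℝ) : ℝ :=
  tensorInner (matTensorPow (k - 1) W) (contractFirst T u)

/-- `v` is an admissible output of one of the two threads of Bi-Threaded NSGA on the samples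
`T 0, …, T (N-1)` of odd order `k`: the thread with rewards `s * oddReward u (T t)`
(`s = 1` for the first thread, `s = -1` for the second). -/
def IsThreadOutput {d k N : ℕ} (u : EuclideanSpace ℝ (Fin d)) (η₀ : ℝ) (T : Fin N → Tensor d k)
    (s : ℝ) (v : EuclideanSpace ℝ (Fin d)) : Prop :=
  IsTopEigenvector
    (nsga (k - 1) η₀ (fun t W => s * oddReward u (T t) W) N
      + (nsga (k - 1) η₀ (fun t W => s * oddReward u (T t) W) N)ᵀ) v

/-- The noise tensors `E 0, …, E (N-1)` are i.i.d., have mean zero, and satisfy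
`𝔼 exp ⟨x, E⟩ ≤ exp (σ² ‖x‖²)` for every `x`. -/
structure IsSubGaussianNoise {Ω : Type*} [MeasurableSpace Ω] (P : Measure Ω) {d k N : ℕ}
    (E : Fin N → Ω → Tensor d k) (σ : ℝ) : Prop where
  measurable : ∀ t, Measurable (E t)
  indep : iIndepFun E P
  identDistrib : ∀ s t, IdentDistrib (E s) (E t) P P
  mean_zero : ∀ t i, Integrable (fun ω => E t ω i) P ∧ ∫ ω, E t ω i ∂P = 0
  subGaussian : ∀ t (x : Tensor d k),
    Integrable (fun ω => Real.exp (tensorInner x (E t ω))) P ∧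
      ∫ ω, Real.exp (tensorInner x (E t ω)) ∂P ≤ Real.exp (σ ^ 2 * tensorInner x x)

/-- The observed tensor `λ v^{⊗k} + E`. -/
def observation {d k : ℕ} (lam : ℝ) (v : EuclideanSpace ℝ (Fin d)) (E : Tensor d k) :
    Tensor d k :=
  lam • vecTensorPow k v + E

/-- The order of magnitude of the sample size, where `g` stands for `λ |⟨v, u⟩|`. -/
def sampleRate (k d N : ℕ) (σ g δ : ℝ) : ℝ :=
  (max (Real.log N / (d : ℝ) ^ (((k : ℝ) - 1) / 4 - 1)) (Real.log d)) ^ 2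
    * (σ * k * Real.log (σ * k * N * d / δ) ^ (7 / 2 : ℝ) / g ^ 2)
    * (d : ℝ) ^ (((k : ℝ) - 1) / 2)

/-- The order of magnitude of the initial step-size, where `g` stands for `λ |⟨v, u⟩|`. -/
def stepRate (k d N : ℕ) (g : ℝ) : ℝ :=
  max (Real.log N / ((k : ℝ) - 1))
      (((k : ℝ) - 1) * (d : ℝ) ^ (((k : ℝ) - 1) / 4 - 1)
        / max (((k : ℝ) - 1) * ((k : ℝ) - 5)) (Real.log d)⁻¹)
    * (⌈Real.log N⌉₊ / (g * N))

/-- The error rate, where `g` stands for `λ |⟨v, u⟩|`. -/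
def errorRate (k d N : ℕ) (σ g δ η₀ : ℝ) : ℝ :=
  (1 - η₀ * g * ((k : ℝ) - 1) / (2 * Real.exp 1)) ^ ((phaseLength N : ℝ) / 2)
      * (1 / (k * δ ^ (1 / 2 : ℝ)))
    + (g ^ 2 * k + σ * (d : ℝ) ^ 2) * (d : ℝ) ^ ((k : ℝ) / 8 - 5 / 8)
      / (g ^ 2 * k * δ ^ (1 / 2 : ℝ) * N)
    + σ / (g * δ ^ (1 / 2 : ℝ) * Real.sqrt N)

/-- The squared distance of `w` to `v` up to sign. -/
def signedSqError {d : ℕ} (w v : EuclideanSpace ℝ (Fin d)) : ℝ :=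
  min (‖w - v‖ ^ 2) (‖w + v‖ ^ 2)

end

/-! Put m = (k-1)/2. Only the thread whose sign agrees with that of ⟨v,u⟩ is analysed: it performs
ascent on the even-order tensor g v^{⊗2m} plus noise, and its error bounds the minimum over the two
threads. A step is positively homogeneous of degree one in W, so the iterates may be rescaled at
will without changing their top eigenvectors. Write W = a vvᵀ + M with M ⊥ vvᵀ, r = a/‖W‖ and y =
ηg. A noiseless step multiplies M by A = 1 - y(m-2)r^m and a by A + B, where B = y m r^{m-2}.
Dividing by A + B freezes a at its initial value 1 and multiplies M by K = A/(A+B). What remains is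
a scalar recursion for p = ‖M‖.

Dynamics. Either |K| ≤ 1/(1+B), or A < 0 (`abs_stepK_cases`). Such an overshoot requires p to be of
order 1/√m, and y m ≤ e limits its expansion to e - 1, so p stays of that order. Starting from p ≤
√d, the value q = √d/2^l is halved in about (1+q²)^{(m-2)/2}/(y m) steps (`NoisyOrbit.halve`). The
sum over l is of order log d for m = 2 and d^{(m-2)/2} for m > 2, which the lower bound on η₀ makes
affordable within the first phase. After the first halving of the step-size nothing expands any
more, and every step contracts by 1 - c y m with c = e^{-13}/2 (`NoisyOrbit.K_le_later`).

Noise. In a fixed direction the accumulated noise obeys a scalar linear recursion whose coefficients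
are adapted and bounded by 1, driven by tensors of squared norm at most 2mη²‖W‖² times that of the
direction. Moments of cosh propagate through it (`lintegral_cosh_le`), which gives sub-Gaussian
tails. Indicators cut the recursion off outside the region of interest, so these tails hold
unconditionally; a union bound over starting times, end times, scales and matrix entries follows
(`exists_forall_noiseBounds`), and an induction shows that on the resulting event the orbit never
leaves the region.

Conclusion. Once there is a spectral gap, the top eigenvector is controlled by (M+Mᵀ)v alone
(`signedSqError_le`). This has d coordinates, and the contraction after the first phase keeps the
variance of each at order η₀/g. The decayed initial part is at most of order N^{-1/2}d^{-k/4}, and λ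
≤ C_λ d^{k/4} turns this into σ/(g√N). Thus both parts are bounded, up to log², by the third term of
the rate; the other two terms enter only through their nonnegativity. -/

noncomputable section

/-- The Frobenius inner product of two matrices. -/
def frobInner {d : ℕ} (X Y : Matrix (Fin d) (Fin d) ℝ) : ℝ := ∑ a, ∑ b, X a b * Y a b

/-- The outer product of `n / 2` matrices, a tensor of order `n`. -/
def mixTensor {d : ℕ} (n : ℕ) (A : Fin (n / 2) → Matrix (Fin d) (Fin d) ℝ) : Tensor d n :=
  fun i => ∏ l : Fin (n / 2), A l (i ⟨2 * (l : ℕ), by omega⟩) (i ⟨2 * (l : ℕ) + 1, by omega⟩)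

/-- The tensor representing the derivative of `W ↦ ⟨W^{⊗ n/2}, ·⟩` in the direction `X`. -/
def dirTensor {d : ℕ} (n : ℕ) (W X : Matrix (Fin d) (Fin d) ℝ) : Tensor d n :=
  ∑ l : Fin (n / 2), mixTensor n (Function.update (fun _ => W) l X)

/-- The tensor representing the `X`-component of the increment of a step of NSGA at `W`. -/
def updTensor {d : ℕ} (n : ℕ) (W X : Matrix (Fin d) (Fin d) ℝ) : Tensor d n :=
  (frobNorm W ^ (n / 2 - 2))⁻¹ • dirTensor n W X
    - (((n / 2 : ℕ) - 2 : ℝ) / frobNorm W ^ (n / 2) * frobInner X W) • matTensorPow n W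

/-! ### Frobenius geometry of matrices. -/

section FrobInner

variable {d : ℕ} (X Y Z : Matrix (Fin d) (Fin d) ℝ)

lemma frobInner_comm : frobInner X Y = frobInner Y X := by
  simp [frobInner, mul_comm]

lemma frobInner_add_right : frobInner X (Y + Z) = frobInner X Y + frobInner X Z := by
  simp [frobInner, mul_add, Finset.sum_add_distrib]

lemma frobInner_smul_right (c : ℝ) : frobInner X (c • Y) = c * frobInner X Y := by
  simp [frobInner, Finset.mul_sum, mul_left_comm]

lemma frobInner_add_left : frobInner (X + Y) Z = frobInner X Z + frobInner Y Z := by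
  simp [frobInner, add_mul, Finset.sum_add_distrib]

lemma frobInner_smul_left (c : ℝ) : frobInner (c • X) Y = c * frobInner X Y := by
  simp [frobInner, Finset.mul_sum, mul_assoc]

lemma frobInner_sub_right : frobInner X (Y - Z) = frobInner X Y - frobInner X Z := by
  simp [frobInner, mul_sub, Finset.sum_sub_distrib]

lemma frobInner_sub_left : frobInner (X - Y) Z = frobInner X Z - frobInner Y Z := by
  simp [frobInner, sub_mul, Finset.sum_sub_distrib]

lemma frobInner_self_nonneg : 0 ≤ frobInner X X :=
  Finset.sum_nonneg fun _ _ => Finset.sum_nonneg fun _ _ => mul_self_nonneg _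

lemma frobNorm_nonneg : 0 ≤ frobNorm X := Real.sqrt_nonneg _

lemma frobNorm_sq : frobNorm X ^ 2 = frobInner X X := by
  have h : 0 ≤ ∑ a, ∑ b, X a b ^ 2 :=
    Finset.sum_nonneg fun _ _ => Finset.sum_nonneg fun _ _ => sq_nonneg _
  refine (Real.sq_sqrt h).trans ?_
  simp only [frobInner, sq]

lemma frobNorm_eq_norm : frobNorm X
    = ‖(WithLp.toLp 2 fun ij : Fin d × Fin d => X ij.1 ij.2 : EuclideanSpace ℝ (Fin d × Fin d))‖ := by
  rw [EuclideanSpace.norm_eq, frobNorm, Fintype.sum_prod_type]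
  simp

lemma frobInner_eq_inner : frobInner X Y
    = inner ℝ (WithLp.toLp 2 fun ij : Fin d × Fin d => Y ij.1 ij.2 : EuclideanSpace ℝ (Fin d × Fin d))
        (WithLp.toLp 2 fun ij : Fin d × Fin d => X ij.1 ij.2) := by
  simp [PiLp.inner_apply, Fintype.sum_prod_type, frobInner]

lemma abs_frobInner_le : |frobInner X Y| ≤ frobNorm X * frobNorm Y := by
  rw [frobInner_eq_inner, frobNorm_eq_norm, frobNorm_eq_norm, mul_comm]
  exact abs_real_inner_le_norm _ _

lemma frobNorm_add_le : frobNorm (X + Y) ≤ frobNorm X + frobNorm Y := by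
  simp only [frobNorm_eq_norm]
  exact norm_add_le
    (WithLp.toLp 2 fun ij : Fin d × Fin d => X ij.1 ij.2 : EuclideanSpace ℝ (Fin d × Fin d))
    (WithLp.toLp 2 fun ij => Y ij.1 ij.2)

lemma frobNorm_smul (c : ℝ) : frobNorm (c • X) = |c| * frobNorm X := by
  simp only [frobNorm_eq_norm]
  rw [← Real.norm_eq_abs, ← norm_smul]
  rfl

lemma frobNorm_le_of_entries {c : ℝ} (hc : 0 ≤ c) (h : ∀ i j, |X i j| ≤ c) :
    frobNorm X ≤ d * c := by
  apply Real.sqrt_le_iff.2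
  refine ⟨by positivity, ?_⟩
  calc ∑ a, ∑ b, X a b ^ 2 ≤ ∑ _a : Fin d, ∑ _b : Fin d, c ^ 2 := by
        refine Finset.sum_le_sum fun a _ => Finset.sum_le_sum fun b _ => ?_
        exact sq_le_sq' (abs_le.1 (h a b)).1 (abs_le.1 (h a b)).2
    _ = (d * c) ^ 2 := by simp; ring

end FrobInner

/-! ### Inner products of tensors built from matrices. -/

section Tensors

variable {d n : ℕ}

lemma tensorInner_comm (A B : Tensor d n) : tensorInner A B = tensorInner B A := by
  simp [tensorInner, mul_comm]

lemma tensorInner_sub_left (A B C : Tensor d n) :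
    tensorInner (A - B) C = tensorInner A C - tensorInner B C := by
  simp [tensorInner, sub_mul, Finset.sum_sub_distrib]

lemma tensorInner_smul_left (c : ℝ) (A B : Tensor d n) :
    tensorInner (c • A) B = c * tensorInner A B := by
  simp [tensorInner, Finset.mul_sum, mul_assoc]

lemma tensorInner_add_right (A B C : Tensor d n) :
    tensorInner A (B + C) = tensorInner A B + tensorInner A C := by
  simp [tensorInner, mul_add, Finset.sum_add_distrib]

lemma tensorInner_sub_right (A B C : Tensor d n) :
    tensorInner A (B - C) = tensorInner A B - tensorInner A C := by
  simp [tensorInner, mul_sub, Finset.sum_sub_distrib]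

lemma tensorInner_smul_right (c : ℝ) (A B : Tensor d n) :
    tensorInner A (c • B) = c * tensorInner A B := by
  simp [tensorInner, Finset.mul_sum, mul_left_comm]

lemma tensorInner_sum_left {ι : Type*} (s : Finset ι) (A : ι → Tensor d n) (B : Tensor d n) :
    tensorInner (∑ l ∈ s, A l) B = ∑ l ∈ s, tensorInner (A l) B := by
  simp only [tensorInner, Finset.sum_apply, Finset.sum_mul]
  exact Finset.sum_comm

lemma tensorInner_self_nonneg (A : Tensor d n) : 0 ≤ tensorInner A A :=
  Finset.sum_nonneg fun _ _ => mul_self_nonneg _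

lemma matTensorPow_eq_mixTensor (W : Matrix (Fin d) (Fin d) ℝ) :
    matTensorPow n W = mixTensor n fun _ => W := rfl

/-- Multi-indices of even length as families of pairs. -/
def pairIndexEquiv (hn : Even n) : (Fin n → Fin d) ≃ (Fin (n / 2) → Fin d × Fin d) where
  toFun i l := (i ⟨2 * (l : ℕ), by omega⟩, i ⟨2 * (l : ℕ) + 1, by omega⟩)
  invFun q r :=
    if (r : ℕ) % 2 = 0 then (q ⟨r / 2, by obtain ⟨c, hc⟩ := hn; omega⟩).1
    else (q ⟨r / 2, by obtain ⟨c, hc⟩ := hn; omega⟩).2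
  left_inv i := by
    funext r
    by_cases h : (r : ℕ) % 2 = 0
    · simp only [h, if_true]
      congr 1
      ext
      simp only
      omega
    · simp only [h, if_false]
      congr 1
      ext
      simp only
      omega
  right_inv q := by
    funext l
    have h1 : 2 * (l : ℕ) / 2 = l := by omega
    have h2 : (2 * (l : ℕ) + 1) / 2 = l := by omega
    simp [h2, Nat.add_mod]

/-- Grouping the indices in pairs turns the sum over multi-indices into a product of independent
sums. -/
lemma tensorInner_mixTensor (hn : Even n) (A B : Fin (n / 2) → Matrix (Fin d) (Fin d) ℝ) :
    tensorInner (mixTensor n A) (mixTensor n B) = ∏ l, frobInner (A l) (B l) := by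
  have h : ∀ l, frobInner (A l) (B l) = ∑ ab : Fin d × Fin d, A l ab.1 ab.2 * B l ab.1 ab.2 :=
    fun l => by rw [Fintype.sum_prod_type]; rfl
  simp_rw [h]
  rw [Finset.prod_univ_sum, Fintype.piFinset_univ, tensorInner,
    ← (pairIndexEquiv (d := d) hn).sum_comp]
  refine Finset.sum_congr rfl fun i _ => ?_
  rw [mixTensor, mixTensor, ← Finset.prod_mul_distrib]
  rfl

lemma vecTensorPow_eq_mixTensor (hn : Even n) (v : EuclideanSpace ℝ (Fin d)) :
    vecTensorPow n v = mixTensor n fun _ => Matrix.vecMulVec v.ofLp v.ofLp := by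
  funext i
  obtain ⟨c, rfl⟩ := hn
  simp only [vecTensorPow, mixTensor, Matrix.vecMulVec_apply]
  have e : ∏ l, v.ofLp (i l) = ∏ r ∈ Finset.range (c + c), if h : r < c + c then v.ofLp (i ⟨r, h⟩) else 1 := by
    rw [Finset.prod_range]
    simp
  have hc : (c + c) / 2 = c := by omega
  rw [e]
  have e2 : ∏ l : Fin ((c + c) / 2), v.ofLp (i ⟨2 * (l : ℕ), by omega⟩) * v.ofLp (i ⟨2 * (l : ℕ) + 1, by omega⟩)
     = ∏ r ∈ Finset.range ((c + c) / 2),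
        (if h : 2 * r < c + c then v.ofLp (i ⟨2 * r, h⟩) else 1)
        * (if h : 2 * r + 1 < c + c then v.ofLp (i ⟨2 * r + 1, h⟩) else 1) := by
    rw [Finset.prod_range]
    refine Finset.prod_congr rfl fun l _ => ?_
    rw [dif_pos (by omega), dif_pos (by omega)]
  rw [e2, hc]
  have key : ∀ (f : ℕ → ℝ) (c : ℕ), ∏ r ∈ Finset.range (c + c), f r
      = ∏ r ∈ Finset.range c, f (2 * r) * f (2 * r + 1) := by
    intro f c
    induction c with
    | zero => simp
    | succ c ih =>
      rw [show c + 1 + (c + 1) = c + c + 1 + 1 by ring, Finset.prod_range_succ,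
        Finset.prod_range_succ, ih, Finset.prod_range_succ, mul_assoc]
      ring_nf
  exact key (fun r => if h : r < c + c then v.ofLp (i ⟨r, h⟩) else 1) c

lemma prod_update_const (m : ℕ) (l : Fin m) (x y : ℝ) :
    ∏ j, Function.update (fun _ => y) l x j = x * y ^ (m - 1) := by
  rw [Finset.prod_update_of_mem (Finset.mem_univ _)]
  simp [Finset.card_sdiff]

lemma tensorInner_dirTensor_mixTensor (hn : Even n) (W X Z : Matrix (Fin d) (Fin d) ℝ) :
    tensorInner (dirTensor n W X) (mixTensor n fun _ => Z)
      = (n / 2 : ℕ) * (frobInner X Z * frobInner W Z ^ (n / 2 - 1)) := by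
  rw [dirTensor, tensorInner_sum_left]
  have : ∀ l : Fin (n / 2), tensorInner (mixTensor n (Function.update (fun _ => W) l X))
      (mixTensor n fun _ => Z) = frobInner X Z * frobInner W Z ^ (n / 2 - 1) := by
    intro l
    rw [tensorInner_mixTensor hn, ← prod_update_const (n / 2) l]
    refine Finset.prod_congr rfl fun j _ => ?_
    by_cases h : j = l
    · subst h; simp
    · simp [h]
  simp [this]

/-- Among the pairs of summands, the diagonal ones match X with X once; the others match X with W
twice. -/
lemma tensorInner_dirTensor_self (hn : Even n) (h4 : 4 ≤ n) (W X : Matrix (Fin d) (Fin d) ℝ) :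
    tensorInner (dirTensor n W X) (dirTensor n W X)
      = (n / 2 : ℕ) * (frobInner X X * frobInner W W ^ (n / 2 - 1)
        + ((n / 2 : ℕ) - 1) * (frobInner X W ^ 2 * frobInner W W ^ (n / 2 - 2))) := by
  nth_rewrite 1 [dirTensor]
  rw [tensorInner_sum_left]
  have key : ∀ l l' : Fin (n / 2), tensorInner (mixTensor n (Function.update (fun _ => W) l X))
      (mixTensor n (Function.update (fun _ => W) l' X))
      = if l' = l then frobInner X X * frobInner W W ^ (n / 2 - 1)
        else frobInner X W ^ 2 * frobInner W W ^ (n / 2 - 2) := by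
    intro l l'
    rw [tensorInner_mixTensor hn]
    split_ifs with h
    · subst h
      rw [← prod_update_const (n / 2) l']
      refine Finset.prod_congr rfl fun j _ => ?_
      by_cases h : j = l'
      · subst h; simp
      · simp [h]
    · rw [← Finset.mul_prod_erase _ _ (Finset.mem_univ l),
        ← Finset.mul_prod_erase _ _ (Finset.mem_erase.2 ⟨h, Finset.mem_univ l'⟩)]
      rw [Finset.prod_congr rfl (g := fun _ => frobInner W W)]
      · rw [Finset.prod_const, Finset.card_erase_of_mem (Finset.mem_erase.2 ⟨h, Finset.mem_univ l'⟩),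
          Finset.card_erase_of_mem (Finset.mem_univ l)]
        have h' : l ≠ l' := fun e => h e.symm
        simp [h, h', frobInner_comm W X]
        rw [show n / 2 - 1 - 1 = n / 2 - 2 by omega]
        ring
      · intro j hj
        simp only [Finset.mem_erase, Finset.mem_univ, and_true] at hj
        simp [hj.1, hj.2]
  have key2 : ∀ l : Fin (n / 2), tensorInner (mixTensor n (Function.update (fun _ => W) l X))
      (dirTensor n W X) = frobInner X X * frobInner W W ^ (n / 2 - 1)
        + ((n / 2 : ℕ) - 1) * (frobInner X W ^ 2 * frobInner W W ^ (n / 2 - 2)) := by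
    intro l
    rw [tensorInner_comm, dirTensor, tensorInner_sum_left,
      Finset.sum_congr rfl fun l' _ => (tensorInner_comm _ _).trans (key l l'),
      ← Finset.add_sum_erase _ _ (Finset.mem_univ l), if_pos rfl,
      Finset.sum_congr rfl (g := fun _ => frobInner X W ^ 2 * frobInner W W ^ (n / 2 - 2))]
    · rw [Finset.sum_const, Finset.card_erase_of_mem (Finset.mem_univ l)]
      simp only [Finset.card_univ, Fintype.card_fin, nsmul_eq_mul]
      rw [Nat.cast_sub (by omega)]
      simp
    · intro j hj
      rw [if_neg (Finset.ne_of_mem_erase hj)]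
  simp only [key2, Finset.sum_const, Finset.card_univ, Fintype.card_fin, nsmul_eq_mul]

/-- The derivative tensor alone has a term of order m² in ⟨X,W⟩². The correction with coefficient m
- 2 in the step cancels it: m(m-1) - 2m(m-2) + (m-2)² = 4 - m. This leaves a noise variance linear
in m. -/
lemma tensorInner_updTensor_self_le (hn : Even n) (h4 : 4 ≤ n) (W X : Matrix (Fin d) (Fin d) ℝ) :
    tensorInner (updTensor n W X) (updTensor n W X)
      ≤ 2 * (n / 2 : ℕ) * frobNorm W ^ 2 * frobInner X X := by
  obtain ⟨m, hm, rfl⟩ : ∃ m, 2 ≤ m ∧ n = 2 * m := by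
    obtain ⟨c, hc⟩ := hn
    exact ⟨c, by omega, by omega⟩
  have hm' : 2 * m / 2 = m := by omega
  have hM : (2 : ℝ) ≤ m := by exact_mod_cast hm
  have hXX := frobInner_self_nonneg X
  have hexp : tensorInner (updTensor (2 * m) W X) (updTensor (2 * m) W X)
      = ((frobNorm W ^ (m - 2))⁻¹) ^ 2 * (m * (frobInner X X * frobInner W W ^ (m - 1)
          + (m - 1) * (frobInner X W ^ 2 * frobInner W W ^ (m - 2))))
        - 2 * (frobNorm W ^ (m - 2))⁻¹ * (((m : ℝ) - 2) / frobNorm W ^ m * frobInner X W)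
          * (m * (frobInner X W * frobInner W W ^ (m - 1)))
        + (((m : ℝ) - 2) / frobNorm W ^ m * frobInner X W) ^ 2 * frobInner W W ^ m := by
    have e1 := tensorInner_dirTensor_self hn h4 W X
    have e2 := tensorInner_dirTensor_mixTensor hn W X W
    have e3 := tensorInner_mixTensor hn (fun _ => W) (fun _ => W)
    rw [hm'] at e1
    conv_rhs at e2 => rw [hm']
    simp only [Finset.prod_const, Finset.card_univ, Fintype.card_fin, hm'] at e3
    rw [updTensor, matTensorPow_eq_mixTensor]
    simp only [tensorInner_sub_left, tensorInner_sub_right, tensorInner_smul_left,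
      tensorInner_smul_right, hm', e1, e2, e3,
      tensorInner_comm (mixTensor (2 * m) fun _ => W) (dirTensor (2 * m) W X)]
    ring
  rw [hexp, hm', ← frobNorm_sq W]
  rcases eq_or_lt_of_le (frobNorm_nonneg W) with h0 | h0
  · rw [← h0]
    have : (m : ℕ) ≠ 0 := by omega
    have h1 : m - 1 ≠ 0 := by omega
    have hXW : frobInner X W = 0 := by
      have := abs_frobInner_le X W
      rw [← h0, mul_zero] at this
      exact abs_nonpos_iff.1 this
    simp [hXW, h1]
  · set F := frobNorm W
    have hq : frobInner X W ^ 2 ≤ F ^ 2 * frobInner X X := by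
      rw [← frobNorm_sq X]
      have := abs_frobInner_le X W
      calc frobInner X W ^ 2 = |frobInner X W| ^ 2 := (sq_abs _).symm
        _ ≤ (frobNorm X * F) ^ 2 := by gcongr
        _ = _ := by ring
    obtain ⟨j, rfl⟩ : ∃ j, m = j + 2 := ⟨m - 2, by omega⟩
    have hF : F ≠ 0 := h0.ne'
    have e : j + 2 - 1 = j + 1 := by omega
    simp only [Nat.add_sub_cancel, e]
    push_cast at hM ⊢
    -- With m = j + 2, the surviving coefficient 4 - m is 2 - j.
    have : (F ^ j)⁻¹ ^ 2 * ((j + 2 : ℝ) * (frobInner X X * (F ^ 2) ^ (j + 1)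
          + ((j : ℝ) + 2 - 1) * (frobInner X W ^ 2 * (F ^ 2) ^ j)))
        - 2 * (F ^ j)⁻¹ * (((j : ℝ) + 2 - 2) / F ^ (j + 2) * frobInner X W)
          * ((j + 2 : ℝ) * (frobInner X W * (F ^ 2) ^ (j + 1)))
        + (((j : ℝ) + 2 - 2) / F ^ (j + 2) * frobInner X W) ^ 2 * (F ^ 2) ^ (j + 2)
        = (j + 2) * F ^ 2 * frobInner X X + (2 - j) * frobInner X W ^ 2 := by
      field_simp
      ring
    rw [this]
    have hj : (0 : ℝ) ≤ j := Nat.cast_nonneg _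
    nlinarith [sq_nonneg (frobInner X W), mul_nonneg hj (sq_nonneg (frobInner X W)), mul_nonneg hj (sub_nonneg.2 hq)]

end Tensors

/-! ### One step of the algorithm, tested against a fixed direction. -/

section Step

variable {d n : ℕ}

lemma hasDerivAt_mixTensor (W X : Matrix (Fin d) (Fin d) ℝ) (i : Fin n → Fin d) :
    HasDerivAt (fun s : ℝ => matTensorPow n (W + s • X) i) (dirTensor n W X i) 0 := by
  have h : ∀ l : Fin (n / 2), HasDerivAt (fun s : ℝ =>
      (W + s • X) (i ⟨2 * (l : ℕ), by omega⟩) (i ⟨2 * (l : ℕ) + 1, by omega⟩))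
      (X (i ⟨2 * (l : ℕ), by omega⟩) (i ⟨2 * (l : ℕ) + 1, by omega⟩)) 0 := by
    intro l
    simpa using ((hasDerivAt_id (0 : ℝ)).mul_const
      (X (i ⟨2 * (l : ℕ), by omega⟩) (i ⟨2 * (l : ℕ) + 1, by omega⟩))).const_add
      (W (i ⟨2 * (l : ℕ), by omega⟩) (i ⟨2 * (l : ℕ) + 1, by omega⟩))
  have := HasDerivAt.fun_finsetProd (u := Finset.univ) (fun l _ => h l)
  refine this.congr_deriv ?_
  rw [dirTensor, Finset.sum_apply]
  refine Finset.sum_congr rfl fun l _ => ?_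
  rw [mixTensor, ← Finset.mul_prod_erase _ _ (Finset.mem_univ l), smul_eq_mul, mul_comm]
  simp only [Function.update_self, zero_smul, add_zero]
  congr 1
  refine Finset.prod_congr rfl fun j hj => ?_
  rw [Function.update_of_ne (Finset.ne_of_mem_erase hj)]

lemma matGrad_tensorInner (S : Tensor d n) (W : Matrix (Fin d) (Fin d) ℝ) (a b : Fin d) :
    matGrad (fun W => tensorInner (matTensorPow n W) S) W a b
      = tensorInner (dirTensor n W (Matrix.single a b 1)) S := by
  rw [matGrad, Matrix.of_apply]
  refine HasDerivAt.deriv ?_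
  simp only [tensorInner]
  exact HasDerivAt.fun_sum fun i _ => (hasDerivAt_mixTensor W _ i).mul_const _

lemma mixTensor_update_eq (W X : Matrix (Fin d) (Fin d) ℝ) (l : Fin (n / 2)) :
    mixTensor n (Function.update (fun _ => W) l X)
      = ∑ a, ∑ b, X a b • mixTensor n (Function.update (fun _ => W) l (Matrix.single a b 1)) := by
  funext i
  have h : ∀ Z : Matrix (Fin d) (Fin d) ℝ, mixTensor n (Function.update (fun _ => W) l Z) i
      = Z (i ⟨2 * (l : ℕ), by omega⟩) (i ⟨2 * (l : ℕ) + 1, by omega⟩)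
        * ∏ j ∈ Finset.univ.erase l,
          W (i ⟨2 * (j : ℕ), by omega⟩) (i ⟨2 * (j : ℕ) + 1, by omega⟩) := by
    intro Z
    rw [mixTensor, ← Finset.mul_prod_erase _ _ (Finset.mem_univ l)]
    simp only [Function.update_self]
    congr 1
    refine Finset.prod_congr rfl fun j hj => ?_
    rw [Function.update_of_ne (Finset.ne_of_mem_erase hj)]
  simp only [Finset.sum_apply, Pi.smul_apply, h, smul_eq_mul, ← mul_assoc, ← Finset.sum_mul]
  congr 1
  simp [Matrix.single_apply, ite_and]

lemma frobInner_matGrad (S : Tensor d n) (W X : Matrix (Fin d) (Fin d) ℝ) :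
    frobInner X (matGrad (fun W => tensorInner (matTensorPow n W) S) W)
      = tensorInner (dirTensor n W X) S := by
  simp only [frobInner, matGrad_tensorInner]
  have h : dirTensor n W X = ∑ a, ∑ b, X a b • dirTensor n W (Matrix.single a b 1) := by
    simp only [dirTensor, Finset.smul_sum, mixTensor_update_eq W X]
    rw [Finset.sum_comm]
    refine Finset.sum_congr rfl fun a _ => ?_
    rw [Finset.sum_comm]
  rw [h]
  simp only [tensorInner_sum_left, tensorInner_smul_left]

/-- Testing against a fixed X makes the increment linear in the reward tensor, so signal and noise
separate. -/
lemma frobInner_nsgaStep (hn : Even n) (η : ℝ) (S : Tensor d n) (W X : Matrix (Fin d) (Fin d) ℝ) :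
    frobInner X (nsgaStep n η (fun W => tensorInner (matTensorPow n W) S) W)
      = frobInner X W + η * tensorInner (updTensor n W X) S := by
  rw [nsgaStep, frobInner_add_right, frobInner_smul_right, frobInner_smul_right,
    frobInner_matGrad, updTensor, tensorInner_sub_left, tensorInner_smul_left,
    tensorInner_smul_left]
  have : (n : ℝ) = 2 * (n / 2 : ℕ) := by
    obtain ⟨c, rfl⟩ := hn
    rw [show (c + c) / 2 = c by omega]
    push_cast; ring
  have e : η * ((n : ℝ) - 4) / (2 * frobNorm W ^ (n / 2))
      = η * (((n / 2 : ℕ) - 2 : ℝ) / frobNorm W ^ (n / 2)) := by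
    rw [this, show (2 * ((n / 2 : ℕ) : ℝ) - 4) = 2 * ((n / 2 : ℕ) - 2) by ring]
    rw [mul_left_comm, mul_div_mul_left _ _ two_ne_zero, mul_div_assoc]
  rw [e]
  ring

lemma matrix_eq_of_frobInner {A B : Matrix (Fin d) (Fin d) ℝ}
    (h : ∀ X, frobInner X A = frobInner X B) : A = B := by
  ext i j
  simpa [frobInner, Matrix.single_apply, ite_and] using h (Matrix.single i j 1)

lemma updTensor_smul (h4 : 4 ≤ n) (W X : Matrix (Fin d) (Fin d) ℝ) {c : ℝ} (hc : 0 < c) :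
    updTensor n (c • W) X = c • updTensor n W X := by
  have h1 : ∀ l : Fin (n / 2), mixTensor n (Function.update (fun _ => c • W) l X)
      = c ^ (n / 2 - 1) • mixTensor n (Function.update (fun _ => W) l X) := by
    intro l
    funext i
    simp only [mixTensor, Pi.smul_apply, smul_eq_mul]
    rw [← Finset.mul_prod_erase _ _ (Finset.mem_univ l),
      ← Finset.mul_prod_erase _ _ (Finset.mem_univ l), mul_left_comm]
    simp only [Function.update_self]
    congr 1
    have : c ^ (n / 2 - 1) = ∏ j ∈ Finset.univ.erase l, c := by
      rw [Finset.prod_const, Finset.card_erase_of_mem (Finset.mem_univ l)]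
      simp
    rw [this, ← Finset.prod_mul_distrib]
    refine Finset.prod_congr rfl fun j hj => ?_
    rw [Function.update_of_ne (Finset.ne_of_mem_erase hj),
      Function.update_of_ne (Finset.ne_of_mem_erase hj)]
    simp
  have h2 : dirTensor n (c • W) X = c ^ (n / 2 - 1) • dirTensor n W X := by
    simp only [dirTensor, h1, Finset.smul_sum]
  have h3 : matTensorPow n (c • W) = c ^ (n / 2) • matTensorPow n W := by
    funext i
    simp [matTensorPow, Finset.prod_mul_distrib]
  rw [updTensor, updTensor, h2, h3, frobNorm_smul, abs_of_pos hc, frobInner_smul_right,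
    smul_sub, smul_smul, smul_smul, smul_smul, smul_smul]
  have hc' := hc.ne'
  congr 2
  · rw [mul_pow, mul_inv, mul_right_comm, show n / 2 - 1 = n / 2 - 2 + 1 by omega, pow_succ]
    field_simp
  · rw [mul_pow]
    field_simp

/-- The powers of the Frobenius norm in the step are chosen so that both increments have degree one;
hence positive rescaling of the iterates commutes with the algorithm. -/
lemma nsgaStep_smul (hn : Even n) (h4 : 4 ≤ n) (η : ℝ) (S : Tensor d n)
    (W : Matrix (Fin d) (Fin d) ℝ) {c : ℝ} (hc : 0 < c) :
    nsgaStep n η (fun W => tensorInner (matTensorPow n W) S) (c • W)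
      = c • nsgaStep n η (fun W => tensorInner (matTensorPow n W) S) W := by
  refine matrix_eq_of_frobInner fun X => ?_
  rw [frobInner_smul_right, frobInner_nsgaStep hn, frobInner_nsgaStep hn, updTensor_smul h4 _ _ hc,
    tensorInner_smul_left, frobInner_smul_right]
  ring

lemma tensorInner_updTensor_vecTensorPow (hn : Even n) (h4 : 4 ≤ n)
    (v : EuclideanSpace ℝ (Fin d)) (W X : Matrix (Fin d) (Fin d) ℝ) :
    tensorInner (updTensor n W X) (vecTensorPow n v)
      = (n / 2 : ℕ) * (frobInner (Matrix.vecMulVec v.ofLp v.ofLp) W / frobNorm W) ^ (n / 2 - 2)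
          * frobInner (Matrix.vecMulVec v.ofLp v.ofLp) W
          * frobInner X (Matrix.vecMulVec v.ofLp v.ofLp)
        - ((n / 2 : ℕ) - 2)
          * (frobInner (Matrix.vecMulVec v.ofLp v.ofLp) W / frobNorm W) ^ (n / 2)
          * frobInner X W := by
  rw [updTensor, tensorInner_sub_left, tensorInner_smul_left, tensorInner_smul_left,
    matTensorPow_eq_mixTensor, vecTensorPow_eq_mixTensor hn, tensorInner_dirTensor_mixTensor hn,
    tensorInner_mixTensor hn]
  simp only [Finset.prod_const, Finset.card_univ, Fintype.card_fin]
  rw [frobInner_comm W, div_pow, div_pow, show n / 2 - 1 = n / 2 - 2 + 1 by omega, pow_succ]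
  ring

/-- The tensor of order `k` representing the contraction of the first mode with `c • u`
and of the others with `G`. -/
def liftTensor {k : ℕ} (c : ℝ) (u : EuclideanSpace ℝ (Fin d)) (G : Tensor d (k - 1)) : Tensor d k :=
  fun i => if h : 0 < k then
    c * u (i ⟨0, h⟩) * G (fun r => i ⟨(r : ℕ) + 1, by omega⟩) else 0

lemma sum_firstIndex {k : ℕ} (hk : 0 < k) (f : (Fin k → Fin d) → ℝ) :
    ∑ i, f i = ∑ j : Fin (k - 1) → Fin d, ∑ a : Fin d,
      f (fun r => if h : (r : ℕ) = 0 then a else j ⟨(r : ℕ) - 1, by omega⟩) := by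
  obtain ⟨k, rfl⟩ : ∃ j, k = j + 1 := ⟨k - 1, by omega⟩
  rw [← (Fin.consEquiv fun _ : Fin (k + 1) => Fin d).sum_comp, Fintype.sum_prod_type,
    Finset.sum_comm]
  refine Finset.sum_congr rfl fun j _ => Finset.sum_congr rfl fun a _ => ?_
  congr 1
  funext r
  refine Fin.cases ?_ (fun r => ?_) r
  · simp [Fin.consEquiv]
  · simp [Fin.consEquiv]

/-- The lift is the adjoint of T ↦ c T(u). It moves pairings with contracted noise back to the
original noise, where the sub-Gaussian hypothesis applies; for c² = ‖u‖ = 1 it is isometric. -/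
lemma tensorInner_liftTensor {k : ℕ} (hk : 0 < k) (c : ℝ) (u : EuclideanSpace ℝ (Fin d))
    (G : Tensor d (k - 1)) (T : Tensor d k) :
    tensorInner (liftTensor c u G) T = tensorInner G (c • contractFirst T u) := by
  rw [tensorInner, sum_firstIndex hk, tensorInner]
  refine Finset.sum_congr rfl fun j _ => ?_
  simp only [Pi.smul_apply, contractFirst, smul_eq_mul, Finset.mul_sum]
  refine Finset.sum_congr rfl fun a _ => ?_
  simp [liftTensor, hk]
  ring

lemma contractFirst_liftTensor {k : ℕ} (hk : 0 < k) (c : ℝ) (u : EuclideanSpace ℝ (Fin d))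
    (G : Tensor d (k - 1)) : contractFirst (liftTensor c u G) u = (c * ‖u‖ ^ 2) • G := by
  funext j
  rw [EuclideanSpace.norm_eq, Real.sq_sqrt (Finset.sum_nonneg fun _ _ => sq_nonneg _)]
  simp only [contractFirst, Pi.smul_apply, smul_eq_mul, Finset.mul_sum, Finset.sum_mul]
  refine Finset.sum_congr rfl fun a _ => ?_
  simp [liftTensor, hk]
  ring

lemma tensorInner_liftTensor_self {k : ℕ} (hk : 0 < k) (c : ℝ) (u : EuclideanSpace ℝ (Fin d))
    (G : Tensor d (k - 1)) :
    tensorInner (liftTensor c u G) (liftTensor c u G) = c ^ 2 * ‖u‖ ^ 2 * tensorInner G G := by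
  rw [tensorInner_liftTensor hk, contractFirst_liftTensor hk, tensorInner_smul_right,
    tensorInner_smul_right]
  ring

lemma contractFirst_vecTensorPow {k : ℕ} (hk : 0 < k) (v u : EuclideanSpace ℝ (Fin d)) :
    contractFirst (vecTensorPow k v) u = inner ℝ v u • vecTensorPow (k - 1) v := by
  obtain ⟨k, rfl⟩ : ∃ j, k = j + 1 := ⟨k - 1, by omega⟩
  funext j
  simp only [contractFirst, vecTensorPow, Pi.smul_apply, smul_eq_mul, PiLp.inner_apply,
    Finset.sum_mul]
  refine Finset.sum_congr rfl fun a _ => ?_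
  rw [Fin.prod_univ_succ]
  simp
  ring

lemma contractFirst_observation {k : ℕ} (hk : 0 < k) (lam : ℝ) (v u : EuclideanSpace ℝ (Fin d))
    (E : Tensor d k) : contractFirst (observation lam v E) u
      = (lam * inner ℝ v u) • vecTensorPow (k - 1) v + contractFirst E u := by
  rw [mul_smul, ← contractFirst_vecTensorPow hk]
  funext j
  simp only [contractFirst, observation, Pi.add_apply, Pi.smul_apply, smul_eq_mul, mul_add,
    Finset.sum_add_distrib, Finset.mul_sum]
  congr 1
  refine Finset.sum_congr rfl fun a _ => ?_
  ring

end Step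

/-! ### Concentration for linear recursions with adapted coefficients. -/

section Concentration

variable {Ω : Type*} [mΩ : MeasurableSpace Ω] {P : Measure Ω}
  {d k N : ℕ} {E : Fin N → Ω → Tensor d k} {σ : ℝ} {S : Type*} [MeasurableSpace S]

/-- The state at time t is a function of the noise strictly before t, hence independent of the noise
at t. -/
lemma measurable_indepFun_of_recursion (hE : IsSubGaussianNoise P E σ) {Z : ℕ → Ω → S} {z₀ : S}
    (h0 : ∀ ω, Z 0 ω = z₀) {Ψ : ℕ → S × Tensor d k → S} (hΨ : ∀ t, Measurable (Ψ t))
    (hrec : ∀ t (ht : t < N) ω, Z (t + 1) ω = Ψ t (Z t ω, E ⟨t, ht⟩ ω)) (t : ℕ) :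
    (t ≤ N → Measurable (Z t)) ∧ ∀ ht : t < N, IndepFun (Z t) (E ⟨t, ht⟩) P := by
  set m : ℕ → MeasurableSpace Ω := fun t =>
    ⨆ s ∈ {s : Fin N | (s : ℕ) < t}, MeasurableSpace.comap (E s) inferInstance with hm
  have hle : ∀ s, MeasurableSpace.comap (E s) inferInstance ≤ mΩ := fun s =>
    (hE.measurable s).comap_le
  have hmle : ∀ t, m t ≤ mΩ := fun t => iSup₂_le fun s _ => hle s
  have hZ : ∀ t, t ≤ N → Measurable[m t] (Z t) := by
    intro t
    induction t with
    | zero =>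
      intro _
      rw [show Z 0 = fun _ => z₀ from funext h0]
      exact measurable_const
    | succ t ih =>
      intro ht
      have h1 : m t ≤ m (t + 1) :=
        biSup_mono fun s (hs : (s : ℕ) < t) => show (s : ℕ) < t + 1 by omega
      have h2 : MeasurableSpace.comap (E ⟨t, ht⟩) inferInstance ≤ m (t + 1) :=
        le_biSup (fun s : Fin N => MeasurableSpace.comap (E s) inferInstance)
          (show (⟨t, ht⟩ : Fin N) ∈ {s : Fin N | (s : ℕ) < t + 1} from Nat.lt_succ_self t)
      rw [show Z (t + 1) = fun ω => Ψ t (Z t ω, E ⟨t, ht⟩ ω) from funext (hrec t ht)]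
      have h3 : Measurable[m (t + 1)] (Z t) := (ih (by omega)).mono h1 le_rfl
      have h4 : Measurable[m (t + 1)] (E ⟨t, ht⟩) := (comap_measurable _).mono h2 le_rfl
      exact (hΨ t).comp (h3.prodMk h4)
  refine ⟨fun ht => (hZ t ht).mono (hmle t) le_rfl, fun ht => ?_⟩
  have hind := indep_iSup_of_disjoint hle hE.indep
    (S := {s : Fin N | (s : ℕ) < t}) (T := {⟨t, ht⟩})
    (Set.disjoint_singleton_right.2 (fun h : t < t => lt_irrefl _ h))
  rw [IndepFun_iff_Indep]
  refine indep_of_indep_of_le_left (indep_of_indep_of_le_right hind ?_) (hZ t ht.le).comap_le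
  exact le_biSup (fun s : Fin N => MeasurableSpace.comap (E s) inferInstance) (Set.mem_singleton _)

/-- Splitting cosh into its two exponentials and using the moment bound at x and -x gives the same
factor for both. -/
lemma lintegral_cosh_add_tensorInner_le (hE : IsSubGaussianNoise P E σ) (t : Fin N) (c : ℝ)
    (x : Tensor d k) :
    ∫⁻ ω, ENNReal.ofReal (Real.cosh (c + tensorInner x (E t ω))) ∂P
      ≤ ENNReal.ofReal (Real.cosh c * Real.exp (σ ^ 2 * tensorInner x x)) := by
  have h1 := hE.subGaussian t x
  have h2 := hE.subGaussian t ((-1 : ℝ) • x)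
  simp only [tensorInner_smul_left, tensorInner_smul_right] at h2
  have e : ∀ ω, Real.cosh (c + tensorInner x (E t ω))
      = Real.exp c / 2 * Real.exp (tensorInner x (E t ω))
        + Real.exp (-c) / 2 * Real.exp (-1 * tensorInner x (E t ω)) := by
    intro ω
    rw [Real.cosh_eq, neg_add, Real.exp_add, Real.exp_add, neg_one_mul]
    ring
  simp only [e]
  have i1 := (h1.1.const_mul (Real.exp c / 2))
  have i2 := (h2.1.const_mul (Real.exp (-c) / 2))
  have hint := ofReal_integral_eq_lintegral_ofReal (i1.add i2) (Filter.Eventually.of_forall fun ω => by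
    simp only [Pi.add_apply, Pi.zero_apply]; positivity)
  simp only [Pi.add_apply] at hint
  rw [← hint]
  refine ENNReal.ofReal_le_ofReal ?_
  rw [integral_add i1 i2, integral_const_mul, integral_const_mul, Real.cosh_eq]
  have h3 := mul_le_mul_of_nonneg_left h1.2 (by positivity : 0 ≤ Real.exp c / 2)
  have h4 := mul_le_mul_of_nonneg_left h2.2 (by positivity : 0 ≤ Real.exp (-c) / 2)
  rw [show (-1 : ℝ) * (-1 * tensorInner x x) = tensorInner x x by ring] at h4
  calc _ ≤ _ := add_le_add h3 h4
    _ = _ := by ring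

lemma measurable_tensorInner {α : Type*} [MeasurableSpace α] {f g : α → Tensor d k}
    (hf : Measurable f) (hg : Measurable g) : Measurable fun x => tensorInner (f x) (g x) := by
  unfold tensorInner
  exact Finset.measurable_sum _ fun i _ =>
    ((measurable_pi_apply i).comp hf).mul ((measurable_pi_apply i).comp hg)

/-- Exponential moments of a contracting linear recursion driven by sub-Gaussian noise, whose
coefficients are functions of an adapted state. -/
lemma lintegral_cosh_le [IsProbabilityMeasure P] (hE : IsSubGaussianNoise P E σ) {Y : ℕ → Ω → S} {y₀ : S}
    (hY0 : ∀ ω, Y 0 ω = y₀) {Φ : ℕ → S × Tensor d k → S} (hΦ : ∀ t, Measurable (Φ t))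
    (hY : ∀ t (ht : t < N) ω, Y (t + 1) ω = Φ t (Y t ω, E ⟨t, ht⟩ ω))
    {κ : ℕ → S → ℝ} (hκ : ∀ t, Measurable (κ t))
    {H : ℕ → S → Tensor d k} (hH : ∀ t, Measurable (H t))
    {U : ℕ → Ω → ℝ} (hU0 : ∀ ω, U 0 ω = 0)
    (hU : ∀ t (ht : t < N) ω, U (t + 1) ω
      = κ t (Y t ω) * U t ω + tensorInner (H t (Y t ω)) (E ⟨t, ht⟩ ω))
    {κb s V : ℕ → ℝ} (hκb : ∀ t y, |κ t y| ≤ κb t)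
    (hs : ∀ t y, tensorInner (H t y) (H t y) ≤ s t)
    (hV0 : 0 ≤ V 0) (hV : ∀ t < N, κb t ^ 2 * V t + s t ≤ V (t + 1)) (t : ℕ) (ht : t ≤ N) :
    Measurable (U t) ∧ ∀ θ : ℝ, ∫⁻ ω, ENNReal.ofReal (Real.cosh (θ * U t ω)) ∂P
      ≤ ENNReal.ofReal (Real.exp (σ ^ 2 * θ ^ 2 * V t)) := by
  set Z : ℕ → Ω → S × ℝ := fun t ω => (Y t ω, U t ω) with hZ
  set Ψ : ℕ → (S × ℝ) × Tensor d k → S × ℝ := fun t q =>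
    (Φ t (q.1.1, q.2), κ t q.1.1 * q.1.2 + tensorInner (H t q.1.1) q.2) with hΨ
  have hΨm : ∀ t, Measurable (Ψ t) := by
    intro t
    have h1 : Measurable fun q : (S × ℝ) × Tensor d k => q.1.1 := measurable_fst.fst
    refine ((hΦ t).comp (h1.prodMk measurable_snd)).prodMk ?_
    refine (((hκ t).comp h1).mul measurable_fst.snd).add ?_
    exact measurable_tensorInner ((hH t).comp h1) measurable_snd
  have hrec := measurable_indepFun_of_recursion hE (Z := Z) (z₀ := (y₀, 0)) (Ψ := Ψ)
    (fun ω => by simp [hZ, hY0, hU0]) hΨm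
    (fun t ht ω => by simp only [hZ, hΨ, hY t ht, hU t ht])
  have hmeas : ∀ t ≤ N, Measurable (U t) := fun t ht => ((hrec t).1 ht).snd
  refine ⟨hmeas t ht, ?_⟩
  induction t with
  | zero =>
    intro θ
    simp only [hU0, mul_zero, Real.cosh_zero, ENNReal.ofReal_one, lintegral_one, measure_univ]
    rw [← ENNReal.ofReal_one]
    exact ENNReal.ofReal_le_ofReal (Real.one_le_exp (by positivity))
  | succ t ih =>
    intro θ
    have htN : t < N := ht
    have ih := ih htN.le
    have hZm := (hrec t).1 htN.le
    have hEm := hE.measurable ⟨t, htN⟩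
    have hind := (indepFun_iff_map_prod_eq_prod_map_map hZm.aemeasurable hEm.aemeasurable).1
      ((hrec t).2 htN)
    set F : (S × ℝ) × Tensor d k → ENNReal := fun q => ENNReal.ofReal (Real.cosh
      (θ * (Ψ t q).2)) with hF
    have hFm : Measurable F := by
      refine ENNReal.measurable_ofReal.comp (Real.measurable_cosh.comp ?_)
      exact (hΨm t).snd.const_mul θ
    have hκb0 : 0 ≤ κb t := (abs_nonneg _).trans (hκb t y₀)
    calc ∫⁻ ω, ENNReal.ofReal (Real.cosh (θ * U (t + 1) ω)) ∂P
        = ∫⁻ ω, F (Z t ω, E ⟨t, htN⟩ ω) ∂P := by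
          refine lintegral_congr fun ω => ?_
          simp only [hF, hΨ, hZ, hU t htN]
      _ = ∫⁻ q, F q ∂(P.map fun ω => (Z t ω, E ⟨t, htN⟩ ω)) :=
          (lintegral_map hFm (hZm.prodMk hEm)).symm
      _ = ∫⁻ z, ∫⁻ e, F (z, e) ∂(P.map (E ⟨t, htN⟩)) ∂(P.map (Z t)) := by
          have := Measure.isProbabilityMeasure_map (μ := P) hEm.aemeasurable
          rw [hind, lintegral_prod _ hFm.aemeasurable]
      _ = ∫⁻ ω', ∫⁻ ω, F (Z t ω', E ⟨t, htN⟩ ω) ∂P ∂P := by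
          have := Measure.isProbabilityMeasure_map (μ := P) hEm.aemeasurable
          rw [lintegral_map hFm.lintegral_prod_right' hZm]
          refine lintegral_congr fun ω' => ?_
          exact lintegral_map (hFm.comp measurable_prodMk_left) hEm
      _ ≤ ∫⁻ ω', ENNReal.ofReal (Real.exp (σ ^ 2 * θ ^ 2 * s t)) *
            ENNReal.ofReal (Real.cosh ((θ * κb t) * U t ω')) ∂P := by
          refine lintegral_mono fun ω' => ?_
          have h := lintegral_cosh_add_tensorInner_le hE ⟨t, htN⟩
            (θ * (κ t (Y t ω') * U t ω')) (θ • H t (Y t ω'))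
          simp only [tensorInner_smul_left, tensorInner_smul_right, ← mul_add] at h
          refine h.trans ?_
          rw [← ENNReal.ofReal_mul (Real.exp_pos _).le, mul_comm (Real.cosh _)]
          refine ENNReal.ofReal_le_ofReal (mul_le_mul ?_ ?_ (Real.cosh_pos _).le (Real.exp_pos _).le)
          · rw [Real.exp_le_exp]
            have := mul_le_mul_of_nonneg_left (hs t (Y t ω')) (by positivity : 0 ≤ σ ^ 2 * θ ^ 2)
            calc _ = σ ^ 2 * θ ^ 2 * tensorInner (H t (Y t ω')) (H t (Y t ω')) := by ring
              _ ≤ _ := this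
          -- This is the reason for cosh instead of exp: it is even and increasing in the modulus,
          -- so a random coefficient of either sign may be replaced by its bound.
          · rw [Real.cosh_le_cosh, abs_mul, abs_mul, abs_mul, abs_mul, abs_of_nonneg hκb0,
              mul_assoc]
            gcongr
            exact hκb t _
      _ = ENNReal.ofReal (Real.exp (σ ^ 2 * θ ^ 2 * s t)) *
            ∫⁻ ω', ENNReal.ofReal (Real.cosh ((θ * κb t) * U t ω')) ∂P := by
          rw [lintegral_const_mul]
          exact ENNReal.measurable_ofReal.comp (Real.measurable_cosh.comp
            ((hmeas t htN.le).const_mul _))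
      _ ≤ ENNReal.ofReal (Real.exp (σ ^ 2 * θ ^ 2 * s t)) *
            ENNReal.ofReal (Real.exp (σ ^ 2 * (θ * κb t) ^ 2 * V t)) := by
          gcongr
          exact ih _
      _ ≤ _ := by
          rw [← ENNReal.ofReal_mul (Real.exp_pos _).le, ← Real.exp_add]
          refine ENNReal.ofReal_le_ofReal (Real.exp_le_exp.2 ?_)
          have := mul_le_mul_of_nonneg_left (hV t htN) (by positivity : 0 ≤ σ ^ 2 * θ ^ 2)
          calc _ = σ ^ 2 * θ ^ 2 * (κb t ^ 2 * V t + s t) := by ring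
            _ ≤ _ := this

/-- Chernoff's bound, two-sided at once because cosh is even. -/
lemma measure_le_abs_of_lintegral_cosh_le {U : Ω → ℝ} (hUm : Measurable U) {V v z L : ℝ}
    (hσ : 0 < σ) (hU : ∀ θ : ℝ, ∫⁻ ω, ENNReal.ofReal (Real.cosh (θ * U ω)) ∂P
      ≤ ENNReal.ofReal (Real.exp (σ ^ 2 * θ ^ 2 * V)))
    (hVv : V ≤ v) (hv : 0 < v) (hL : 0 ≤ L) (hz0 : 0 ≤ z) (hz : 4 * σ ^ 2 * v * L ≤ z ^ 2) :
    P {ω | z < |U ω|} ≤ ENNReal.ofReal (2 * Real.exp (-L)) := by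
  set w := Real.sqrt (4 * σ ^ 2 * v * L) with hw
  have hw0 : 0 ≤ w := Real.sqrt_nonneg _
  have hwsq : w ^ 2 = 4 * σ ^ 2 * v * L := Real.sq_sqrt (by positivity)
  have hwz : w ≤ z := by
    rw [hw]
    exact Real.sqrt_le_iff.2 ⟨hz0, hz⟩
  -- The minimiser of σ²θ²v - θw; the two terms are then L and 2L.
  set θ := w / (2 * σ ^ 2 * v) with hθ
  have hθ0 : 0 ≤ θ := by positivity
  have e1 : σ ^ 2 * θ ^ 2 * v = L := by
    rw [hθ, div_pow, hwsq]
    field_simp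
    ring
  have e2 : θ * w = 2 * L := by
    rw [hθ, div_mul_eq_mul_div, ← sq, hwsq]
    field_simp
    ring
  have hsub : {ω | z < |U ω|} ⊆ {ω | ENNReal.ofReal (Real.exp (2 * L) / 2)
      ≤ ENNReal.ofReal (Real.cosh (θ * U ω))} := by
    intro ω (hω : z < |U ω|)
    refine ENNReal.ofReal_le_ofReal ?_
    rw [← Real.cosh_abs, abs_mul, abs_of_nonneg hθ0]
    have h1 : 2 * L ≤ θ * |U ω| := by
      rw [← e2]
      exact mul_le_mul_of_nonneg_left (hwz.trans hω.le) hθ0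
    rw [Real.cosh_eq]
    have h2 := Real.exp_le_exp.2 h1
    have h3 := Real.exp_pos (-(θ * |U ω|))
    linarith
  have hm : Measurable fun ω => ENNReal.ofReal (Real.cosh (θ * U ω)) :=
    ENNReal.measurable_ofReal.comp (Real.measurable_cosh.comp (hUm.const_mul _))
  have hpos : 0 < Real.exp (2 * L) / 2 := by positivity
  refine (measure_mono hsub).trans ((meas_ge_le_lintegral_div hm.aemeasurable
    (by simpa using hpos) ENNReal.ofReal_ne_top).trans ?_)
  refine (ENNReal.div_le_div_right (hU θ) _).trans ?_
  rw [← ENNReal.ofReal_div_of_pos hpos]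
  refine ENNReal.ofReal_le_ofReal ?_
  have h1 : Real.exp (σ ^ 2 * θ ^ 2 * V) ≤ Real.exp L := by
    rw [← e1]
    exact Real.exp_le_exp.2 (by gcongr)
  calc Real.exp (σ ^ 2 * θ ^ 2 * V) / (Real.exp (2 * L) / 2)
      ≤ Real.exp L / (Real.exp (2 * L) / 2) := by gcongr
    _ = 2 * Real.exp (-L) := by
      rw [Real.exp_neg, two_mul, Real.exp_add]
      field_simp

end Concentration

/-! ### Growth and contraction factors of a noiseless step. -/

/-- Factor by which a noiseless step with `y = η g` multiplies the components orthogonal to the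
signal, at an iterate of correlation `r` with the signal. -/
def stepA (m : ℕ) (y r : ℝ) : ℝ := 1 - y * ((m : ℝ) - 2) * r ^ m

/-- Additional growth factor of the signal component in a noiseless step. -/
def stepB (m : ℕ) (y r : ℝ) : ℝ := y * m * r ^ (m - 2)

/-- The normalising factor of a step. -/
def stepC (m : ℕ) (y r : ℝ) : ℝ := max 1 (stepA m y r + stepB m y r)

/-- Factor by which a normalised noiseless step multiplies the orthogonal components. -/
def stepK (m : ℕ) (y r : ℝ) : ℝ := stepA m y r / stepC m y r

section StepFactors

variable {m : ℕ} {y r : ℝ}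

lemma one_le_stepC : 1 ≤ stepC m y r := le_max_left _ _

lemma stepC_pos : 0 < stepC m y r := one_pos.trans_le one_le_stepC

lemma stepB_nonneg (hy : 0 ≤ y) (hr : 0 ≤ r) : 0 ≤ stepB m y r := by
  unfold stepB; positivity

/-- (m-2)r^m ≤ m r^{m-2} on [0,1]. So the maximum in `stepC` is idle at iterates correlated with the
signal; elsewhere it ensures that normalising never amplifies noise. -/
lemma one_le_stepA_add_stepB (hm : 2 ≤ m) (hy : 0 ≤ y) (hr : 0 ≤ r) (hr1 : r ≤ 1) :
    1 ≤ stepA m y r + stepB m y r := by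
  have h1 : r ^ m ≤ r ^ (m - 2) := pow_le_pow_of_le_one hr hr1 (by omega)
  have h2 : (2 : ℝ) ≤ m := by exact_mod_cast hm
  have h3 : 0 ≤ r ^ (m - 2) := by positivity
  have h4 : ((m : ℝ) - 2) * r ^ m ≤ m * r ^ (m - 2) := by
    apply mul_le_mul (by linarith) h1 (by positivity) (by positivity)
  have := mul_le_mul_of_nonneg_left h4 hy
  unfold stepA stepB
  linarith

lemma stepC_eq (hm : 2 ≤ m) (hy : 0 ≤ y) (hr : 0 ≤ r) (hr1 : r ≤ 1) :
    stepC m y r = stepA m y r + stepB m y r :=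
  max_eq_right (one_le_stepA_add_stepB hm hy hr hr1)

lemma stepA_le_one (hm : 2 ≤ m) (hy : 0 ≤ y) (hr : 0 ≤ r) : stepA m y r ≤ 1 := by
  have h2 : (2 : ℝ) ≤ m := by exact_mod_cast hm
  have : 0 ≤ y * ((m : ℝ) - 2) * r ^ m :=
    mul_nonneg (mul_nonneg hy (by linarith)) (by positivity)
  unfold stepA
  linarith

/-- Either the step contracts, or it overshoots, which happens only close to the signal. -/
lemma abs_stepK_cases (hm : 2 ≤ m) (hy : 0 ≤ y) (hr : 0 ≤ r) (hr1 : r ≤ 1) :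
    |stepK m y r| ≤ (1 + stepB m y r)⁻¹ ∨ (|stepK m y r| ≤ y * m - 1 ∧ 1 < y * m * r ^ m) := by
  have h2 : (2 : ℝ) ≤ m := by exact_mod_cast hm
  have hB := stepB_nonneg (m := m) hy hr
  rcases le_or_gt 0 (stepA m y r) with hA | hA
  · left
    have hA1 := stepA_le_one hm hy hr
    rw [stepK, stepC_eq hm hy hr hr1, abs_of_nonneg (by positivity), ← one_div]
    have h3 := one_le_stepA_add_stepB hm hy hr hr1
    -- A/(A+B) ≤ 1/(1+B) because 0 ≤ A ≤ 1.
    rw [div_le_div_iff₀ (by linarith) (by linarith)]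
    nlinarith
  · right
    have hrm : r ^ m ≤ 1 := pow_le_one₀ hr hr1
    have hrm0 : 0 ≤ r ^ m := by positivity
    have hle : y * ((m : ℝ) - 2) * r ^ m ≤ y * m * r ^ m := by
      have := mul_nonneg hy hrm0
      nlinarith
    have hle2 : y * m * r ^ m ≤ y * m := mul_le_of_le_one_right (by positivity) hrm
    have hAdef : stepA m y r = 1 - y * ((m : ℝ) - 2) * r ^ m := rfl
    refine ⟨?_, by linarith⟩
    rw [stepK, abs_div, abs_of_pos (stepC_pos (m := m) (y := y) (r := r)), abs_of_neg hA]
    refine (div_le_self (by linarith) one_le_stepC).trans ?_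
    linarith

end StepFactors

/-! ### The correlation in terms of the two components. -/

section Correlation

variable {a p : ℝ}

lemma corr_pos (ha : 0 < a) : 0 < a / √(a ^ 2 + p ^ 2) := by positivity

lemma corr_le_one (ha : 0 < a) : a / √(a ^ 2 + p ^ 2) ≤ 1 := by
  have : 0 < √(a ^ 2 + p ^ 2) := by positivity
  rw [div_le_one this]
  exact Real.le_sqrt_of_sq_le (by nlinarith [sq_nonneg p])

lemma inv_le_corr (ha : 0 < a) {w : ℝ} (hw : 0 < w) (h : a ^ 2 + p ^ 2 ≤ a ^ 2 * w ^ 2) :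
    w⁻¹ ≤ a / √(a ^ 2 + p ^ 2) := by
  have h0 : 0 < √(a ^ 2 + p ^ 2) := by positivity
  have : √(a ^ 2 + p ^ 2) ≤ a * w := Real.sqrt_le_iff.2 ⟨by positivity, by nlinarith⟩
  rw [inv_eq_one_div, div_le_div_iff₀ hw h0]
  linarith

/-- Overshooting means r^{-2m} = (1 + p²/a²)^m < e², and Bernoulli's inequality gives m p²/a² ≤ e² -
1 < 32/5. -/
lemma mul_sq_le_of_overshoot {m : ℕ} {x : ℝ} (hx : x ≤ Real.exp 1)
    (ha : 0 < a) (h : 1 < x * (a / √(a ^ 2 + p ^ 2)) ^ m) : m * p ^ 2 ≤ 32 / 5 * a ^ 2 := by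
  set r := a / √(a ^ 2 + p ^ 2) with hr
  have hr0 : 0 < r := corr_pos ha
  have h1 : 1 < Real.exp 1 * r ^ m :=
    h.trans_le (mul_le_mul_of_nonneg_right hx (by positivity))
  have h2 : 1 < Real.exp 1 ^ 2 * (r ^ 2) ^ m := by
    have : (1 : ℝ) < (Real.exp 1 * r ^ m) ^ 2 := one_lt_pow₀ h1 two_ne_zero
    calc (1 : ℝ) < _ := this
      _ = _ := by ring
  have hrsq : r ^ 2 = (1 + p ^ 2 / a ^ 2)⁻¹ := by
    rw [hr, div_pow, Real.sq_sqrt (by positivity)]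
    field_simp
  have h3 : (1 + p ^ 2 / a ^ 2) ^ m < Real.exp 1 ^ 2 := by
    rw [hrsq, inv_pow, ← div_eq_mul_inv, one_lt_div (by positivity)] at h2
    exact h2
  have h4 : 1 + (m : ℝ) * (p ^ 2 / a ^ 2) ≤ (1 + p ^ 2 / a ^ 2) ^ m :=
    one_add_mul_le_pow (by have : 0 ≤ p ^ 2 / a ^ 2 := by positivity
                           linarith) m
  have h5 : Real.exp 1 ^ 2 ≤ 37 / 5 := by
    have := Real.exp_one_lt_d9
    have h0 := Real.exp_pos 1
    nlinarith
  have h6 : (m : ℝ) * (p ^ 2 / a ^ 2) ≤ 32 / 5 := by linarith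
  rw [← mul_div_assoc, div_le_iff₀ (by positivity)] at h6
  exact h6

end Correlation

/-- Used to restart the analysis at the most recent expanding step. -/
lemma last_or_forall (Q : ℕ → Prop) (s t : ℕ) :
    (∀ r, s ≤ r → r < t → ¬ Q r) ∨ ∃ q, s ≤ q ∧ q < t ∧ Q q ∧ ∀ r, q < r → r < t → ¬ Q r := by
  induction t with
  | zero => left; intro r _ h; omega
  | succ t ih =>
    by_cases hst : s ≤ t
    · by_cases hQ : Q t
      · right
        exact ⟨t, hst, Nat.lt_succ_self t, hQ, fun r h1 h2 => by omega⟩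
      · rcases ih with h | ⟨q, h1, h2, h3, h4⟩
        · left
          intro r hr hr'
          rcases Nat.lt_succ_iff_lt_or_eq.1 hr' with h' | rfl
          · exact h r hr h'
          · exact hQ
        · right
          refine ⟨q, h1, by omega, h3, fun r hr hr' => ?_⟩
          rcases Nat.lt_succ_iff_lt_or_eq.1 hr' with h' | rfl
          · exact h4 r hr h'
          · exact hQ
    · left; intro r _ _; omega

/-- Noise of relative size ε in a and p changes 1 + q², hence the inverse squared correlation, by a
relative amount of order ε. -/
lemma noisy_sq_le {A p q w ε : ℝ} (he0 : 0 ≤ ε) (he : ε ≤ 1 / 2000) (hA : -ε ≤ A - 1)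
    (hp0 : 0 ≤ p) (hp : p ≤ q + 5 * ε * (1 + q)) (hw : w ^ 2 = 1 + q ^ 2) :
    A ^ 2 + p ^ 2 ≤ A ^ 2 * (w * (1 + 40 * ε)) ^ 2 := by
  have e1 : (q + 5 * ε * (1 + q)) ^ 2 ≤ q ^ 2 + 16 * (ε * (1 + q ^ 2)) := by
    have e : (q + 5 * ε * (1 + q)) ^ 2
        = q ^ 2 + ε * (10 * q * (1 + q) + 25 * (ε * (1 + q) ^ 2)) := by ring
    rw [e]
    have h4 : ε * (1 + q) ^ 2 ≤ 1 / 2000 * (1 + q) ^ 2 :=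
      mul_le_mul_of_nonneg_right he (sq_nonneg _)
    have h3 : 10 * q * (1 + q) + 25 * (ε * (1 + q) ^ 2) ≤ 16 * (1 + q ^ 2) := by
      nlinarith [sq_nonneg (q - 1)]
    have h5 := mul_le_mul_of_nonneg_left h3 he0
    linarith
  have e2 : p ^ 2 ≤ (q + 5 * ε * (1 + q)) ^ 2 := by gcongr
  have e3 : 1 - 2 * ε ≤ A ^ 2 := by nlinarith [sq_nonneg (A - 1)]
  have e5 : 1 + 80 * ε ≤ (1 + 40 * ε) ^ 2 := by nlinarith [sq_nonneg ε]
  have e6 : A ^ 2 * ((1 + q ^ 2) * (1 + 80 * ε)) ≤ A ^ 2 * ((1 + q ^ 2) * (1 + 40 * ε) ^ 2) := by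
    gcongr
  rw [mul_pow, hw]
  refine le_trans ?_ e6
  set u := ε * (1 + q ^ 2) with hu
  have hu0 : 0 ≤ u := by positivity
  have hqu : ε * q ^ 2 ≤ u := by rw [hu]; nlinarith
  have hεu : ε * u ≤ 1 / 2000 * u := mul_le_mul_of_nonneg_right he hu0
  have e8 : (1 - 2 * ε) * (q ^ 2 + 80 * u) ≤ A ^ 2 * (q ^ 2 + 80 * u) := by gcongr
  have e9 : A ^ 2 * ((1 + q ^ 2) * (1 + 80 * ε)) = A ^ 2 + A ^ 2 * (q ^ 2 + 80 * u) := by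
    rw [hu]; ring
  rw [e9]
  have e10 : (1 - 2 * ε) * (q ^ 2 + 80 * u) = q ^ 2 + 80 * u - 2 * (ε * q ^ 2) - 160 * (ε * u) := by
    ring
  linarith

/-- The correlation enters to the power m - 2, so the relative noise must be of order 1/m for the
loss to stay below a factor 2. -/
lemma noisy_pow_le {m : ℕ} {w ε : ℝ} (hm : 2 ≤ m) (he0 : 0 ≤ ε) (he : ε * m ≤ 1 / 1000)
    (hw : 0 ≤ w) : (w * (1 + 40 * ε)) ^ (m - 2) ≤ 2 * w ^ (m - 2) := by
  rw [mul_pow, mul_comm]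
  gcongr
  calc (1 + 40 * ε) ^ (m - 2) ≤ Real.exp (40 * ε) ^ (m - 2) := by
        gcongr
        have := Real.add_one_le_exp (40 * ε)
        linarith
    _ = Real.exp ((m - 2 : ℕ) * (40 * ε)) := by rw [← Real.exp_nat_mul]
    _ ≤ Real.exp (1 / 2) := by
        rw [Real.exp_le_exp, Nat.cast_sub hm]
        push_cast
        nlinarith
    _ ≤ 2 := by
        have := Real.exp_one_lt_d9
        have h5 : Real.exp (1 / 2) ^ 2 = Real.exp 1 := by
          rw [← Real.exp_nat_mul]; norm_num
        have := Real.exp_pos (1 / 2)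
        nlinarith

/-! ### Deterministic analysis of the orbit under bounded noise. -/

/-- The truncation levels. -/
def trunc (d l : ℕ) : ℝ := 5 * (1 + √d / 2 ^ l)

/-- The properties of the signal component `a` and of the norm `p` of the orthogonal component of
the normalised iterates that hold with high probability: `ε` bounds the accumulated noise. -/
structure NoisyOrbit (m d T N : ℕ) (y : ℕ → ℝ) (x ε : ℝ) (a p : ℕ → ℝ) : Prop where
  two_le : 2 ≤ m
  x_pos : 0 < x
  x_le : x ≤ Real.exp 1
  y_nonneg : ∀ t, 0 ≤ y t
  y_first : ∀ t < T, y t * m = x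
  y_later : ∀ t, T ≤ t → y t * m ≤ x / 2
  eps_nonneg : 0 ≤ ε
  eps_le : ε * m ≤ 1 / 1000
  p_nonneg : ∀ t, 0 ≤ p t
  p_zero : p 0 ≤ √d
  a_bound : ∀ t ≤ N, (∀ r < t, 0 < a r ∧ √(a r ^ 2 + p r ^ 2) ≤ trunc d 0) → |a t - 1| ≤ ε
  p_bound : ∀ l ≤ d, ∀ s t, s < t → t ≤ N →
    (∀ r, s ≤ r → r < t → 0 < a r ∧ √(a r ^ 2 + p r ^ 2) ≤ trunc d l) →
    -- The strict inequality s < r matters: the factor at time s acts on p s only, since noise is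
    -- accumulated from s on. A restart at an expanding step is therefore allowed.
    (∀ r, s < r → r < t → |stepK m (y r) (a r / √(a r ^ 2 + p r ^ 2))| ≤ 1) →
    p t ≤ (∏ r ∈ Finset.Ico s t, |stepK m (y r) (a r / √(a r ^ 2 + p r ^ 2))|) * p s
      + ε * trunc d l

namespace NoisyOrbit

variable {m d T N : ℕ} {y : ℕ → ℝ} {x ε : ℝ} {a p : ℕ → ℝ}

/-- The contraction factor along the orbit. -/
abbrev K (m : ℕ) (y a p : ℕ → ℝ) (r : ℕ) : ℝ := stepK m (y r) (a r / √(a r ^ 2 + p r ^ 2))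

section
variable (h : NoisyOrbit m d T N y x ε a p)
include h

lemma y_mul_le (t : ℕ) : y t * m ≤ Real.exp 1 := by
  rcases lt_or_ge t T with ht | ht
  · rw [h.y_first t ht]; exact h.x_le
  · have := h.y_later t ht
    have := h.x_pos
    have := h.x_le
    linarith

lemma eps_le' : ε ≤ 1 / 2000 := by
  have h2 : (2 : ℝ) ≤ m := by exact_mod_cast h.two_le
  have := h.eps_le
  have := h.eps_nonneg
  nlinarith

lemma a_pos {t : ℕ} (ha : |a t - 1| ≤ ε) : 0 < a t := by
  have := h.eps_le'
  have := abs_le.1 ha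
  linarith

lemma K_le {t : ℕ} (ha : |a t - 1| ≤ ε) :
    |K m y a p t| ≤ (1 + stepB m (y t) (a t / √(a t ^ 2 + p t ^ 2)))⁻¹
      ∨ (|K m y a p t| ≤ y t * m - 1 ∧ √m * p t ≤ 26 / 10) := by
  have ha0 := h.a_pos ha
  rcases abs_stepK_cases h.two_le (h.y_nonneg t) (corr_pos (p := p t) ha0).le
    (corr_le_one ha0) with h1 | ⟨h1, h2⟩
  · exact Or.inl h1
  · right
    refine ⟨h1, ?_⟩
    have h3 := mul_sq_le_of_overshoot (h.y_mul_le t) ha0 h2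
    have h4 := h.eps_le'
    have h5 := abs_le.1 ha
    -- (26/10)² exceeds 32/5 by more than a², which is close to 1, can add.
    have h6 : (√m * p t) ^ 2 ≤ (26 / 10) ^ 2 := by
      rw [mul_pow, Real.sq_sqrt (Nat.cast_nonneg m)]
      nlinarith
    exact le_of_sq_le_sq h6 (by norm_num)

/-- Only an overshoot expands, and then by at most y m - 1 ≤ e - 1 < 43/25. -/
lemma K_le_one_of_large {t : ℕ} (ha : |a t - 1| ≤ ε) (hK : 1 < |K m y a p t|) :
    |K m y a p t| ≤ 43 / 25 ∧ √m * p t ≤ 26 / 10 := by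
  rcases h.K_le ha with h1 | ⟨h1, h2⟩
  · exfalso
    have hB := stepB_nonneg (m := m) (h.y_nonneg t) (corr_pos (p := p t) (h.a_pos ha)).le
    have : (1 + stepB m (y t) (a t / √(a t ^ 2 + p t ^ 2)))⁻¹ ≤ 1 := inv_le_one_of_one_le₀ (by linarith)
    linarith
  · refine ⟨?_, h2⟩
    have := h.y_mul_le t
    have := Real.exp_one_lt_d9
    linarith

lemma sqrt_m_ge : (7 : ℝ) / 5 ≤ √m := by
  have h2 : (2 : ℝ) ≤ m := by exact_mod_cast h.two_le
  exact Real.le_sqrt_of_sq_le (by norm_num; linarith)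

lemma eps_trunc_le (l : ℕ) : ε * trunc d l ≤ 1 / 400 * (1 + √d / 2 ^ l) := by
  have h1 := h.eps_le'
  have h2 : 0 ≤ 1 + √d / 2 ^ l := by positivity
  unfold trunc
  nlinarith

/-- The factor 5 in `trunc` leaves room for a, q and the noise together, so the norm conditions in
`NoisyOrbit` reproduce themselves along the orbit. -/
lemma norm_le_of {t l : ℕ} {q : ℝ} (ha : |a t - 1| ≤ ε) (hp : p t ≤ q + ε * trunc d l)
    (hq : q ≤ 7 / 2 + √d / 2 ^ l) : √(a t ^ 2 + p t ^ 2) ≤ trunc d l := by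
  have h1 := h.eps_le'
  have h2 := h.eps_trunc_le l
  have h3 := abs_le.1 ha
  have ha0 := h.a_pos ha
  have hp0 := h.p_nonneg t
  have h0 : 0 ≤ √d / 2 ^ l := by positivity
  have h4 : a t + p t ≤ trunc d l := by unfold trunc at *; linarith
  refine Real.sqrt_le_iff.2 ⟨by linarith, ?_⟩
  nlinarith

/-- The orthogonal component stays below its value at any time, up to the region of overshoot
and up to noise. -/
lemma p_le_of_start {s l : ℕ} {q : ℝ} (hl : l ≤ d) (hq : q ≤ 7 / 2 + √d / 2 ^ l)
    (hs : p s ≤ q) (t : ℕ) (hst : s ≤ t) (htN : t ≤ N) (ha : ∀ r < t, |a r - 1| ≤ ε) :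
    p t ≤ max q (9 / 2 / √m) + ε * trunc d l := by
  have hm := h.sqrt_m_ge
  have hm0 : 0 < √(m : ℝ) := by linarith
  have htr : 0 ≤ ε * trunc d l := mul_nonneg h.eps_nonneg (by unfold trunc; positivity)
  have h0 : 0 ≤ √d / 2 ^ l := by positivity
  induction t using Nat.strong_induction_on with
  | _ t ih =>
    rcases hst.eq_or_lt with rfl | hst
    · exact hs.trans ((le_max_left _ _).trans (le_add_of_nonneg_right htr))
    -- The induction hypothesis at earlier times keeps the orbit inside the truncation, which is
    -- what the noise bound at time t needs.
    have hf : ∀ r, s ≤ r → r < t → 0 < a r ∧ √(a r ^ 2 + p r ^ 2) ≤ trunc d l := by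
      intro r hr hrt
      refine ⟨h.a_pos (ha r hrt), h.norm_le_of (ha r hrt)
        (ih r hrt hr (by omega) fun r' hr' => ha r' (by omega)) (max_le hq ?_)⟩
      rw [div_le_iff₀ hm0]
      nlinarith
    have hprod : ∀ u, (∀ r, u ≤ r → r < t → |K m y a p r| ≤ 1) →
        ∏ r ∈ Finset.Ico u t, |K m y a p r| ≤ 1 := fun u hu =>
      Finset.prod_le_one (fun _ _ => abs_nonneg _) fun r hr =>
        hu r (Finset.mem_Ico.1 hr).1 (Finset.mem_Ico.1 hr).2
    -- After the last expanding step u all factors are at most 1, so restarting there costs one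
    -- expansion and one noise term, however many overshoots occurred before.
    rcases last_or_forall (fun r => 1 < |K m y a p r|) s t with hno | ⟨u, hsu, hut, hKu, hlast⟩
    · have h1 := h.p_bound l hl s t hst htN hf fun r hr hrt => not_lt.1 (hno r hr.le hrt)
      have h2 := hprod s fun r hr hrt => not_lt.1 (hno r hr hrt)
      have h3 := mul_le_of_le_one_left (h.p_nonneg s) h2
      have := le_max_left q (9 / 2 / √m)
      linarith
    · have h1 := h.p_bound l hl u t hut htN (fun r hr hrt => hf r (by omega) hrt)
        fun r hr hrt => not_lt.1 (hlast r hr hrt)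
      obtain ⟨h4, h5⟩ := h.K_le_one_of_large (ha u hut) hKu
      have h2 := hprod (u + 1) fun r hr hrt => not_lt.1 (hlast r hr hrt)
      rw [Finset.prod_eq_prod_Ico_succ_bot hut] at h1
      have h6 : p u ≤ 26 / 10 / √m := by
        rw [le_div_iff₀ hm0]; linarith
      have h7 : |K m y a p u| * (∏ r ∈ Finset.Ico (u + 1) t, |K m y a p r|) * p u
          ≤ 43 / 25 * 1 * (26 / 10 / √m) := by
        have : 0 ≤ ∏ r ∈ Finset.Ico (u + 1) t, |K m y a p r| :=
          Finset.prod_nonneg fun _ _ => abs_nonneg _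
        have hp0 := h.p_nonneg u
        gcongr
      -- The largest expansion times the largest p at which it can occur: 4.472 < 9/2.
      have h8 : 43 / 25 * 1 * (26 / 10 / √m) ≤ 9 / 2 / √(m : ℝ) := by
        rw [← mul_div_assoc]
        gcongr
        norm_num
      have := le_max_right q (9 / 2 / √m)
      linarith

/-- Bootstrap at the coarsest level l = 0, where the initial value p ≤ √d is admissible: closeness
of a at earlier times bounds p, which keeps the truncation idle. -/
lemma a_near_one (hd : 5 ≤ d) (t : ℕ) (ht : t ≤ N) : |a t - 1| ≤ ε := by
  have hm := h.sqrt_m_ge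
  have hm0 : 0 < √(m : ℝ) := by linarith
  induction t using Nat.strong_induction_on with
  | _ t ih =>
    refine h.a_bound t ht fun r hr => ?_
    have har := ih r hr (by omega)
    refine ⟨h.a_pos har, ?_⟩
    have h1 : √(d : ℝ) ≤ 7 / 2 + √d / 2 ^ 0 := by simp; norm_num
    refine h.norm_le_of har (h.p_le_of_start (Nat.zero_le d) h1 h.p_zero r (Nat.zero_le r)
      (by omega) fun r' hr' => ih r' (by omega) (by omega)) (max_le h1 ?_)
    rw [div_le_iff₀ hm0]
    have : 0 ≤ √(d : ℝ) / 2 ^ 0 := by positivity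
    nlinarith

/-- As long as the orthogonal component is not small, it halves within a controlled time. -/
lemma halve (hd : 5 ≤ d) (hTN : T ≤ N) {l s D : ℕ} (hl : l ≤ d)
    (hbig : ∀ r ≤ T, 3 / √m < p r) (hps : p s ≤ √d / 2 ^ l) (hsD : s + D ≤ T)
    (hD : 8 * √(1 + (√d / 2 ^ l) ^ 2) ^ (m - 2) ≤ D * x) :
    p (s + D) ≤ √d / 2 ^ (l + 1) := by
  have hm := h.sqrt_m_ge
  have hm0 : 0 < √(m : ℝ) := by linarith
  set q := √d / 2 ^ l with hq
  have hq0 : 0 ≤ q := by positivity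
  have ha : ∀ r ≤ N, |a r - 1| ≤ ε := fun r hr => h.a_near_one hd r hr
  have hx := h.x_pos
  have he0 := h.eps_nonneg
  have he := h.eps_le'
  have hem := h.eps_le
  have h2 : (2 : ℝ) ≤ m := by exact_mod_cast h.two_le
  set w := √(1 + q ^ 2) with hw
  have hw1 : 1 ≤ w := Real.one_le_sqrt.2 (by nlinarith)
  have hwsq : w ^ 2 = 1 + q ^ 2 := Real.sq_sqrt (by positivity)
  have hq3 : 3 / √m < q := (hbig s (by omega)).trans_le hps
  have hD0 : 0 < D := by
    rcases Nat.eq_zero_or_pos D with rfl | hD0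
    · exfalso
      have : 0 < 8 * w ^ (m - 2) := by positivity
      simp at hD
      linarith
    · exact hD0
  have hf : ∀ r, s ≤ r → r < s + D → 0 < a r ∧ √(a r ^ 2 + p r ^ 2) ≤ trunc d l := by
    intro r hr hrt
    have har := ha r (by omega)
    refine ⟨h.a_pos har, ?_⟩
    have h1 : q ≤ 7 / 2 + √d / 2 ^ l := by linarith
    refine h.norm_le_of har (h.p_le_of_start hl h1 hps r hr (by omega) fun r' hr' =>
      ha r' (by omega)) (max_le h1 ?_)
    rw [div_le_iff₀ hm0]
    nlinarith
  -- Overshooting needs √m p ≤ 26/10 and is excluded while p > 3/√m.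
  have hK : ∀ r ≤ T, |K m y a p r| ≤ (1 + stepB m (y r) (a r / √(a r ^ 2 + p r ^ 2)))⁻¹ := by
    intro r hr
    rcases h.K_le (ha r (by omega)) with h1 | ⟨-, h1⟩
    · exact h1
    · exfalso
      have h3 := hbig r hr
      rw [div_lt_iff₀ hm0] at h3
      linarith
  have hK1 : ∀ r ≤ T, |K m y a p r| ≤ 1 := fun r hr => (hK r hr).trans
    (inv_le_one_of_one_le₀ (by
      have := stepB_nonneg (m := m) (h.y_nonneg r) (corr_pos (p := p r) (h.a_pos (ha r (by omega)))).le
      linarith))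
  have htr : ε * trunc d l = 5 * ε * (1 + q) := by simp only [trunc]; ring
  have hpr : ∀ r, s ≤ r → r < s + D → p r ≤ q + 5 * ε * (1 + q) := by
    intro r hr hrt
    rcases hr.eq_or_lt with rfl | hr
    · have : 0 ≤ 5 * ε * (1 + q) := by positivity
      linarith
    · have h1 := h.p_bound l hl s r hr (by omega) (fun r' h1 h2 => hf r' h1 (by omega))
        fun r' h1 h2 => hK1 r' (by omega)
      have h3 : ∏ r ∈ Finset.Ico s r, |K m y a p r| ≤ 1 :=
        Finset.prod_le_one (fun _ _ => abs_nonneg _) fun r' hr' =>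
          hK1 r' (by have := (Finset.mem_Ico.1 hr').2; omega)
      have h4 := mul_le_of_le_one_left (h.p_nonneg s) h3
      linarith
  -- Half the growth x/w^{m-2} belonging to the scale q; the 2 is the loss in `noisy_pow_le`.
  set b := x / (2 * w ^ (m - 2)) with hb
  have hb0 : 0 < b := by positivity
  have hB : ∀ r, s ≤ r → r < s + D → b ≤ stepB m (y r) (a r / √(a r ^ 2 + p r ^ 2)) := by
    intro r hr hrt
    have har := abs_le.1 (ha r (by omega))
    have ha0 := h.a_pos (ha r (by omega))
    have hp1 := hpr r hr hrt
    have hp0 := h.p_nonneg r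
    have hw' : a r ^ 2 + p r ^ 2 ≤ a r ^ 2 * (w * (1 + 40 * ε)) ^ 2 :=
      noisy_sq_le he0 he har.1 hp0 hp1 hwsq
    have hwpos : 0 < w * (1 + 40 * ε) := by positivity
    have h3 := inv_le_corr ha0 hwpos hw'
    have h4 : (w * (1 + 40 * ε)) ^ (m - 2) ≤ 2 * w ^ (m - 2) :=
      noisy_pow_le h.two_le he0 hem (by linarith)
    rw [stepB, h.y_first r (by omega), hb, div_eq_mul_inv]
    gcongr
    calc (2 * w ^ (m - 2))⁻¹ ≤ ((w * (1 + 40 * ε)) ^ (m - 2))⁻¹ := by gcongr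
      _ = ((w * (1 + 40 * ε))⁻¹) ^ (m - 2) := by rw [inv_pow]
      _ ≤ _ := by gcongr
  have h1 := h.p_bound l hl s (s + D) (by omega) (by omega) hf fun r' h1 h2 => hK1 r' (by omega)
  -- The choice of D makes D b ≥ 4, and Bernoulli's inequality gives (1+b)^D ≥ 5.
  have h3 : ∏ r ∈ Finset.Ico s (s + D), |K m y a p r| ≤ 1 / 5 := by
    calc ∏ r ∈ Finset.Ico s (s + D), |K m y a p r| ≤ ∏ _r ∈ Finset.Ico s (s + D), (1 + b)⁻¹ := by
          refine Finset.prod_le_prod (fun _ _ => abs_nonneg _) fun r hr => ?_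
          have hr := Finset.mem_Ico.1 hr
          refine (hK r (by omega)).trans ?_
          have := hB r hr.1 hr.2
          gcongr
      _ = ((1 + b) ^ D)⁻¹ := by simp
      _ ≤ (5 : ℝ)⁻¹ := by
          have h4 : 1 + (D : ℝ) * b ≤ (1 + b) ^ D := one_add_mul_le_pow (by linarith) D
          have h5 : 4 ≤ (D : ℝ) * b := by
            rw [hb, ← mul_div_assoc, le_div_iff₀ (by positivity)]
            linarith
          gcongr
          linarith
      _ = 1 / 5 := by norm_num
  -- The noise may use what is left of 1/2 after the contraction to 1/5. As q > 3/√m gives q m ≥ 1,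
  -- the additive ε is at most ε m q, a small multiple of q.
  have h4 : 5 * ε * (1 + q) ≤ 3 / 10 * q := by
    have hm1 : √(m : ℝ) ≤ m := by
      rw [Real.sqrt_le_iff]
      exact ⟨by positivity, by nlinarith⟩
    have h5 : 1 ≤ q * m := by
      rw [div_lt_iff₀ hm0] at hq3
      nlinarith
    have h6 : ε ≤ ε * (q * m) := le_mul_of_one_le_right he0 h5
    have h7 : ε * q ≤ 1 / 2000 * q := mul_le_mul_of_nonneg_right he hq0
    have h8 : ε * (q * m) ≤ 1 / 1000 * q := by nlinarith
    linarith
  have h5 : (∏ r ∈ Finset.Ico s (s + D), |K m y a p r|) * p s ≤ 1 / 5 * q :=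
    mul_le_mul h3 hps (h.p_nonneg s) (by norm_num)
  have h6 : √d / 2 ^ (l + 1) = q / 2 := by rw [hq, pow_succ]; field_simp
  rw [h6]
  rw [htr] at h1
  linarith

/-- The orthogonal component becomes small within the first phase. -/
lemma exists_small (hd : 5 ≤ d) (hTN : T ≤ N) {L : ℕ} (hL : L ≤ d) (hLs : √d / 2 ^ L ≤ 3 / √m)
    (hbudget : 11 * ∑ j ∈ Finset.range L, √(1 + (√d / 2 ^ j) ^ 2) ^ (m - 2) ≤ x * T) :
    ∃ s ≤ T, p s ≤ 3 / √m := by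
  by_contra! hbig
  have hx := h.x_pos
  have key : ∀ l ≤ L, ∃ s ≤ T, p s ≤ √d / 2 ^ l
      ∧ x * s ≤ 11 * ∑ j ∈ Finset.range l, √(1 + (√d / 2 ^ j) ^ 2) ^ (m - 2) := by
    intro l
    induction l with
    | zero =>
      intro _
      exact ⟨0, Nat.zero_le _, by simpa using h.p_zero, by simp⟩
    | succ l ih =>
      intro hl
      obtain ⟨s, hs, hps, hxs⟩ := ih (by omega)
      set W := √(1 + (√d / 2 ^ l) ^ 2) ^ (m - 2) with hW
      have hW1 : 1 ≤ W := one_le_pow₀ (Real.one_le_sqrt.2 (by nlinarith [sq_nonneg (√d / 2 ^ l)]))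
      set D := ⌈8 * W / x⌉₊ with hD
      have hD1 : 8 * W ≤ D * x := by
        rw [← div_le_iff₀ hx]
        exact Nat.le_ceil _
      -- Rounding up costs at most x ≤ e < 3 ≤ 3W, which raises 8 to 11.
      have hD2 : x * D ≤ 11 * W := by
        have h1 := Nat.ceil_lt_add_one (a := 8 * W / x) (by positivity)
        have h2 : x * D ≤ x * (8 * W / x + 1) := by gcongr
        have h3 : x * (8 * W / x + 1) = 8 * W + x := by field_simp
        have := h.x_le
        have := Real.exp_one_lt_d9
        linarith
      have hsum : x * (s + D : ℕ)
          ≤ 11 * ∑ j ∈ Finset.range (l + 1), √(1 + (√d / 2 ^ j) ^ 2) ^ (m - 2) := by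
        rw [Finset.sum_range_succ]
        push_cast
        linarith
      have hsT : s + D ≤ T := by
        have h1 : ∑ j ∈ Finset.range (l + 1), √(1 + (√d / 2 ^ j) ^ 2) ^ (m - 2)
            ≤ ∑ j ∈ Finset.range L, √(1 + (√d / 2 ^ j) ^ 2) ^ (m - 2) :=
          Finset.sum_le_sum_of_subset_of_nonneg (Finset.range_mono hl)
            fun _ _ _ => by positivity
        have h2 : x * (s + D : ℕ) ≤ x * T := by linarith
        exact_mod_cast le_of_mul_le_mul_left h2 hx
      exact ⟨s + D, hsT, h.halve hd hTN (by omega) hbig hps hsT hD1, hsum⟩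
  obtain ⟨s, hs, hps, -⟩ := key L le_rfl
  exact absurd (hps.trans hLs) (not_le.2 (hbig s hs))

/-- From the end of the first phase on, the orthogonal component is small. -/
lemma p_le_later (hd : 5 ≤ d) (hTN : T ≤ N) {L : ℕ} (hL : L ≤ d) (hLs : √d / 2 ^ L ≤ 3 / √m)
    (hbudget : 11 * ∑ j ∈ Finset.range L, √(1 + (√d / 2 ^ j) ^ 2) ^ (m - 2) ≤ x * T)
    (t : ℕ) (hTt : T ≤ t) (htN : t ≤ N) : p t ≤ 5 / √m := by
  have hm := h.sqrt_m_ge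
  have hm0 : 0 < √(m : ℝ) := by linarith
  obtain ⟨s, hs, hps⟩ := h.exists_small hd hTN hL hLs hbudget
  have h3 : 3 / √(m : ℝ) ≤ 7 / 2 := by rw [div_le_iff₀ hm0]; linarith
  have h4 : 3 / √(m : ℝ) ≤ 7 / 2 + √d / 2 ^ L := by
    have : 0 ≤ √(d : ℝ) / 2 ^ L := by positivity
    linarith
  have h1 := h.p_le_of_start hL h4 hps t (by omega) htN fun r hr => h.a_near_one hd r (by omega)
  -- Overshoots may raise p from 3/√m to 9/2/√m again; the remaining half unit covers the noise.
  rw [max_eq_right (by gcongr; norm_num)] at h1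
  refine h1.trans ?_
  have h5 : trunc d L ≤ 25 := by unfold trunc; linarith
  have h6 : ε * trunc d L ≤ 25 * ε := by nlinarith [h.eps_nonneg]
  have hm1 : √(m : ℝ) ≤ m := by
    rw [Real.sqrt_le_iff]
    have h2 : (2 : ℝ) ≤ m := by exact_mod_cast h.two_le
    exact ⟨by positivity, by nlinarith⟩
  have h7 : ε * √m ≤ 1 / 1000 := (mul_le_mul_of_nonneg_left hm1 h.eps_nonneg).trans h.eps_le
  have h8 : ε ≤ 1 / 1000 / √m := by rwa [le_div_iff₀ hm0]
  have h9 : 9 / 2 / √(m : ℝ) + 25 * (1 / 1000 / √m) ≤ 5 / √m := by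
    rw [← mul_div_assoc, ← add_div]
    gcongr
    norm_num
  linarith

/-- From the end of the first phase on, the orthogonal component contracts. -/
lemma K_le_later (hd : 5 ≤ d) {t : ℕ} (hTt : T ≤ t) (htN : t ≤ N)
    (hp : p t ≤ 5 / √m) : |K m y a p t| ≤ 1 - Real.exp (-13) / 2 * (y t * m) := by
  have hm := h.sqrt_m_ge
  have hm0 : 0 < √(m : ℝ) := by linarith
  have ha := h.a_near_one hd t htN
  have ha0 := h.a_pos ha
  have h2 : (2 : ℝ) ≤ m := by exact_mod_cast h.two_le
  have he := h.eps_le'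
  have har := abs_le.1 ha
  have hp0 := h.p_nonneg t
  set c := Real.exp (-13) with hc
  have hc0 : 0 < c := Real.exp_pos _
  have hc1 : c ≤ 1 / 14 := by
    rw [hc, Real.exp_neg, ← one_div]
    have := Real.add_one_le_exp 13
    gcongr
    linarith
  -- The effect of halving the step-size: e/2 < 7/5, so an overshoot has |K| ≤ 2/5.
  have hx1 : y t * m ≤ 7 / 5 := by
    have := h.y_later t hTt
    have := h.x_le
    have := Real.exp_one_lt_d9
    linarith
  have hx0 : 0 ≤ y t * m := mul_nonneg (h.y_nonneg t) (by positivity)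
  rcases h.K_le ha with h1 | ⟨h1, -⟩
  · refine h1.trans ?_
    -- p ≤ 5/√m and a ≈ 1 give 1 + p²/a² ≤ 1 + 26/m ≤ e^{26/m}. Thus r ≥ e^{-13/m} and r^{m-2} ≥
    -- e^{-13}, the origin of the contraction constant.
    set w := Real.exp (13 / m) with hw
    have hw0 : 0 < w := Real.exp_pos _
    have hpm : p t ^ 2 ≤ 25 / (m : ℝ) := by
      calc p t ^ 2 ≤ (5 / √m) ^ 2 := by gcongr
        _ = 25 / (m : ℝ) := by rw [div_pow, Real.sq_sqrt (by positivity)]; norm_num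
    have hw2 : 1 + 26 / (m : ℝ) ≤ w ^ 2 := by
      have := Real.add_one_le_exp (26 / (m : ℝ))
      have e : w ^ 2 = Real.exp (26 / m) := by
        rw [hw, ← Real.exp_nat_mul]
        congr 1
        push_cast
        ring
      linarith
    have ha2 : (25 : ℝ) / 26 ≤ a t ^ 2 := by nlinarith
    have hcond : a t ^ 2 + p t ^ 2 ≤ a t ^ 2 * w ^ 2 := by
      have h3 : a t ^ 2 * (1 + 26 / (m : ℝ)) ≤ a t ^ 2 * w ^ 2 := by gcongr
      have h4 : 25 / (m : ℝ) ≤ a t ^ 2 * (26 / m) := by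
        have : 25 / (m : ℝ) = 25 / 26 * (26 / m) := by ring
        rw [this]
        gcongr
      linarith
    have h3 := inv_le_corr ha0 hw0 hcond
    have hB : c * (y t * m) ≤ stepB m (y t) (a t / √(a t ^ 2 + p t ^ 2)) := by
      rw [stepB, mul_comm c]
      refine mul_le_mul_of_nonneg_left ?_ hx0
      have hcw : c = w⁻¹ ^ m := by
        rw [hc, hw, ← Real.exp_neg, ← Real.exp_nat_mul]
        congr 1
        field_simp
      have hw1 : w⁻¹ ≤ 1 := inv_le_one_of_one_le₀ (Real.one_le_exp (by positivity))
      calc c = w⁻¹ ^ m := hcw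
        _ ≤ w⁻¹ ^ (m - 2) := pow_le_pow_of_le_one (by positivity) hw1 (by omega)
        _ ≤ _ := by gcongr
    calc (1 + stepB m (y t) (a t / √(a t ^ 2 + p t ^ 2)))⁻¹ ≤ (1 + c * (y t * m))⁻¹ := by gcongr
      -- 1/(1+z) ≤ 1 - z/2 for z in [0,1].
      _ ≤ 1 - c / 2 * (y t * m) := by
        have h5 : 0 ≤ c * (y t * m) := by positivity
        have h6 : c * (y t * m) ≤ 1 := by nlinarith
        rw [inv_eq_one_div, div_le_iff₀ (by linarith)]
        nlinarith
  · refine h1.trans ?_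
    nlinarith

end

end NoisyOrbit

/-! ### Perturbation of the top eigenvector. -/

section TopEigenvector

variable {d : ℕ}

lemma norm_sq_eq_dotProduct (x : EuclideanSpace ℝ (Fin d)) : ‖x‖ ^ 2 = x.ofLp ⬝ᵥ x.ofLp := by
  rw [EuclideanSpace.norm_eq, Real.sq_sqrt (Finset.sum_nonneg fun _ _ => sq_nonneg _)]
  simp [dotProduct, sq]

lemma frobInner_vecMulVec (x y : Fin d → ℝ) (M : Matrix (Fin d) (Fin d) ℝ) :
    frobInner (Matrix.vecMulVec x y) M = x ⬝ᵥ (M *ᵥ y) := by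
  simp only [frobInner, Matrix.vecMulVec_apply, dotProduct, Matrix.mulVec, Finset.mul_sum]
  refine Finset.sum_congr rfl fun i _ => Finset.sum_congr rfl fun j _ => ?_
  ring

lemma frobInner_vecMulVec_vecMulVec (x y x' y' : Fin d → ℝ) :
    frobInner (Matrix.vecMulVec x y) (Matrix.vecMulVec x' y') = (x ⬝ᵥ x') * (y ⬝ᵥ y') := by
  simp only [frobInner, Matrix.vecMulVec_apply, dotProduct, Finset.sum_mul_sum]
  refine Finset.sum_congr rfl fun i _ => Finset.sum_congr rfl fun j _ => ?_
  ring

lemma dotProduct_mulVec_le_of_eigenvalue_le {S : Matrix (Fin d) (Fin d) ℝ} (hS : S.IsHermitian)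
    {μ : ℝ} (hμ : ∀ ν : ℝ, Module.End.HasEigenvalue (Matrix.toLin' S) ν → ν ≤ μ)
    (x : Fin d → ℝ) : x ⬝ᵥ (S *ᵥ x) ≤ μ * (x ⬝ᵥ x) := by
  have hev : ∀ i, hS.eigenvalues i ≤ μ := by
    intro i
    refine hμ _ (Module.End.hasEigenvalue_of_hasEigenvector
      (x := (hS.eigenvectorBasis i).ofLp) ⟨?_, ?_⟩)
    · rw [Module.End.mem_eigenspace_iff, Matrix.toLin'_apply]
      exact hS.mulVec_eigenvectorBasis i
    · intro h0
      have h1 := hS.eigenvectorBasis.orthonormal.1 i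
      have h2 : hS.eigenvectorBasis i = 0 := by
        ext j
        exact congrFun h0 j
      rw [h2, norm_zero] at h1
      exact zero_ne_one h1
  set b := hS.eigenvectorBasis with hb
  set X : EuclideanSpace ℝ (Fin d) := WithLp.toLp 2 x with hX
  set Z : EuclideanSpace ℝ (Fin d) := WithLp.toLp 2 (S *ᵥ x) with hZ
  have e1 : x ⬝ᵥ (S *ᵥ x) = inner ℝ X Z := by
    simp [hX, hZ, EuclideanSpace.inner_eq_star_dotProduct, dotProduct_comm]
  have e2 : x ⬝ᵥ x = inner ℝ X X := by
    rw [real_inner_self_eq_norm_sq, norm_sq_eq_dotProduct]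
  have e3 : ∀ i, inner ℝ (b i) Z = hS.eigenvalues i * inner ℝ (b i) X := by
    intro i
    have h1 : inner ℝ (b i) Z = (b i).ofLp ⬝ᵥ (S *ᵥ x) := by
      simp [hZ, EuclideanSpace.inner_eq_star_dotProduct, dotProduct_comm]
    have h2 : inner ℝ (b i) X = (b i).ofLp ⬝ᵥ x := by
      simp [hX, EuclideanSpace.inner_eq_star_dotProduct, dotProduct_comm]
    have hT : Sᵀ = S := by
      have : S.IsSymm := by simpa using hS
      exact this
    rw [h1, h2, Matrix.dotProduct_mulVec, ← Matrix.mulVec_transpose, hT,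
      hS.mulVec_eigenvectorBasis i, smul_dotProduct]
    rfl
  rw [e1, e2, ← b.sum_inner_mul_inner X Z, ← b.sum_inner_mul_inner X X, Finset.mul_sum]
  refine Finset.sum_le_sum fun i _ => ?_
  rw [e3, real_inner_comm X (b i)]
  have := mul_le_mul_of_nonneg_right (hev i) (mul_self_nonneg (inner ℝ X (b i)))
  linarith

/-- Perturbation bound for the top eigenvector of the symmetric part of a matrix that is close to
a multiple of `v vᵀ`. -/
lemma signedSqError_le {W : Matrix (Fin d) (Fin d) ℝ} {v w : EuclideanSpace ℝ (Fin d)}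
    (hv : ‖v‖ = 1) (hw : IsTopEigenvector (W + Wᵀ) w) {a q : ℝ} {M : Matrix (Fin d) (Fin d) ℝ}
    (hW : W = a • Matrix.vecMulVec v.ofLp v.ofLp + M)
    (hM : frobInner (Matrix.vecMulVec v.ofLp v.ofLp) M = 0) (hq : frobNorm M ≤ q)
    (hgap : 1 ≤ 2 * a - 2 * q) :
    signedSqError w v ≤ 2 * (((M + Mᵀ) *ᵥ v.ofLp) ⬝ᵥ ((M + Mᵀ) *ᵥ v.ofLp)) := by
  obtain ⟨hw1, μ, hμ, hmax⟩ := hw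
  set x := v.ofLp with hx
  have hxx : x ⬝ᵥ x = 1 := by rw [← norm_sq_eq_dotProduct, hv]; norm_num
  have hww : w.ofLp ⬝ᵥ w.ofLp = 1 := by rw [← norm_sq_eq_dotProduct, hw1]; norm_num
  set c := x ⬝ᵥ w.ofLp with hc
  set z := w.ofLp - c • x with hz
  have hxz : x ⬝ᵥ z = 0 := by
    simp [hz, dotProduct_sub, hxx, ← hc]
  have hwz : w.ofLp = c • x + z := by simp [hz]
  have hzz : z ⬝ᵥ z = 1 - c ^ 2 := by
    have : w.ofLp ⬝ᵥ w.ofLp = c ^ 2 + z ⬝ᵥ z := by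
      rw [hwz]
      simp only [add_dotProduct, dotProduct_add, smul_dotProduct, dotProduct_smul, hxx, hxz,
        dotProduct_comm z x, smul_eq_mul]
      ring
    linarith
  set e := (M + Mᵀ) *ᵥ x with he
  have hSx : ∀ y, (W + Wᵀ) *ᵥ y = (2 * a * (x ⬝ᵥ y)) • x + (M + Mᵀ) *ᵥ y := by
    intro y
    rw [hW, Matrix.transpose_add, Matrix.transpose_smul, Matrix.transpose_vecMulVec]
    simp only [Matrix.add_mulVec, Matrix.smul_mulVec, Matrix.vecMulVec_mulVec]
    ext i
    simp
    ring
  have hquad : ∀ y, y ⬝ᵥ ((M + Mᵀ) *ᵥ y) = 2 * (y ⬝ᵥ (M *ᵥ y)) := by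
    intro y
    rw [Matrix.add_mulVec, dotProduct_add, Matrix.mulVec_transpose, dotProduct_comm y (y ᵥ* M),
      ← Matrix.dotProduct_mulVec]
    ring
  have hHerm : (W + Wᵀ).IsHermitian := by
    rw [Matrix.IsHermitian, Matrix.conjTranspose_eq_transpose_of_trivial, Matrix.transpose_add,
      Matrix.transpose_transpose, add_comm]
  -- The Rayleigh quotient at v, to which M contributes nothing.
  have hμa : 2 * a ≤ μ := by
    have h1 := dotProduct_mulVec_le_of_eigenvalue_le hHerm hmax x
    rw [hSx, dotProduct_add, dotProduct_smul, hxx, hquad, ← frobInner_vecMulVec, hM] at h1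
    simpa using h1
  have hzM : z ⬝ᵥ ((M + Mᵀ) *ᵥ z) ≤ 2 * q * (z ⬝ᵥ z) := by
    rw [hquad, ← frobInner_vecMulVec]
    have h1 := (le_abs_self _).trans (abs_frobInner_le (Matrix.vecMulVec z z) M)
    have h2 : frobNorm (Matrix.vecMulVec z z) = z ⬝ᵥ z := by
      have h0 : 0 ≤ z ⬝ᵥ z := by
        simpa using dotProduct_star_self_nonneg z
      have h3 : frobNorm (Matrix.vecMulVec z z) ^ 2 = (z ⬝ᵥ z) ^ 2 := by
        rw [frobNorm_sq, frobInner_vecMulVec_vecMulVec, sq]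
      exact (sq_eq_sq₀ (frobNorm_nonneg _) h0).1 h3
    rw [h2] at h1
    have h0 : 0 ≤ z ⬝ᵥ z := h2 ▸ frobNorm_nonneg _
    nlinarith
  -- The eigenvector equation paired with the part z of w orthogonal to v: M acts on v only through
  -- e.
  have hze : μ * (z ⬝ᵥ z) = c * (z ⬝ᵥ e) + z ⬝ᵥ ((M + Mᵀ) *ᵥ z) := by
    have h1 : z ⬝ᵥ ((W + Wᵀ) *ᵥ w.ofLp) = μ * (z ⬝ᵥ z) := by
      rw [hμ, dotProduct_smul, hwz, dotProduct_add, dotProduct_smul, dotProduct_comm z x, hxz]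
      simp
    rw [← h1, hSx, hwz, Matrix.mulVec_add, Matrix.mulVec_smul, dotProduct_add, dotProduct_add,
      dotProduct_smul, dotProduct_smul, dotProduct_comm z x, hxz]
    simp [he]
  have hcs : (z ⬝ᵥ e) ^ 2 ≤ (z ⬝ᵥ z) * (e ⬝ᵥ e) := by
    simpa [dotProduct, sq] using Finset.sum_mul_sq_le_sq_mul_sq Finset.univ z e
  have hz0 : 0 ≤ z ⬝ᵥ z := by simpa using dotProduct_star_self_nonneg z
  have he0 : 0 ≤ e ⬝ᵥ e := by simpa using dotProduct_star_self_nonneg e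
  have hc1 : c ^ 2 ≤ 1 := by linarith
  -- The gap moves the quadratic term in z to the left, leaving ‖z‖² ≤ c⟨z,e⟩.
  have hbound : z ⬝ᵥ z ≤ e ⬝ᵥ e := by
    have h1 : z ⬝ᵥ z ≤ c * (z ⬝ᵥ e) := by nlinarith
    have h2 : (z ⬝ᵥ z) ^ 2 ≤ (z ⬝ᵥ z) * (e ⬝ᵥ e) := by
      calc (z ⬝ᵥ z) ^ 2 ≤ (c * (z ⬝ᵥ e)) ^ 2 := by gcongr
        _ = c ^ 2 * (z ⬝ᵥ e) ^ 2 := by ring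
        _ ≤ 1 * (z ⬝ᵥ e) ^ 2 := by gcongr
        _ ≤ _ := by rw [one_mul]; exact hcs
    rcases hz0.eq_or_lt with h0 | h0
    · rw [← h0]; exact he0
    · rw [sq] at h2
      exact le_of_mul_le_mul_left h2 h0
  have hm : ‖w - v‖ ^ 2 = 2 - 2 * c := by
    rw [norm_sq_eq_dotProduct]
    simp only [WithLp.ofLp_sub, sub_dotProduct, dotProduct_sub, hww, ← hx, hxx,
      dotProduct_comm w.ofLp x, ← hc]
    ring
  have hp : ‖w + v‖ ^ 2 = 2 + 2 * c := by
    rw [norm_sq_eq_dotProduct]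
    simp only [WithLp.ofLp_add, add_dotProduct, dotProduct_add, hww, ← hx, hxx,
      dotProduct_comm w.ofLp x, ← hc]
    ring
  rw [signedSqError, hm, hp]
  have habs := abs_le_of_sq_le_sq' (a := c) (b := 1) (by simpa using hc1) zero_le_one
  -- With the better sign the squared distance is 2 - 2|c| ≤ 2(1 - c²) = 2‖z‖².
  rcases le_total 0 c with h0 | h0
  · refine (min_le_left _ _).trans ?_
    nlinarith
  · refine (min_le_right _ _).trans ?_
    nlinarith

end TopEigenvector

/-! ### Normalised iterates and their components. -/

section NormalisedIterates

variable {d n : ℕ}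

/-- The component of a matrix along `v vᵀ`. -/
def signal (v : EuclideanSpace ℝ (Fin d)) (W : Matrix (Fin d) (Fin d) ℝ) : ℝ :=
  frobInner (Matrix.vecMulVec v.ofLp v.ofLp) W

/-- The component of a matrix orthogonal to `v vᵀ`. -/
def orth (v : EuclideanSpace ℝ (Fin d)) (W : Matrix (Fin d) (Fin d) ℝ) :
    Matrix (Fin d) (Fin d) ℝ :=
  W - signal v W • Matrix.vecMulVec v.ofLp v.ofLp

/-- A step of NSGA on the reward given by `g v^{⊗ n} + Z`, divided by the noiseless growth factor
of the signal component. -/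
def normStep (n : ℕ) (η g : ℝ) (v : EuclideanSpace ℝ (Fin d)) (Z : Tensor d n)
    (W : Matrix (Fin d) (Fin d) ℝ) : Matrix (Fin d) (Fin d) ℝ :=
  (stepC (n / 2) (η * g) (signal v W / frobNorm W))⁻¹ •
    nsgaStep n η (fun W => tensorInner (matTensorPow n W) (g • vecTensorPow n v + Z)) W

/-- The iterates of `normStep` from the identity matrix. -/
def normIter (n : ℕ) (η : ℕ → ℝ) (g : ℝ) (v : EuclideanSpace ℝ (Fin d)) (Z : ℕ → Tensor d n) :
    ℕ → Matrix (Fin d) (Fin d) ℝ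
  | 0 => 1
  | t + 1 => normStep n (η t) g v (Z t) (normIter n η g v Z t)

/-- The contraction factor at `W`. -/
def factorK (n : ℕ) (y : ℝ) (v : EuclideanSpace ℝ (Fin d)) (W : Matrix (Fin d) (Fin d) ℝ) : ℝ :=
  stepK (n / 2) y (signal v W / frobNorm W)

/-- The noise tensor of a normalised step in the direction `X`. -/
def noiseTensor (n : ℕ) (η g : ℝ) (v : EuclideanSpace ℝ (Fin d))
    (W X : Matrix (Fin d) (Fin d) ℝ) : Tensor d n :=
  (η / stepC (n / 2) (η * g) (signal v W / frobNorm W)) • updTensor n W X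

/-- By homogeneity the normalising factors collect into one positive scalar, to which top
eigenvectors are insensitive. -/
lemma nsga_eq_smul_normIter (hn : Even n) (h4 : 4 ≤ n) {N : ℕ} (η₀ g : ℝ)
    (v : EuclideanSpace ℝ (Fin d)) (Z : ℕ → Tensor d n)
    (R : Fin N → Matrix (Fin d) (Fin d) ℝ → ℝ)
    (hR : ∀ t, R t = fun W => tensorInner (matTensorPow n W) (g • vecTensorPow n v + Z t))
    (t : ℕ) (ht : t ≤ N) :
    ∃ D : ℝ, 0 < D ∧ nsga n η₀ R t
      = D • normIter n (fun t => η₀ / 2 ^ (t / phaseLength N)) g v Z t := by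
  induction t with
  | zero => exact ⟨1, one_pos, by simp [nsga, normIter]⟩
  | succ t ih =>
    obtain ⟨D, hD, h⟩ := ih (by omega)
    have htN : t < N := ht
    have hC := stepC_pos (m := n / 2) (y := η₀ / 2 ^ (t / phaseLength N) * g)
      (r := signal v (normIter n (fun t => η₀ / 2 ^ (t / phaseLength N)) g v Z t)
        / frobNorm (normIter n (fun t => η₀ / 2 ^ (t / phaseLength N)) g v Z t))
    refine ⟨D * stepC (n / 2) (η₀ / 2 ^ (t / phaseLength N) * g)
      (signal v (normIter n (fun t => η₀ / 2 ^ (t / phaseLength N)) g v Z t)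
        / frobNorm (normIter n (fun t => η₀ / 2 ^ (t / phaseLength N)) g v Z t)),
      mul_pos hD hC, ?_⟩
    rw [nsga, dif_pos htN, h, hR, nsgaStep_smul hn h4 _ _ _ hD, normIter, normStep, smul_smul,
      mul_assoc, mul_inv_cancel₀ hC.ne', mul_one]

lemma frobInner_normStep (hn : Even n) (h4 : 4 ≤ n) (η g : ℝ) (v : EuclideanSpace ℝ (Fin d))
    (Z : Tensor d n) (W X : Matrix (Fin d) (Fin d) ℝ) :
    frobInner X (normStep n η g v Z W) = factorK n (η * g) v W * frobInner X W
      + stepB (n / 2) (η * g) (signal v W / frobNorm W)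
        / stepC (n / 2) (η * g) (signal v W / frobNorm W) * signal v W
        * frobInner X (Matrix.vecMulVec v.ofLp v.ofLp)
      + tensorInner (noiseTensor n η g v W X) Z := by
  rw [normStep, frobInner_smul_right, frobInner_nsgaStep hn, tensorInner_add_right,
    tensorInner_smul_right, tensorInner_updTensor_vecTensorPow hn h4, noiseTensor,
    tensorInner_smul_left, factorK, stepK, stepB, stepA]
  change _ * (_ + η * (g * (_ * (signal v W / _) ^ _ * signal v W * _ - _ * (signal v W / _) ^ _ * _) + _)) = _
  ring

lemma orth_entry (v : EuclideanSpace ℝ (Fin d)) (W X : Matrix (Fin d) (Fin d) ℝ) :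
    frobInner X (orth v W) = frobInner (orth v X) W := by
  rw [orth, orth, frobInner_sub_right, frobInner_sub_left, frobInner_smul_right,
    frobInner_smul_left, signal, signal, frobInner_comm X (Matrix.vecMulVec _ _)]
  ring

lemma signal_orth {v : EuclideanSpace ℝ (Fin d)} (hv : ‖v‖ = 1) (W : Matrix (Fin d) (Fin d) ℝ) :
    signal v (orth v W) = 0 := by
  rw [orth, signal, frobInner_sub_right, frobInner_smul_right, frobInner_vecMulVec_vecMulVec,
    ← norm_sq_eq_dotProduct, hv, signal]
  ring

lemma frobNorm_sq_eq {v : EuclideanSpace ℝ (Fin d)} (hv : ‖v‖ = 1)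
    (W : Matrix (Fin d) (Fin d) ℝ) :
    frobNorm W ^ 2 = signal v W ^ 2 + frobNorm (orth v W) ^ 2 := by
  have h1 : W = signal v W • Matrix.vecMulVec v.ofLp v.ofLp + orth v W := by simp [orth]
  have h2 := signal_orth hv W
  rw [signal] at h2
  rw [frobNorm_sq, frobNorm_sq]
  conv_lhs => rw [h1]
  rw [frobInner_add_left, frobInner_add_right, frobInner_add_right, frobInner_smul_left,
    frobInner_smul_left, frobInner_smul_right, frobInner_smul_right, h2,
    frobInner_comm (orth v W), h2, frobInner_vecMulVec_vecMulVec, ← norm_sq_eq_dotProduct, hv]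
  ring

lemma frobNorm_eq_sqrt {v : EuclideanSpace ℝ (Fin d)} (hv : ‖v‖ = 1)
    (W : Matrix (Fin d) (Fin d) ℝ) :
    frobNorm W = √(signal v W ^ 2 + frobNorm (orth v W) ^ 2) := by
  rw [← frobNorm_sq_eq hv, Real.sqrt_sq (frobNorm_nonneg W)]

/-- `orth v X` is orthogonal to vvᵀ, so the extra signal growth drops out and every direction has
the same factor K. -/
lemma frobInner_orth_normStep (hn : Even n) (h4 : 4 ≤ n) (η g : ℝ)
    {v : EuclideanSpace ℝ (Fin d)} (hv : ‖v‖ = 1) (Z : Tensor d n)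
    (W X : Matrix (Fin d) (Fin d) ℝ) :
    frobInner X (orth v (normStep n η g v Z W)) = factorK n (η * g) v W * frobInner X (orth v W)
      + tensorInner (noiseTensor n η g v W (orth v X)) Z := by
  have h := signal_orth hv X
  rw [signal] at h
  rw [orth_entry, frobInner_normStep hn h4, frobInner_comm (orth v X) (Matrix.vecMulVec _ _), h,
    orth_entry]
  ring

/-- The normaliser equals A + B here, so the multiplier of the signal is exactly 1 and only noise
moves it. -/
lemma signal_normStep (hn : Even n) (h4 : 4 ≤ n) {η g : ℝ} (hη : 0 ≤ η * g)
    {v : EuclideanSpace ℝ (Fin d)} (hv : ‖v‖ = 1) (Z : Tensor d n)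
    {W : Matrix (Fin d) (Fin d) ℝ} (hW : 0 < signal v W) :
    signal v (normStep n η g v Z W) = signal v W
      + tensorInner (noiseTensor n η g v W (Matrix.vecMulVec v.ofLp v.ofLp)) Z := by
  have h1 : frobInner (Matrix.vecMulVec v.ofLp v.ofLp) (Matrix.vecMulVec v.ofLp v.ofLp) = 1 := by
    rw [frobInner_vecMulVec_vecMulVec, ← norm_sq_eq_dotProduct, hv]; norm_num
  have h2 : 0 ≤ signal v W / frobNorm W := div_nonneg hW.le (frobNorm_nonneg W)
  have h3 : signal v W / frobNorm W ≤ 1 := by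
    rw [frobNorm_eq_sqrt hv]; exact corr_le_one hW
  have hC := stepC_eq (m := n / 2) (by omega) hη h2 h3
  have hC0 := (stepC_pos (m := n / 2) (y := η * g) (r := signal v W / frobNorm W)).ne'
  rw [signal, frobInner_normStep hn h4, h1, factorK, stepK, ← signal]
  have : stepA (n / 2) (η * g) (signal v W / frobNorm W)
      = stepC (n / 2) (η * g) (signal v W / frobNorm W)
        - stepB (n / 2) (η * g) (signal v W / frobNorm W) := by rw [hC]; ring
  rw [this]
  field_simp
  ring

lemma tensorInner_noiseTensor_self_le (hn : Even n) (h4 : 4 ≤ n) (η g : ℝ)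
    (v : EuclideanSpace ℝ (Fin d)) (W X : Matrix (Fin d) (Fin d) ℝ) {F : ℝ} (hF : frobNorm W ≤ F) :
    tensorInner (noiseTensor n η g v W X) (noiseTensor n η g v W X)
      ≤ 2 * (n / 2 : ℕ) * η ^ 2 * F ^ 2 * frobInner X X := by
  rw [noiseTensor, tensorInner_smul_left, tensorInner_smul_right, ← mul_assoc, ← sq, div_pow]
  have h1 := tensorInner_updTensor_self_le hn h4 W X
  have h2 := tensorInner_self_nonneg (updTensor n W X)
  have hC : 1 ≤ stepC (n / 2) (η * g) (signal v W / frobNorm W) ^ 2 := one_le_pow₀ one_le_stepC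
  have hX := frobInner_self_nonneg X
  have hW := frobNorm_nonneg W
  calc η ^ 2 / stepC (n / 2) (η * g) (signal v W / frobNorm W) ^ 2
        * tensorInner (updTensor n W X) (updTensor n W X)
      ≤ η ^ 2 * (2 * (n / 2 : ℕ) * frobNorm W ^ 2 * frobInner X X) := by
        gcongr
        exact div_le_self (sq_nonneg _) hC
    _ ≤ η ^ 2 * (2 * (n / 2 : ℕ) * F ^ 2 * frobInner X X) := by gcongr
    _ = _ := by ring

lemma frobInner_orth_self_le {v : EuclideanSpace ℝ (Fin d)} (hv : ‖v‖ = 1)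
    (X : Matrix (Fin d) (Fin d) ℝ) : frobInner (orth v X) (orth v X) ≤ frobInner X X := by
  rw [← frobNorm_sq, ← frobNorm_sq, frobNorm_sq_eq hv X]
  nlinarith [sq_nonneg (signal v X)]

end NormalisedIterates

/-! ### Measurability of a step in the iterate and the noise. -/

section Measurability

variable {d n : ℕ}

instance matrixMeasurableSpace : MeasurableSpace (Matrix (Fin d) (Fin d) ℝ) :=
  inferInstanceAs (MeasurableSpace (Fin d → Fin d → ℝ))

lemma measurable_matrix_apply (i j : Fin d) :
    Measurable fun W : Matrix (Fin d) (Fin d) ℝ => W i j :=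
  (measurable_pi_apply j).comp (measurable_pi_apply (X := fun _ : Fin d => Fin d → ℝ) i)

lemma measurable_matrix {α : Type*} [MeasurableSpace α] {f : α → Matrix (Fin d) (Fin d) ℝ}
    (h : ∀ i j, Measurable fun x => f x i j) : Measurable f :=
  measurable_pi_lambda (X := fun _ : Fin d => Fin d → ℝ) f
    fun i => measurable_pi_lambda _ fun j => h i j

lemma measurable_frobInner (X : Matrix (Fin d) (Fin d) ℝ) : Measurable (frobInner X) :=
  Finset.measurable_sum _ fun i _ => Finset.measurable_sum _ fun j _ =>
    (measurable_matrix_apply i j).const_mul _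

lemma measurable_frobNorm : Measurable (frobNorm : Matrix (Fin d) (Fin d) ℝ → ℝ) :=
  (Finset.measurable_sum _ fun i _ => Finset.measurable_sum _ fun j _ =>
    (measurable_matrix_apply i j).pow_const 2).sqrt

lemma measurable_corr (v : EuclideanSpace ℝ (Fin d)) :
    Measurable fun W : Matrix (Fin d) (Fin d) ℝ => signal v W / frobNorm W :=
  (measurable_frobInner _).div measurable_frobNorm

lemma measurable_stepB (m : ℕ) (y : ℝ) : Measurable (stepB m y) := by
  unfold stepB; fun_prop

lemma measurable_stepA (m : ℕ) (y : ℝ) : Measurable (stepA m y) := by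
  unfold stepA; fun_prop

lemma measurable_stepC (m : ℕ) (y : ℝ) : Measurable (stepC m y) :=
  measurable_const.max ((measurable_stepA m y).add (measurable_stepB m y))

lemma measurable_factorK (y : ℝ) (v : EuclideanSpace ℝ (Fin d)) : Measurable (factorK n y v) :=
  ((measurable_stepA _ y).div (measurable_stepC _ y)).comp (measurable_corr v)

lemma measurable_mixTensor {α : Type*} [MeasurableSpace α]
    {A : α → Fin (n / 2) → Matrix (Fin d) (Fin d) ℝ} (hA : ∀ l, Measurable fun x => A x l) :
    Measurable fun x => mixTensor n (A x) := by
  refine measurable_pi_lambda _ fun i => ?_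
  exact Finset.measurable_prod _ fun l _ => (measurable_matrix_apply _ _).comp (hA l)

lemma measurable_noiseTensor (η g : ℝ) (v : EuclideanSpace ℝ (Fin d))
    (X : Matrix (Fin d) (Fin d) ℝ) : Measurable fun W => noiseTensor n η g v W X := by
  have h1 : ∀ l : Fin (n / 2), Measurable fun W : Matrix (Fin d) (Fin d) ℝ =>
      mixTensor n (Function.update (fun _ => W) l X) := by
    intro l
    refine measurable_mixTensor fun j => ?_
    by_cases h : j = l
    · subst h; simp
    · simp only [Function.update_of_ne h]
      exact measurable_id
  have h2 : Measurable fun W : Matrix (Fin d) (Fin d) ℝ => dirTensor n W X :=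
    Finset.measurable_sum _ fun l _ => h1 l
  have h3 : Measurable fun W : Matrix (Fin d) (Fin d) ℝ => matTensorPow n W :=
    measurable_mixTensor fun _ => measurable_id
  have h4 : Measurable fun W : Matrix (Fin d) (Fin d) ℝ => updTensor n W X :=
    (((measurable_frobNorm.pow_const _).inv).smul h2).sub
      (((measurable_const.div (measurable_frobNorm.pow_const _)).mul (measurable_frobInner X)).smul h3)
  exact (measurable_const.div ((measurable_stepC _ _).comp (measurable_corr v))).smul h4

lemma measurable_normStep (hn : Even n) (h4 : 4 ≤ n) (η g : ℝ) (v : EuclideanSpace ℝ (Fin d))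
    {α : Type*} [MeasurableSpace α] {W : α → Matrix (Fin d) (Fin d) ℝ} {Z : α → Tensor d n}
    (hW : Measurable W) (hZ : Measurable Z) :
    Measurable fun x => normStep n η g v (Z x) (W x) := by
  refine measurable_matrix fun i j => ?_
  have h : ∀ x, normStep n η g v (Z x) (W x) i j
      = frobInner (Matrix.single i j 1) (normStep n η g v (Z x) (W x)) := by
    intro x
    simp [frobInner, Matrix.single_apply, ite_and]
  simp only [h, frobInner_normStep hn h4]
  have hc : Measurable fun x => signal v (W x) / frobNorm (W x) := (measurable_corr v).comp hW
  refine Measurable.add (Measurable.add ?_ ?_) ?_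
  · exact ((measurable_factorK _ v).mul (measurable_frobInner _)).comp hW
  · refine Measurable.mul_const (Measurable.mul ?_ ?_) _
    · exact ((measurable_stepB _ _).div (measurable_stepC _ _)).comp hc
    · exact (measurable_frobInner _).comp hW
  · exact measurable_tensorInner ((measurable_noiseTensor η g v _).comp hW) hZ

lemma measurable_liftTensor {k : ℕ} (c : ℝ) (u : EuclideanSpace ℝ (Fin d)) :
    Measurable (liftTensor (k := k) c u) := by
  refine measurable_pi_lambda _ fun i => ?_
  unfold liftTensor
  split_ifs
  · exact (measurable_pi_apply _).const_mul _
  · exact measurable_const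

lemma measurable_contractFirst (c : ℝ) (u : EuclideanSpace ℝ (Fin d)) :
    Measurable fun T : Tensor d n => c • contractFirst T u := by
  refine Measurable.const_smul ?_ c
  refine measurable_pi_lambda _ fun i => ?_
  exact Finset.measurable_sum _ fun a _ => (measurable_pi_apply _).const_mul _

end Measurability

/-! ### Accumulated noise with cut-offs. -/

section NoiseProcess

variable {d n : ℕ}

/-- The noise in the direction `X` accumulated by the iterates `Y` from time `s` on, where `q` are
the contraction factors and the accumulation is reset when the iterate leaves the sets `G`. -/
def noiseSum (n : ℕ) (η : ℕ → ℝ) (g : ℝ) (v : EuclideanSpace ℝ (Fin d)) (s : ℕ)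
    (q : ℕ → Matrix (Fin d) (Fin d) ℝ → ℝ) (G : ℕ → Set (Matrix (Fin d) (Fin d) ℝ))
    (X : Matrix (Fin d) (Fin d) ℝ) (Y : ℕ → Matrix (Fin d) (Fin d) ℝ) (Z : ℕ → Tensor d n) :
    ℕ → ℝ
  | 0 => 0
  -- Noise enters from time s on, but is multiplied only at later times: the factor at time s acts
  -- on the starting value alone.
  | t + 1 => (if s < t then (G t).indicator (q t) (Y t) else 0) * noiseSum n η g v s q G X Y Z t
      + tensorInner (if s ≤ t then
          (G t).indicator (fun W => noiseTensor n (η t) g v W X) (Y t) else 0) (Z t)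

variable {η : ℕ → ℝ} {g : ℝ} {v : EuclideanSpace ℝ (Fin d)} {s : ℕ}
  {q : ℕ → Matrix (Fin d) (Fin d) ℝ → ℝ} {G : ℕ → Set (Matrix (Fin d) (Fin d) ℝ)}
  {X : Matrix (Fin d) (Fin d) ℝ} {Y : ℕ → Matrix (Fin d) (Fin d) ℝ} {Z : ℕ → Tensor d n}

lemma noiseSum_eq_zero (t : ℕ) (ht : t ≤ s) : noiseSum n η g v s q G X Y Z t = 0 := by
  cases t with
  | zero => rfl
  | succ t =>
    rw [noiseSum, if_neg (by omega), if_neg (by omega)]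
    simp [tensorInner]

/-- While the iterates stay in the sets G the indicators are idle, and the cut-off noise is the true
one. -/
lemma eq_prod_mul_add_noiseSum {x : ℕ → ℝ} (t : ℕ) (hst : s ≤ t)
    (hx : ∀ r, s ≤ r → r < t → x (r + 1) = q r (Y r) * x r
      + tensorInner (noiseTensor n (η r) g v (Y r) X) (Z r))
    (hG : ∀ r, s ≤ r → r < t → Y r ∈ G r) :
    x t = (∏ r ∈ Finset.Ico s t, q r (Y r)) * x s + noiseSum n η g v s q G X Y Z t := by
  induction t with
  | zero =>
    obtain rfl : s = 0 := by omega
    simp [noiseSum]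
  | succ t ih =>
    rcases hst.eq_or_lt with rfl | hlt
    · simp [noiseSum_eq_zero]
    have hst' : s ≤ t := by omega
    have h1 := ih hst' (fun r h1 h2 => hx r h1 (by omega)) fun r h1 h2 => hG r h1 (by omega)
    have hGt := hG t hst' (Nat.lt_succ_self t)
    rw [hx t hst' (Nat.lt_succ_self t), h1, Finset.prod_Ico_succ_top hst', noiseSum,
      if_pos hst', Set.indicator_of_mem hGt, Set.indicator_of_mem hGt]
    rcases hst'.eq_or_lt with rfl | hlt'
    · simp [noiseSum_eq_zero]
    · rw [if_pos hlt']
      ring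

end NoiseProcess

/-! ### Tail bounds and the union bound. -/

section Event

variable {Ω : Type*} [MeasurableSpace Ω] {P : Measure Ω} {d k N : ℕ}
  {E : Fin N → Ω → Tensor d k} {σ : ℝ}

/-- The contracted noise tensors. -/
def contractedNoise (c : ℝ) (u : EuclideanSpace ℝ (Fin d)) (E : Fin N → Ω → Tensor d k) (ω : Ω)
    (t : ℕ) : Tensor d (k - 1) :=
  if h : t < N then c • contractFirst (E ⟨t, h⟩ ω) u else 0

/-- The cut-offs make the bounds on factors and noise tensors hold for every iterate, so no
conditioning is needed. V may be any supersolution of the variance recursion. -/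
lemma measure_lt_abs_noiseSum_le [IsProbabilityMeasure P] (hE : IsSubGaussianNoise P E σ)
    (hk : Odd k) (h5 : 5 ≤ k) (hσ : 0 < σ) {c : ℝ} (hc : c ^ 2 = 1)
    {u v : EuclideanSpace ℝ (Fin d)} (hu : ‖u‖ = 1) {η : ℕ → ℝ} {g : ℝ} {s : ℕ}
    {q : ℕ → Matrix (Fin d) (Fin d) ℝ → ℝ} (hq : ∀ t, Measurable (q t))
    {G : ℕ → Set (Matrix (Fin d) (Fin d) ℝ)} (hG : ∀ t, MeasurableSet (G t))
    {X : Matrix (Fin d) (Fin d) ℝ} {κb V : ℕ → ℝ} {F x b z L : ℝ}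
    (hκb0 : ∀ t, 0 ≤ κb t) (hκb : ∀ t, s < t → ∀ W ∈ G t, |q t W| ≤ κb t)
    (hF : ∀ t, ∀ W ∈ G t, frobNorm W ≤ F) (hX : frobInner X X ≤ x)
    (hV0 : 0 ≤ V 0)
    (hV : ∀ t < N, κb t ^ 2 * V t + 2 * ((k - 1) / 2 : ℕ) * η t ^ 2 * F ^ 2 * x ≤ V (t + 1))
    (t : ℕ) (ht : t ≤ N) (hVb : V t ≤ b) (hb : 0 < b) (hL : 0 ≤ L) (hz : 0 ≤ z)
    (hbz : 4 * σ ^ 2 * b * L ≤ z ^ 2) :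
    P {ω | z < |noiseSum (k - 1) η g v s q G X
      (normIter (k - 1) η g v (contractedNoise c u E ω)) (contractedNoise c u E ω) t|}
      ≤ ENNReal.ofReal (2 * Real.exp (-L)) := by
  have hk0 : 0 < k := by omega
  have hn : Even (k - 1) := by
    obtain ⟨j, hj⟩ := hk
    exact ⟨j, by omega⟩
  have h4 : 4 ≤ k - 1 := by omega
  have hx0 : 0 ≤ x := (frobInner_self_nonneg X).trans hX
  let Y : ℕ → Ω → Matrix (Fin d) (Fin d) ℝ := fun t ω =>
    normIter (k - 1) η g v (contractedNoise c u E ω) t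
  let U : ℕ → Ω → ℝ := fun t ω => noiseSum (k - 1) η g v s q G X
      (normIter (k - 1) η g v (contractedNoise c u E ω)) (contractedNoise c u E ω) t
  let Φ : ℕ → Matrix (Fin d) (Fin d) ℝ × Tensor d k → Matrix (Fin d) (Fin d) ℝ :=
    fun t p => normStep (k - 1) (η t) g v (c • contractFirst p.2 u) p.1
  let κ : ℕ → Matrix (Fin d) (Fin d) ℝ → ℝ :=
    fun t W => if s < t then (G t).indicator (q t) W else 0
  let H₀ : ℕ → Matrix (Fin d) (Fin d) ℝ → Tensor d (k - 1) := fun t W => if s ≤ t then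
    (G t).indicator (fun W => noiseTensor (k - 1) (η t) g v W X) W else 0
  have hΦ : ∀ t, Measurable (Φ t) := fun t =>
    measurable_normStep hn h4 (η t) g v measurable_fst
      ((measurable_contractFirst c u).comp measurable_snd)
  have hZ : ∀ t (ht : t < N) ω, c • contractFirst (E ⟨t, ht⟩ ω) u = contractedNoise c u E ω t :=
    fun t ht ω => by rw [contractedNoise, dif_pos ht]
  have hY : ∀ t (ht : t < N) ω, Y (t + 1) ω = Φ t (Y t ω, E ⟨t, ht⟩ ω) := fun t ht ω => by
    change normStep (k - 1) (η t) g v (contractedNoise c u E ω t) (Y t ω)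
      = normStep (k - 1) (η t) g v (c • contractFirst (E ⟨t, ht⟩ ω) u) (Y t ω)
    rw [hZ t ht]
  have hκ : ∀ t, Measurable (κ t) := fun t => by
    by_cases hst : s < t
    · simp only [κ, if_pos hst]
      exact (hq t).indicator (hG t)
    · simp only [κ, if_neg hst]
      exact measurable_const
  have hH₀ : ∀ t, Measurable (H₀ t) := fun t => by
    by_cases hst : s ≤ t
    · simp only [H₀, if_pos hst]
      exact (measurable_noiseTensor (η t) g v X).indicator (hG t)
    · simp only [H₀, if_neg hst]
      exact measurable_const
  have hUrec : ∀ t (ht : t < N) ω, U (t + 1) ω = κ t (Y t ω) * U t ω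
      + tensorInner (liftTensor c u (H₀ t (Y t ω))) (E ⟨t, ht⟩ ω) := fun t ht ω => by
    rw [tensorInner_liftTensor hk0]
    rw [hZ t ht]
    rfl
  have hκb' : ∀ t W, |κ t W| ≤ κb t := fun t W => by
    by_cases hst : s < t
    · simp only [κ, if_pos hst]
      by_cases hW : W ∈ G t
      · rw [Set.indicator_of_mem hW]
        exact hκb t hst W hW
      · rw [Set.indicator_of_notMem hW, abs_zero]
        exact hκb0 t
    · simp only [κ, if_neg hst, abs_zero]
      exact hκb0 t
  have hH₀b : ∀ t W, tensorInner (H₀ t W) (H₀ t W)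
      ≤ 2 * ((k - 1) / 2 : ℕ) * η t ^ 2 * F ^ 2 * x := fun t W => by
    have h0 : (0 : ℝ) ≤ 2 * ((k - 1) / 2 : ℕ) * η t ^ 2 * F ^ 2 * x := by positivity
    have h00 : tensorInner (0 : Tensor d (k - 1)) 0 = 0 := by simp [tensorInner]
    by_cases hst : s ≤ t
    · simp only [H₀, if_pos hst]
      by_cases hW : W ∈ G t
      · rw [Set.indicator_of_mem hW]
        have h1 := tensorInner_noiseTensor_self_le hn h4 (η t) g v W X (hF t W hW)
        refine h1.trans ?_
        gcongr
      · rw [Set.indicator_of_notMem hW, h00]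
        exact h0
    · simp only [H₀, if_neg hst]
      rw [h00]
      exact h0
  have h := lintegral_cosh_le hE (Y := Y) (y₀ := 1) (fun _ => rfl) (Φ := Φ) hΦ hY (κ := κ) hκ
    (H := fun t W => liftTensor c u (H₀ t W))
    (fun t => (measurable_liftTensor c u).comp (hH₀ t))
    (U := U) (fun _ => rfl) hUrec
    (κb := κb) (s := fun t => 2 * ((k - 1) / 2 : ℕ) * η t ^ 2 * F ^ 2 * x) (V := V) hκb'
    (fun t W => by
      rw [tensorInner_liftTensor_self hk0, hc, hu, one_pow, one_mul, one_mul]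
      exact hH₀b t W)
    hV0 hV t ht
  exact measure_le_abs_of_lintegral_cosh_le h.1 hσ h.2 hVb hb hL hz hbz

/-- A union bound; a measurable hull spares any measurability of the bad sets. -/
lemma exists_measurableSet_of_forall_measure_le [IsProbabilityMeasure P] {ι : Type*} [Fintype ι]
    {B : ι → Set Ω} {r δ : ℝ} (hr : 0 ≤ r) (hB : ∀ i, P (B i) ≤ ENNReal.ofReal r)
    (hδ : Fintype.card ι * r ≤ δ) :
    ∃ A : Set Ω, MeasurableSet A ∧ 1 - δ ≤ P.real A ∧ ∀ ω ∈ A, ∀ i, ω ∉ B i := by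
  refine ⟨(toMeasurable P (⋃ i, B i))ᶜ, (measurableSet_toMeasurable _ _).compl, ?_, ?_⟩
  · rw [probReal_compl_eq_one_sub (measurableSet_toMeasurable _ _)]
    have h1 : P (⋃ i, B i) ≤ ENNReal.ofReal (Fintype.card ι * r) := by
      refine (measure_iUnion_fintype_le P B).trans ((Finset.sum_le_sum fun i _ => hB i).trans ?_)
      rw [Finset.sum_const, Finset.card_univ, nsmul_eq_mul, ENNReal.ofReal_mul (Nat.cast_nonneg _),
        ENNReal.ofReal_natCast]
    have h2 : P.real (toMeasurable P (⋃ i, B i)) ≤ Fintype.card ι * r := by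
      rw [measureReal_def, measure_toMeasurable]
      exact ENNReal.toReal_le_of_le_ofReal (by positivity) h1
    linarith
  · intro ω hω i hi
    exact hω (subset_toMeasurable _ _ (Set.mem_iUnion.2 ⟨i, hi⟩))

end Event

/-! ### The high-probability event. -/

section NoiseBounds

variable {d n : ℕ}

/-- The iterates correlated with the signal, of bounded norm, whose orthogonal component does not
expand except possibly at time `s`. -/
def nonexpandingSet (n : ℕ) (y : ℕ → ℝ) (v : EuclideanSpace ℝ (Fin d)) (F : ℝ) (s t : ℕ) :
    Set (Matrix (Fin d) (Fin d) ℝ) :=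
  {W | (0 < signal v W ∧ frobNorm W ≤ F) ∧ (t = s ∨ |factorK n (y t) v W| ≤ 1)}

/-- The iterates correlated with the signal and of bounded norm. -/
def correlatedSet (v : EuclideanSpace ℝ (Fin d)) (F : ℝ) : Set (Matrix (Fin d) (Fin d) ℝ) :=
  {W | 0 < signal v W ∧ frobNorm W ≤ F}

/-- The iterates of bounded norm whose orthogonal component contracts at rate `c`. -/
def contractingSet (n : ℕ) (y : ℕ → ℝ) (v : EuclideanSpace ℝ (Fin d)) (F c : ℝ) (t : ℕ) :
    Set (Matrix (Fin d) (Fin d) ℝ) :=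
  {W | frobNorm W ≤ F ∧ |factorK n (y t) v W| ≤ 1 - c * (y t * (n / 2 : ℕ))}

lemma measurableSet_correlatedSet (v : EuclideanSpace ℝ (Fin d)) (F : ℝ) :
    MeasurableSet (correlatedSet v F) :=
  (measurableSet_lt measurable_const (measurable_frobInner _)).inter
    (measurableSet_le measurable_frobNorm measurable_const)

lemma measurableSet_nonexpandingSet (y : ℕ → ℝ) (v : EuclideanSpace ℝ (Fin d)) (F : ℝ)
    (s t : ℕ) : MeasurableSet (nonexpandingSet n y v F s t) :=
  (measurableSet_correlatedSet v F).inter ((MeasurableSet.const _).union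
    (measurableSet_le (measurable_factorK (y t) v).abs measurable_const))

lemma measurableSet_contractingSet (y : ℕ → ℝ) (v : EuclideanSpace ℝ (Fin d)) (F c : ℝ)
    (t : ℕ) : MeasurableSet (contractingSet n y v F c t) :=
  (measurableSet_le measurable_frobNorm measurable_const).inter
    (measurableSet_le (measurable_factorK (y t) v).abs measurable_const)

/-- The direction measuring the `i`-th coordinate of `(M + Mᵀ) v`. -/
def crossDir (v : EuclideanSpace ℝ (Fin d)) (i : Fin d) : Matrix (Fin d) (Fin d) ℝ :=
  Matrix.vecMulVec (Pi.single i 1) v.ofLp + Matrix.vecMulVec v.ofLp (Pi.single i 1)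

lemma frobInner_crossDir (v : EuclideanSpace ℝ (Fin d)) (i : Fin d)
    (M : Matrix (Fin d) (Fin d) ℝ) :
    frobInner (crossDir v i) M = ((M + Mᵀ) *ᵥ v.ofLp) i := by
  rw [crossDir, frobInner_add_left, frobInner_vecMulVec, frobInner_vecMulVec, Matrix.add_mulVec,
    Pi.add_apply, single_one_dotProduct, Matrix.mulVec_single_one]
  simp [Matrix.mulVec, dotProduct, mul_comm]

lemma frobInner_crossDir_self_le {v : EuclideanSpace ℝ (Fin d)} (hv : ‖v‖ = 1) (i : Fin d) :
    frobInner (crossDir v i) (crossDir v i) ≤ 4 := by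
  have hvv : v.ofLp ⬝ᵥ v.ofLp = 1 := by rw [← norm_sq_eq_dotProduct, hv]; norm_num
  have h2 : v.ofLp i ^ 2 ≤ 1 := by
    rw [← hvv, dotProduct, sq]
    exact Finset.single_le_sum (f := fun i => v.ofLp i * v.ofLp i)
      (fun j _ => mul_self_nonneg _) (Finset.mem_univ i)
  rw [crossDir]
  simp only [frobInner_add_left, frobInner_add_right, frobInner_vecMulVec_vecMulVec, hvv,
    single_one_dotProduct, dotProduct_single_one, Pi.single_eq_same]
  nlinarith

lemma frobInner_single_self (i j : Fin d) :
    frobInner (Matrix.single i j (1 : ℝ)) (Matrix.single i j 1) = 1 := by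
  simp [frobInner, Matrix.single_apply, ite_and]

lemma frobInner_single (i j : Fin d) (M : Matrix (Fin d) (Fin d) ℝ) :
    frobInner (Matrix.single i j 1) M = M i j := by
  simp [frobInner, Matrix.single_apply, ite_and]

/-- The high-probability bounds on the accumulated noise. -/
structure NoiseBounds (n d T N : ℕ) (η : ℕ → ℝ) (g : ℝ) (v : EuclideanSpace ℝ (Fin d))
    (c ε ζ : ℝ) (Z : ℕ → Tensor d n) : Prop where
  entry : ∀ s t l : ℕ, s < N → t ≤ N → l ≤ d → ∀ i j : Fin d,
    |noiseSum n η g v s (fun t => factorK n (η t * g) v)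
      (nonexpandingSet n (fun t => η t * g) v (trunc d l) s) (orth v (Matrix.single i j 1))
      (normIter n η g v Z) Z t| ≤ ε * trunc d l / d
  sig : ∀ t ≤ N, |noiseSum n η g v 0 (fun _ _ => 1) (fun _ => correlatedSet v (trunc d 0))
      (Matrix.vecMulVec v.ofLp v.ofLp) (normIter n η g v Z) Z t| ≤ ε
  cross : ∀ i, |noiseSum n η g v T (fun t => factorK n (η t * g) v)
      (contractingSet n (fun t => η t * g) v 5 c) (orth v (crossDir v i))
      (normIter n η g v Z) Z N| ≤ ζ

lemma exists_forall_noiseBounds {Ω : Type*} [MeasurableSpace Ω] {P : Measure Ω}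
    [IsProbabilityMeasure P] {k T N : ℕ} {E : Fin N → Ω → Tensor d k} {σ : ℝ}
    (hE : IsSubGaussianNoise P E σ) (hk : Odd k) (h5 : 5 ≤ k) (hd : 5 ≤ d) (hN : 0 < N)
    (hσ : 0 < σ) {r : ℝ} (hr : r ^ 2 = 1) {u v : EuclideanSpace ℝ (Fin d)} (hu : ‖u‖ = 1)
    (hv : ‖v‖ = 1) {η : ℕ → ℝ} {η₀ g c ε ζ δ L : ℝ} (hη0 : ∀ t, 0 ≤ η t) (hη : ∀ t, η t ≤ η₀)
    (hη₀ : 0 < η₀) (hg : 0 < g) (hc : 0 < c) (hcη : c * (η₀ * g * ((k - 1) / 2 : ℕ)) ≤ 1)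
    (hε : 0 ≤ ε) (hζ : 0 ≤ ζ) (hL : 0 ≤ L)
    (hεL : 200 * σ ^ 2 * ((k - 1) / 2 : ℕ) * (N * η₀ ^ 2) * L * d ^ 2 ≤ ε ^ 2)
    (hζL : 800 * σ ^ 2 * η₀ / (c * g) * L ≤ ζ ^ 2)
    (hδ : ((N * ((N + 1) * ((d + 1) * (d * d))) + ((N + 1) + d) : ℕ) : ℝ) * (2 * Real.exp (-L))
      ≤ δ) :
    ∃ A : Set Ω, MeasurableSet A ∧ 1 - δ ≤ P.real A ∧ ∀ ω ∈ A,
      NoiseBounds (k - 1) d T N η g v c ε ζ (contractedNoise r u E ω) := by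
  set m := (k - 1) / 2 with hm
  have hm2 : 2 ≤ m := by omega
  have hd0 : (5 : ℝ) ≤ d := by exact_mod_cast hd
  have hN0 : (0 : ℝ) < N := by exact_mod_cast hN
  have hm0 : (0 : ℝ) < m := by exact_mod_cast (by omega : 0 < m)
  have htr : ∀ l, 0 < trunc d l := fun l => by unfold trunc; positivity
  have hsq : ∀ t, η t ^ 2 ≤ η₀ ^ 2 := fun t => pow_le_pow_left₀ (hη0 t) (hη t) 2
  let B : (Fin N × Fin (N + 1) × Fin (d + 1) × Fin d × Fin d) ⊕ (Fin (N + 1) ⊕ Fin d) → Set Ω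
    | Sum.inl (s, t, l, i, j) => {ω | ε * trunc d l / d < |noiseSum (k - 1) η g v s
        (fun t => factorK (k - 1) (η t * g) v)
        (nonexpandingSet (k - 1) (fun t => η t * g) v (trunc d l) s) (orth v (Matrix.single i j 1))
        (normIter (k - 1) η g v (contractedNoise r u E ω)) (contractedNoise r u E ω) t|}
    | Sum.inr (Sum.inl t) => {ω | ε < |noiseSum (k - 1) η g v 0 (fun _ _ => 1)
        (fun _ => correlatedSet v (trunc d 0)) (Matrix.vecMulVec v.ofLp v.ofLp)
        (normIter (k - 1) η g v (contractedNoise r u E ω)) (contractedNoise r u E ω) t|}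
    | Sum.inr (Sum.inr i) => {ω | ζ < |noiseSum (k - 1) η g v T
        (fun t => factorK (k - 1) (η t * g) v)
        (contractingSet (k - 1) (fun t => η t * g) v 5 c) (orth v (crossDir v i))
        (normIter (k - 1) η g v (contractedNoise r u E ω)) (contractedNoise r u E ω) N|}
  have hV : ∀ F : ℝ, ∀ t < N, (1 : ℝ) ^ 2 * (t * (2 * m * η₀ ^ 2 * F ^ 2)) + 2 * m * η t ^ 2 * F ^ 2 * 1
      ≤ ((t + 1 : ℕ) : ℝ) * (2 * m * η₀ ^ 2 * F ^ 2) := by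
    intro F t _
    have : 2 * m * η t ^ 2 * F ^ 2 ≤ 2 * m * η₀ ^ 2 * F ^ 2 := by
      have := hsq t
      gcongr
    push_cast
    linarith
  have hVb : ∀ F : ℝ, ∀ t ≤ N, (t : ℝ) * (2 * m * η₀ ^ 2 * F ^ 2) ≤ N * (2 * m * η₀ ^ 2 * F ^ 2) := by
    intro F t ht
    have : (t : ℝ) ≤ N := by exact_mod_cast ht
    gcongr
  have hB : ∀ i, P (B i) ≤ ENNReal.ofReal (2 * Real.exp (-L)) := by
    rintro (⟨s, t, l, i, j⟩ | t | i)
    · refine measure_lt_abs_noiseSum_le hE hk h5 hσ hr hu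
        (fun t => measurable_factorK _ v) (fun t => measurableSet_nonexpandingSet _ v _ _ t)
        (κb := fun _ => 1) (V := fun t => t * (2 * m * η₀ ^ 2 * trunc d l ^ 2)) (F := trunc d l)
        (x := 1) (b := N * (2 * m * η₀ ^ 2 * trunc d l ^ 2)) (fun _ => zero_le_one) ?_
        (fun t W hW => hW.1.2)
        ((frobInner_orth_self_le hv _).trans (frobInner_single_self i j).le)
        (by simp) (hV _) t (Nat.lt_succ_iff.1 t.2) (hVb _ t (Nat.lt_succ_iff.1 t.2)) ?_ hL ?_ ?_
      · rintro t hst W ⟨-, hW | hW⟩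
        · omega
        · exact hW
      · have := htr l
        positivity
      · have := htr l
        positivity
      -- The variance is proportional to the squared truncation level, which cancels against the
      -- threshold; d² is the price of entrywise control.
      · rw [div_pow, le_div_iff₀ (by positivity), mul_pow]
        have h1 : 0 ≤ σ ^ 2 * m * (N * η₀ ^ 2) * L * d ^ 2 := by positivity
        have h2 : 8 * σ ^ 2 * m * (N * η₀ ^ 2) * L * d ^ 2 ≤ ε ^ 2 := by linarith
        calc 4 * σ ^ 2 * (N * (2 * m * η₀ ^ 2 * trunc d l ^ 2)) * L * d ^ 2
            = 8 * σ ^ 2 * m * (N * η₀ ^ 2) * L * d ^ 2 * trunc d l ^ 2 := by ring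
          _ ≤ _ := by gcongr
    · refine measure_lt_abs_noiseSum_le hE hk h5 hσ hr hu
        (fun t => measurable_const) (fun t => measurableSet_correlatedSet v _)
        (κb := fun _ => 1) (V := fun t => t * (2 * m * η₀ ^ 2 * trunc d 0 ^ 2)) (F := trunc d 0)
        (x := 1) (b := N * (2 * m * η₀ ^ 2 * trunc d 0 ^ 2)) (fun _ => zero_le_one)
        (fun _ _ _ _ => by simp) (fun t W hW => hW.2) ?_
        (by simp) (hV _) t (Nat.lt_succ_iff.1 t.2) (hVb _ t (Nat.lt_succ_iff.1 t.2)) ?_ hL hε ?_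
      · rw [frobInner_vecMulVec_vecMulVec, ← norm_sq_eq_dotProduct, hv]; norm_num
      · have := htr 0
        positivity
      · have h1 : 0 ≤ σ ^ 2 * m * (N * η₀ ^ 2) * L := by positivity
        -- Here the threshold ε does not scale with the level; trunc² ≤ 25 d² raises the constant
        -- from 8 to 200.
        have h2 : trunc d 0 ^ 2 ≤ 25 * (d : ℝ) ^ 2 := by
          have h3 : √(d : ℝ) ≤ d - 1 := Real.sqrt_le_iff.2 ⟨by linarith, by nlinarith⟩
          have h4 : trunc d 0 ≤ 5 * d := by simp only [trunc, pow_zero, div_one]; linarith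
          have h5 := pow_le_pow_left₀ (htr 0).le h4 2
          linarith
        calc 4 * σ ^ 2 * (N * (2 * m * η₀ ^ 2 * trunc d 0 ^ 2)) * L
            = 8 * (σ ^ 2 * m * (N * η₀ ^ 2) * L) * trunc d 0 ^ 2 := by ring
          _ ≤ 8 * (σ ^ 2 * m * (N * η₀ ^ 2) * L) * (25 * (d : ℝ) ^ 2) := by gcongr
          _ = 200 * σ ^ 2 * m * (N * η₀ ^ 2) * L * d ^ 2 := by ring
          _ ≤ _ := hεL
    -- The contraction admits a constant variance V = 200η₀/(cg): the loss V c η g m = 200 m η₀ η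
    -- outweighs the gain 200 m η². Here 200 = 2·5²·4, from the norm bound 5 and the squared length
    -- 4 of the direction.
    · have hcx : ∀ t, c * (η t * g * m) ≤ 1 := fun t => by
        refine le_trans ?_ hcη
        have := hη t
        gcongr
      refine measure_lt_abs_noiseSum_le hE hk h5 hσ hr hu
        (fun t => measurable_factorK _ v) (fun t => measurableSet_contractingSet _ v _ _ t)
        (κb := fun t => if T < t then 1 - c * (η t * g * m) else 0)
        (V := fun _ => 200 * η₀ / (c * g)) (F := 5)
        (x := 4) (b := 200 * η₀ / (c * g)) ?_ ?_ (fun t W hW => hW.1)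
        ((frobInner_orth_self_le hv _).trans (frobInner_crossDir_self_le hv i))
        (by positivity) ?_ N le_rfl le_rfl (by positivity) hL hζ ?_
      · intro t
        split_ifs
        · have := hcx t
          linarith
        · exact le_rfl
      · intro t hst W hW
        simp only [if_pos hst]
        exact hW.2
      · intro t _
        have hb : 200 * m * η t ^ 2 ≤ 200 * η₀ / (c * g) * (c * (η t * g * m)) := by
          have : 200 * η₀ / (c * g) * (c * (η t * g * m)) = 200 * m * (η₀ * η t) := by
            field_simp
          rw [this, sq]
          have h1 := mul_le_mul_of_nonneg_right (hη t) (hη0 t)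
          gcongr
        have hb0 : 0 < 200 * η₀ / (c * g) := by positivity
        have hx0 : 0 ≤ c * (η t * g * m) := by have := hη0 t; positivity
        have hx1 := hcx t
        set b := 200 * η₀ / (c * g)
        set x := c * (η t * g * m)
        split_ifs
        · have h2 : (1 - x) ^ 2 ≤ 1 - x := by nlinarith
          have h3 := mul_le_mul_of_nonneg_right h2 hb0.le
          linarith
        · have := mul_le_mul_of_nonneg_left hx1 hb0.le
          linarith
      · refine le_trans (le_of_eq ?_) hζL
        ring
  obtain ⟨A, hA, hPA, hAB⟩ := exists_measurableSet_of_forall_measure_le (P := P) (B := B)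
    (r := 2 * Real.exp (-L)) (δ := δ) (by positivity) hB (by simpa using hδ)
  refine ⟨A, hA, hPA, fun ω hω => ⟨?_, ?_, ?_⟩⟩
  · intro s t l hs ht hl i j
    exact not_lt.1 (hAB ω hω (Sum.inl (⟨s, hs⟩, ⟨t, by omega⟩, ⟨l, by omega⟩, i, j)))
  · intro t ht
    exact not_lt.1 (hAB ω hω (Sum.inr (Sum.inl ⟨t, by omega⟩)))
  · intro i
    exact not_lt.1 (hAB ω hω (Sum.inr (Sum.inr i)))

end NoiseBounds

/-! ### From the noise bounds to recovery of the signal. -/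

section Recovery

variable {d n T N : ℕ} {η : ℕ → ℝ} {g : ℝ} {v : EuclideanSpace ℝ (Fin d)} {c ε ζ : ℝ}
  {Z : ℕ → Tensor d n}

lemma factorK_eq (hv : ‖v‖ = 1) (y : ℝ) (W : Matrix (Fin d) (Fin d) ℝ) :
    factorK n y v W
      = stepK (n / 2) y (signal v W / √(signal v W ^ 2 + frobNorm (orth v W) ^ 2)) := by
  rw [factorK, ← frobNorm_eq_sqrt hv]

lemma signal_one (hv : ‖v‖ = 1) : signal v 1 = 1 := by
  rw [signal, frobInner_vecMulVec, Matrix.one_mulVec, ← norm_sq_eq_dotProduct, hv]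
  norm_num

lemma frobNorm_one : frobNorm (1 : Matrix (Fin d) (Fin d) ℝ) = √d := by
  rw [frobNorm]
  congr 1
  simp [Matrix.one_apply]

/-- The noise bounds make the normalised iterates follow a noisy orbit. -/
lemma NoiseBounds.noisyOrbit (hb : NoiseBounds n d T N η g v c ε ζ Z) (hn : Even n) (h4 : 4 ≤ n)
    (hd : 5 ≤ d) (hv : ‖v‖ = 1) (hg : 0 < g) (hη : ∀ t, 0 ≤ η t) {x : ℝ} (hx0 : 0 < x)
    (hxe : x ≤ Real.exp 1) (hfirst : ∀ t < T, η t * g * (n / 2 : ℕ) = x)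
    (hlater : ∀ t, T ≤ t → η t * g * (n / 2 : ℕ) ≤ x / 2) (hε : 0 ≤ ε)
    (hεm : ε * (n / 2 : ℕ) ≤ 1 / 1000) :
    NoisyOrbit (n / 2) d T N (fun t => η t * g) x ε (fun t => signal v (normIter n η g v Z t))
      (fun t => frobNorm (orth v (normIter n η g v Z t))) where
  two_le := by omega
  x_pos := hx0
  x_le := hxe
  y_nonneg t := mul_nonneg (hη t) hg.le
  y_first := hfirst
  y_later := hlater
  eps_nonneg := hε
  eps_le := hεm
  p_nonneg t := frobNorm_nonneg _
  p_zero := by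
    have h := frobNorm_sq_eq hv (1 : Matrix (Fin d) (Fin d) ℝ)
    rw [← frobNorm_one (d := d)]
    change frobNorm (orth v 1) ≤ _
    refine le_of_sq_le_sq (b := frobNorm (1 : Matrix (Fin d) (Fin d) ℝ)) ?_ (frobNorm_nonneg _)
    nlinarith [sq_nonneg (signal v (1 : Matrix (Fin d) (Fin d) ℝ))]
  a_bound t ht hr := by
    have h := eq_prod_mul_add_noiseSum (s := 0) (q := fun _ _ => 1) (η := η) (g := g) (v := v)
      (G := fun _ => correlatedSet v (trunc d 0)) (X := Matrix.vecMulVec v.ofLp v.ofLp)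
      (Y := normIter n η g v Z) (Z := Z) (x := fun t => signal v (normIter n η g v Z t))
      t (Nat.zero_le t) (fun r _ hrt => by
        rw [one_mul]
        exact signal_normStep hn h4 (mul_nonneg (hη r) hg.le) hv (Z r) (hr r hrt).1)
      (fun r _ hrt => ⟨(hr r hrt).1, by
        rw [frobNorm_eq_sqrt hv]; exact (hr r hrt).2⟩)
    have h1 : signal v (normIter n η g v Z 0) = 1 := signal_one hv
    simp only [Finset.prod_const_one, one_mul, h1] at h
    rw [h, add_sub_cancel_left]
    exact hb.sig t ht
  p_bound l hl s t hst htN hF hK := by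
    have hmem : ∀ r, s ≤ r → r < t → normIter n η g v Z r
        ∈ nonexpandingSet n (fun t => η t * g) v (trunc d l) s r := by
      intro r hsr hrt
      refine ⟨⟨(hF r hsr hrt).1, by rw [frobNorm_eq_sqrt hv]; exact (hF r hsr hrt).2⟩, ?_⟩
      rcases hsr.eq_or_lt with rfl | hsr
      · exact Or.inl rfl
      · exact Or.inr (by rw [factorK_eq hv]; exact hK r hsr hrt)
    set Y := normIter n η g v Z with hY
    set Q := ∏ r ∈ Finset.Ico s t, factorK n (η r * g) v (Y r) with hQ
    have hentry : ∀ i j, frobInner (Matrix.single i j 1) (orth v (Y t))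
        = Q * frobInner (Matrix.single i j 1) (orth v (Y s))
          + noiseSum n η g v s (fun t => factorK n (η t * g) v)
            (nonexpandingSet n (fun t => η t * g) v (trunc d l) s)
            (orth v (Matrix.single i j 1)) Y Z t := fun i j =>
      eq_prod_mul_add_noiseSum (q := fun t => factorK n (η t * g) v)
        (x := fun t => frobInner (Matrix.single i j 1) (orth v (Y t))) t hst.le
        (fun r _ _ => frobInner_orth_normStep hn h4 (η r) g hv (Z r) (Y r) _) hmem
    have hdec : orth v (Y t) = Q • orth v (Y s) + Matrix.of fun i j =>
        noiseSum n η g v s (fun t => factorK n (η t * g) v)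
            (nonexpandingSet n (fun t => η t * g) v (trunc d l) s)
            (orth v (Matrix.single i j 1)) Y Z t := by
      ext i j
      have := hentry i j
      rw [frobInner_single, frobInner_single] at this
      simpa using this
    have hd0 : (0 : ℝ) < d := by exact_mod_cast (by omega : 0 < d)
    have hnoise : frobNorm (Matrix.of fun i j =>
        noiseSum n η g v s (fun t => factorK n (η t * g) v)
            (nonexpandingSet n (fun t => η t * g) v (trunc d l) s)
            (orth v (Matrix.single i j 1)) Y Z t) ≤ ε * trunc d l := by
      have htr : 0 ≤ trunc d l := by unfold trunc; positivity
      refine (frobNorm_le_of_entries _ (c := ε * trunc d l / d) (by positivity) fun i j => ?_).trans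
        (le_of_eq (by field_simp))
      exact hb.entry s t l (by omega) htN hl i j
    have hQabs : |Q| = ∏ r ∈ Finset.Ico s t, |stepK (n / 2) (η r * g)
        (signal v (Y r) / √(signal v (Y r) ^ 2 + frobNorm (orth v (Y r)) ^ 2))| := by
      rw [hQ, Finset.abs_prod]
      exact Finset.prod_congr rfl fun r _ => by rw [factorK_eq hv]
    change frobNorm (orth v (Y t)) ≤ _
    rw [hdec]
    refine (frobNorm_add_le _ _).trans (add_le_add ?_ hnoise)
    rw [frobNorm_smul, hQabs]

lemma isTopEigenvector_of_smul {A : Matrix (Fin d) (Fin d) ℝ} {w : EuclideanSpace ℝ (Fin d)}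
    {D : ℝ} (hD : 0 < D) (hw : IsTopEigenvector (D • A) w) : IsTopEigenvector A w := by
  obtain ⟨h1, μ, h2, h3⟩ := hw
  refine ⟨h1, D⁻¹ * μ, ?_, fun ν hν => ?_⟩
  · rw [mul_smul, ← h2, Matrix.smul_mulVec, smul_smul, inv_mul_cancel₀ hD.ne', one_smul]
  · obtain ⟨z, hz, hz0⟩ := hν.exists_hasEigenvector
    have h4 := h3 (D * ν) (Module.End.hasEigenvalue_of_hasEigenvector (x := z) ⟨by
      rw [Module.End.mem_eigenspace_iff] at hz ⊢
      rw [Matrix.toLin'_apply] at hz ⊢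
      rw [Matrix.smul_mulVec, hz, smul_smul], hz0⟩)
    rw [inv_mul_eq_div, le_div_iff₀ hD]
    linarith

lemma sum_mulVec_sq_le {M : Matrix (Fin d) (Fin d) ℝ} (hv : ‖v‖ = 1) :
    ((M + Mᵀ) *ᵥ v.ofLp) ⬝ᵥ ((M + Mᵀ) *ᵥ v.ofLp) ≤ (2 * frobNorm M) ^ 2 := by
  set w := (M + Mᵀ) *ᵥ v.ofLp with hw
  have hvv : v.ofLp ⬝ᵥ v.ofLp = 1 := by rw [← norm_sq_eq_dotProduct, hv]; norm_num
  have h0 : 0 ≤ w ⬝ᵥ w := by simpa using dotProduct_star_self_nonneg w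
  have h1 : w ⬝ᵥ w = frobInner (Matrix.vecMulVec w v.ofLp) M
      + frobInner (Matrix.vecMulVec v.ofLp w) M := by
    rw [frobInner_vecMulVec, frobInner_vecMulVec]
    nth_rewrite 2 [hw]
    rw [Matrix.add_mulVec, dotProduct_add, Matrix.mulVec_transpose, dotProduct_comm w (_ ᵥ* M),
      ← Matrix.dotProduct_mulVec]
  have h2 : frobNorm (Matrix.vecMulVec w v.ofLp) ^ 2 = w ⬝ᵥ w := by
    rw [frobNorm_sq, frobInner_vecMulVec_vecMulVec, hvv, mul_one]
  have h3 : frobNorm (Matrix.vecMulVec v.ofLp w) ^ 2 = w ⬝ᵥ w := by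
    rw [frobNorm_sq, frobInner_vecMulVec_vecMulVec, hvv, one_mul]
  have h4 := (le_abs_self _).trans (abs_frobInner_le (Matrix.vecMulVec w v.ofLp) M)
  have h5 := (le_abs_self _).trans (abs_frobInner_le (Matrix.vecMulVec v.ofLp w) M)
  have h6 : frobNorm (Matrix.vecMulVec v.ofLp w) = frobNorm (Matrix.vecMulVec w v.ofLp) :=
    (sq_eq_sq₀ (frobNorm_nonneg _) (frobNorm_nonneg _)).1 (h3.trans h2.symm)
  rw [h6] at h5
  set a := frobNorm (Matrix.vecMulVec w v.ofLp)
  have ha : 0 ≤ a := frobNorm_nonneg _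
  have hM := frobNorm_nonneg M
  rw [← h2] at h1 ⊢
  have h7 : a ^ 2 ≤ a * (2 * frobNorm M) := by linarith
  rcases ha.eq_or_lt with h | h
  · rw [← h, zero_pow two_ne_zero]; positivity
  · rw [sq] at h7
    have := le_of_mul_le_mul_left h7 h
    gcongr

/-- Under the noise bounds, top eigenvectors of the symmetric part of the last iterate are close
to the signal. -/
lemma NoiseBounds.signedSqError_le {c : ℝ} (hc : c = Real.exp (-13) / 2)
    (hb : NoiseBounds n d T N η g v c ε ζ Z) (hn : Even n) (h4 : 4 ≤ n)
    (hd : 5 ≤ d) (hv : ‖v‖ = 1) (hg : 0 < g) (hη : ∀ t, 0 ≤ η t) {x : ℝ} (hx0 : 0 < x)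
    (hxe : x ≤ Real.exp 1) (hfirst : ∀ t < T, η t * g * (n / 2 : ℕ) = x)
    (hlater : ∀ t, T ≤ t → η t * g * (n / 2 : ℕ) ≤ x / 2) (hε : 0 ≤ ε)
    (hεm : ε * (n / 2 : ℕ) ≤ 1 / 1000)
    (hsecond : ∀ t, T ≤ t → t < 2 * T → η t * g * (n / 2 : ℕ) = x / 2) (hTN : 2 * T ≤ N)
    {L : ℕ} (hL : L ≤ d) (hLs : √d / 2 ^ L ≤ 3 / √(n / 2 : ℕ))
    (hbudget : 11 * ∑ j ∈ Finset.range L, √(1 + (√d / 2 ^ j) ^ 2) ^ (n / 2 - 2) ≤ x * T)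
    (hcT : 8 ≤ c * (x * T)) {D : ℝ} (hD : 0 < D) {w : EuclideanSpace ℝ (Fin d)}
    (hw : IsTopEigenvector (D • normIter n η g v Z N + (D • normIter n η g v Z N)ᵀ) w) :
    signedSqError w v ≤ 208 * Real.exp (-(c * (x * T))) + 4 * d * ζ ^ 2 := by
  have ho := hb.noisyOrbit hn h4 hd hv hg hη hx0 hxe hfirst hlater hε hεm
  have hTN' : T ≤ N := by omega
  have hT0 : 0 < T := by
    rcases Nat.eq_zero_or_pos T with rfl | h
    · simp at hcT; linarith
    · exact h
  have hc0 : 0 < c := by rw [hc]; positivity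
  set m := n / 2 with hm
  set Y := normIter n η g v Z with hY
  have hp := ho.p_le_later hd hTN' hL hLs hbudget
  have ha := ho.a_near_one hd
  have hK : ∀ t, T ≤ t → t ≤ N → |factorK n (η t * g) v (Y t)| ≤ 1 - c * (η t * g * m) := by
    intro t h1 h2
    rw [factorK_eq hv, hc]
    exact ho.K_le_later hd h1 h2 (hp t h1 h2)
  have hm7 := ho.sqrt_m_ge
  have hm0 : 0 < √(m : ℝ) := by linarith
  have h5m : 5 / √(m : ℝ) ≤ 18 / 5 := by rw [div_le_iff₀ hm0]; linarith
  have hε' := ho.eps_le'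
  have hF : ∀ t, T ≤ t → t ≤ N → 0 < signal v (Y t) ∧ frobNorm (Y t) ≤ 5 := by
    intro t h1 h2
    have h3 := abs_le.1 (ha t h2)
    have h4 := hp t h1 h2
    have h5 := ho.p_nonneg t
    have h6 := ho.a_pos (ha t h2)
    refine ⟨h6, ?_⟩
    rw [frobNorm_eq_sqrt hv]
    exact Real.sqrt_le_iff.2 ⟨by norm_num, by nlinarith⟩
  -- the total contraction after the first phase
  set Q := ∏ r ∈ Finset.Ico T N, |factorK n (η r * g) v (Y r)| with hQ
  have hQ0 : 0 ≤ Q := Finset.prod_nonneg fun _ _ => abs_nonneg _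
  -- Only the second phase, with step-size exactly half the initial one, is counted; later factors
  -- are bounded by 1.
  have hQle : Q ≤ Real.exp (-(c * (x * T)) / 2) := by
    rw [hQ, ← Finset.prod_Ico_consecutive _ (by omega : T ≤ 2 * T) hTN]
    have h1 : ∏ r ∈ Finset.Ico (2 * T) N, |factorK n (η r * g) v (Y r)| ≤ 1 :=
      Finset.prod_le_one (fun _ _ => abs_nonneg _) fun r hr => by
        have hr := Finset.mem_Ico.1 hr
        refine (hK r (by omega) (by omega)).trans ?_
        have := hη r
        have : 0 ≤ c * (η r * g * m) := by positivity
        linarith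
    have h2 : ∏ r ∈ Finset.Ico T (2 * T), |factorK n (η r * g) v (Y r)|
        ≤ ∏ _r ∈ Finset.Ico T (2 * T), Real.exp (-(c * (x / 2))) := by
      refine Finset.prod_le_prod (fun _ _ => abs_nonneg _) fun r hr => ?_
      have hr := Finset.mem_Ico.1 hr
      refine (hK r hr.1 (by omega)).trans ?_
      rw [hsecond r hr.1 hr.2]
      have := Real.add_one_le_exp (-(c * (x / 2)))
      linarith
    have h3 : ∏ _r ∈ Finset.Ico T (2 * T), Real.exp (-(c * (x / 2)))
        = Real.exp (-(c * (x * T)) / 2) := by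
      rw [Finset.prod_const, Nat.card_Ico, ← Real.exp_nat_mul]
      congr 1
      rw [show 2 * T - T = T by omega]
      ring
    calc _ ≤ Real.exp (-(c * (x * T)) / 2) * 1 := by
          rw [← h3]
          exact mul_le_mul h2 h1 (Finset.prod_nonneg fun _ _ => abs_nonneg _)
            (Finset.prod_nonneg fun _ _ => (Real.exp_pos _).le)
      _ = _ := mul_one _
  have hQsmall : Q ≤ 1 / 20 := by
    refine hQle.trans ?_
    calc Real.exp (-(c * (x * T)) / 2) ≤ Real.exp (-4) := Real.exp_le_exp.2 (by linarith)
      _ ≤ 1 / 20 := by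
        rw [Real.exp_neg, ← one_div]
        have h1 : Real.exp 4 = Real.exp 1 ^ 4 := by rw [← Real.exp_nat_mul]; norm_num
        have h2 := Real.exp_one_gt_d9
        have h3 : (20 : ℝ) ≤ Real.exp 1 ^ 4 := by
          have : (5 / 2 : ℝ) ^ 4 ≤ Real.exp 1 ^ 4 := by gcongr; linarith
          linarith
        rw [h1]
        gcongr
  -- the gap
  have hpN : frobNorm (orth v (Y N)) ≤ 1 / 4 := by
    have h1 := ho.p_bound L hL T N (by omega) le_rfl
      (fun r h1 h2 => by
        have h3 := hF r h1 h2.le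
        refine ⟨h3.1, ?_⟩
        rw [← frobNorm_eq_sqrt hv]
        refine h3.2.trans ?_
        have : 0 ≤ √(d : ℝ) / 2 ^ L := by positivity
        unfold trunc
        linarith)
      (fun r h1 h2 => by
        have h3 := hK r h1.le h2.le
        rw [factorK_eq hv] at h3
        refine h3.trans ?_
        have := hη r
        have : 0 ≤ c * (η r * g * m) := by positivity
        linarith)
    have h2 : ∏ r ∈ Finset.Ico T N, |stepK m (η r * g)
        (signal v (Y r) / √(signal v (Y r) ^ 2 + frobNorm (orth v (Y r)) ^ 2))| = Q :=
      Finset.prod_congr rfl fun r _ => by rw [factorK_eq hv]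
    rw [h2] at h1
    have h3 : Q * frobNorm (orth v (Y T)) ≤ 1 / 20 * (18 / 5) :=
      mul_le_mul hQsmall ((hp T le_rfl hTN').trans h5m) (frobNorm_nonneg _) (by norm_num)
    have h4 : 3 / √(m : ℝ) ≤ 11 / 5 := by rw [div_le_iff₀ hm0]; linarith
    have h5 := ho.eps_trunc_le L
    linarith
  -- the cross terms
  set M := orth v (Y N) with hM
  have hcross : ((M + Mᵀ) *ᵥ v.ofLp) ⬝ᵥ ((M + Mᵀ) *ᵥ v.ofLp)
      ≤ 104 * Real.exp (-(c * (x * T))) + 2 * d * ζ ^ 2 := by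
    set M₀ := orth v (Y T) with hM₀
    set R := ∏ r ∈ Finset.Ico T N, factorK n (η r * g) v (Y r) with hR
    have hRQ : R ^ 2 = Q ^ 2 := by rw [hQ, ← Finset.abs_prod, sq_abs]
    -- Each coordinate is unrolled from the end of the first phase, so its noise is damped
    -- geometrically.
    have hcoord : ∀ i, ((M + Mᵀ) *ᵥ v.ofLp) i = R * ((M₀ + M₀ᵀ) *ᵥ v.ofLp) i
          + noiseSum n η g v T (fun t => factorK n (η t * g) v)
            (contractingSet n (fun t => η t * g) v 5 c) (orth v (crossDir v i)) Y Z N := by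
      intro i
      rw [← frobInner_crossDir, ← frobInner_crossDir]
      exact eq_prod_mul_add_noiseSum (q := fun t => factorK n (η t * g) v)
        (x := fun t => frobInner (crossDir v i) (orth v (Y t))) N hTN'
        (fun r _ _ => frobInner_orth_normStep hn h4 (η r) g hv (Z r) (Y r) _)
        (fun r h1 h2 => ⟨(hF r h1 h2.le).2, hK r h1 h2.le⟩)
    have hM₀le := sum_mulVec_sq_le (v := v) (M := M₀) hv
    have hM₀' : frobNorm M₀ ≤ 18 / 5 := (hp T le_rfl hTN').trans h5m
    have hM₀0 := frobNorm_nonneg M₀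
    have hsum : ((M + Mᵀ) *ᵥ v.ofLp) ⬝ᵥ ((M + Mᵀ) *ᵥ v.ofLp)
        ≤ 2 * R ^ 2 * (((M₀ + M₀ᵀ) *ᵥ v.ofLp) ⬝ᵥ ((M₀ + M₀ᵀ) *ᵥ v.ofLp)) + 2 * d * ζ ^ 2 := by
      have h1 : ∀ i, ((M + Mᵀ) *ᵥ v.ofLp) i * ((M + Mᵀ) *ᵥ v.ofLp) i
          ≤ 2 * R ^ 2 * (((M₀ + M₀ᵀ) *ᵥ v.ofLp) i * ((M₀ + M₀ᵀ) *ᵥ v.ofLp) i) + 2 * ζ ^ 2 := by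
        intro i
        have h2 := abs_le.1 (hb.cross i)
        have h3 := hcoord i
        set nz := noiseSum n η g v T (fun t => factorK n (η t * g) v)
            (contractingSet n (fun t => η t * g) v 5 c) (orth v (crossDir v i)) Y Z N with hnz
        have h5 : nz ^ 2 ≤ ζ ^ 2 := sq_le_sq' h2.1 h2.2
        rw [h3]
        nlinarith [sq_nonneg (R * ((M₀ + M₀ᵀ) *ᵥ v.ofLp) i - nz)]
      calc _ ≤ ∑ i, (2 * R ^ 2 * (((M₀ + M₀ᵀ) *ᵥ v.ofLp) i * ((M₀ + M₀ᵀ) *ᵥ v.ofLp) i)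
            + 2 * ζ ^ 2) := Finset.sum_le_sum fun i _ => h1 i
        _ = _ := by
          rw [Finset.sum_add_distrib, ← Finset.mul_sum]
          simp [dotProduct]
          ring
    have hQsq : Q ^ 2 ≤ Real.exp (-(c * (x * T))) := by
      calc Q ^ 2 ≤ Real.exp (-(c * (x * T)) / 2) ^ 2 := by gcongr
        _ = _ := by rw [← Real.exp_nat_mul]; congr 1; push_cast; ring
    have h8 : 2 * R ^ 2 * (((M₀ + M₀ᵀ) *ᵥ v.ofLp) ⬝ᵥ ((M₀ + M₀ᵀ) *ᵥ v.ofLp))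
        ≤ 2 * Real.exp (-(c * (x * T))) * (36 / 5) ^ 2 := by
      rw [hRQ]
      -- 36/5 = 2·18/5, and 2(36/5)² < 104.
      have h9 : ((M₀ + M₀ᵀ) *ᵥ v.ofLp) ⬝ᵥ ((M₀ + M₀ᵀ) *ᵥ v.ofLp) ≤ (36 / 5) ^ 2 :=
        hM₀le.trans (pow_le_pow_left₀ (by positivity) (by linarith) 2)
      have h10 : 0 ≤ ((M₀ + M₀ᵀ) *ᵥ v.ofLp) ⬝ᵥ ((M₀ + M₀ᵀ) *ᵥ v.ofLp) := by
        simpa using dotProduct_star_self_nonneg ((M₀ + M₀ᵀ) *ᵥ v.ofLp)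
      gcongr
    have := Real.exp_pos (-(c * (x * T)))
    linarith
  have hw' : IsTopEigenvector (Y N + (Y N)ᵀ) w :=
    isTopEigenvector_of_smul hD (by rwa [smul_add, ← Matrix.transpose_smul])
  have hfin := _root_.signedSqError_le hv hw' (a := signal v (Y N)) (M := M)
    (by simp [hM, orth]) (signal_orth hv (Y N)) hpN (by
      have := abs_le.1 (ha N le_rfl)
      linarith)
  linarith

end Recovery

/-! ### The time budget as a function of the dimension. -/

section Parameters

/-- The order of magnitude of the time, in units of the inverse step-size, after which the signal
dominates. -/
def growthTime (m d : ℕ) : ℝ := if m = 2 then Real.log d else √d ^ (m - 2)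

/-- The factor of the step-size rate that depends on the dimension. -/
def stepFactor (k d N : ℕ) : ℝ :=
  max (Real.log N / ((k : ℝ) - 1))
      (((k : ℝ) - 1) * (d : ℝ) ^ (((k : ℝ) - 1) / 4 - 1)
        / max (((k : ℝ) - 1) * ((k : ℝ) - 5)) (Real.log d)⁻¹)

lemma one_le_log_of_five_le {d : ℕ} (hd : 5 ≤ d) : 1 ≤ Real.log d := by
  have hd0 : (5 : ℝ) ≤ d := by exact_mod_cast hd
  rw [Real.le_log_iff_exp_le (by linarith)]
  have := Real.exp_one_lt_d9
  linarith

lemma clog_le {d : ℕ} (hd : 5 ≤ d) : (Nat.clog 2 d : ℝ) ≤ 3 * Real.log d := by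
  have hd0 : (5 : ℝ) ≤ d := by exact_mod_cast hd
  have h1 : 2 ^ (Nat.clog 2 d - 1) < d := by
    have := Nat.pow_pred_clog_lt_self one_lt_two (by omega : 1 < d)
    simpa using this
  have hpos : 0 < Nat.clog 2 d := Nat.clog_pos one_lt_two (by omega)
  have h2 : ((Nat.clog 2 d - 1 : ℕ) : ℝ) * Real.log 2 ≤ Real.log d := by
    rw [← Real.log_pow]
    exact Real.log_le_log (by positivity) (by exact_mod_cast h1.le)
  rw [Nat.cast_sub hpos] at h2
  have h3 := Real.log_two_gt_d9
  have h4 := one_le_log_of_five_le hd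
  push_cast at h2
  have h5 : 0 ≤ (Nat.clog 2 d : ℝ) := Nat.cast_nonneg _
  nlinarith

/-- For m = 2 all terms are 1 and their number counts. For m > 2 divide by √d^{m-2}: the terms j ≥ 1
have base at most 1, so one power gives 2^{-j} + 1/√d, and the 1/√d add up to a constant as log d ≤
2√d. The term j = 0 is (1+1/d)^{(m-2)/2}, bounded because m ≤ d. -/
lemma sum_sqrt_pow_le {m d : ℕ} (hm : 2 ≤ m) (hmd : m ≤ d) (hd : 5 ≤ d) :
    11 * ∑ j ∈ Finset.range (Nat.clog 2 d), √(1 + (√d / 2 ^ j) ^ 2) ^ (m - 2)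
      ≤ 200 * growthTime m d := by
  have hd0 : (5 : ℝ) ≤ d := by exact_mod_cast hd
  have hL := clog_le hd
  rcases hm.eq_or_lt with rfl | hm3
  · have h1 := one_le_log_of_five_le hd
    simp only [Nat.sub_self, pow_zero, Finset.sum_const, Finset.card_range, nsmul_eq_mul,
      mul_one, growthTime, if_true]
    linarith
  · rw [growthTime, if_neg (by omega)]
    have hs0 : 0 < √(d : ℝ) := by positivity
    have hterm : ∀ j, √(1 + (√d / 2 ^ j) ^ 2) ^ (m - 2)
        ≤ √(d : ℝ) ^ (m - 2) * (2 * ((1 / 2) ^ j + 1 / √d)) := by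
      intro j
      have e1 : √(1 + (√d / 2 ^ j) ^ 2) = √d * √(((1 / 2) ^ j) ^ 2 + 1 / d) := by
        rw [← Real.sqrt_mul (by positivity)]
        congr 1
        rw [div_pow, Real.sq_sqrt (by positivity), one_div, inv_pow]
        field_simp
        ring
      rw [e1, mul_pow]
      gcongr
      have e2 : √(((1 / 2 : ℝ) ^ j) ^ 2 + 1 / d) ≤ (1 / 2) ^ j + 1 / √d := by
        rw [Real.sqrt_le_iff]
        refine ⟨by positivity, ?_⟩
        have : (1 / √(d : ℝ)) ^ 2 = 1 / d := by rw [div_pow, Real.sq_sqrt (by positivity), one_pow]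
        have h0 : 0 ≤ (1 / 2 : ℝ) ^ j * (1 / √d) := by positivity
        nlinarith
      rcases Nat.eq_zero_or_pos j with rfl | hj
      · have h1 : √(((1 / 2 : ℝ) ^ 0) ^ 2 + 1 / d) ≤ Real.exp (1 / (2 * d)) := by
          rw [Real.sqrt_le_iff]
          refine ⟨(Real.exp_pos _).le, ?_⟩
          have h2 := Real.add_one_le_exp (1 / (d : ℝ))
          have h3 : Real.exp (1 / (2 * d)) ^ 2 = Real.exp (1 / (d : ℝ)) := by
            rw [← Real.exp_nat_mul]
            congr 1
            push_cast
            field_simp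
          rw [h3]
          simp only [pow_zero, one_pow]
          linarith
        have h2 : Real.exp (1 / (2 * d)) ^ (m - 2) ≤ Real.exp (1 / 2) := by
          rw [← Real.exp_nat_mul, Real.exp_le_exp]
          have h3 : ((m - 2 : ℕ) : ℝ) ≤ d := by exact_mod_cast (by omega : m - 2 ≤ d)
          calc ((m - 2 : ℕ) : ℝ) * (1 / (2 * d)) ≤ d * (1 / (2 * d)) := by gcongr
            _ = 1 / 2 := by field_simp
        have h3 : Real.exp (1 / 2) ≤ 2 := by
          have := Real.exp_one_lt_d9
          have h5 : Real.exp (1 / 2) ^ 2 = Real.exp 1 := by rw [← Real.exp_nat_mul]; norm_num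
          have := Real.exp_pos (1 / 2)
          nlinarith
        have h4 : 0 ≤ 1 / √(d : ℝ) := by positivity
        calc _ ≤ Real.exp (1 / (2 * d)) ^ (m - 2) := by gcongr
          _ ≤ 2 := h2.trans h3
          _ ≤ _ := by rw [pow_zero]; linarith
      · have h1 : √(((1 / 2 : ℝ) ^ j) ^ 2 + 1 / d) ≤ 1 := by
          rw [Real.sqrt_le_iff]
          refine ⟨zero_le_one, ?_⟩
          have h2 : (1 / 2 : ℝ) ^ j ≤ 1 / 2 := by
            calc (1 / 2 : ℝ) ^ j ≤ (1 / 2) ^ 1 := pow_le_pow_of_le_one (by norm_num) (by norm_num) hj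
              _ = 1 / 2 := pow_one _
          have h3 : 1 / (d : ℝ) ≤ 1 / 5 := by gcongr
          have h4 : 0 ≤ (1 / 2 : ℝ) ^ j := by positivity
          nlinarith
        calc √(((1 / 2 : ℝ) ^ j) ^ 2 + 1 / d) ^ (m - 2) ≤ √(((1 / 2 : ℝ) ^ j) ^ 2 + 1 / d) ^ 1 :=
              pow_le_pow_of_le_one (Real.sqrt_nonneg _) h1 (by omega)
          _ ≤ (1 / 2) ^ j + 1 / √d := by rw [pow_one]; exact e2
          _ ≤ _ := by
              have : 0 ≤ (1 / 2 : ℝ) ^ j + 1 / √d := by positivity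
              linarith
    have hgeom : ∑ j ∈ Finset.range (Nat.clog 2 d), (1 / 2 : ℝ) ^ j ≤ 2 :=
      sum_geometric_two_le _
    have hlog : Real.log d ≤ 2 * √d := by
      have h1 := Real.log_le_sub_one_of_pos hs0
      have h2 : Real.log d = 2 * Real.log √d := by
        rw [Real.log_sqrt (by positivity)]; ring
      rw [h2]
      linarith
    have hLs : (Nat.clog 2 d : ℝ) * (1 / √d) ≤ 6 := by
      rw [mul_one_div, div_le_iff₀ hs0]
      linarith
    have hsum : ∑ j ∈ Finset.range (Nat.clog 2 d), √(1 + (√d / 2 ^ j) ^ 2) ^ (m - 2)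
        ≤ √(d : ℝ) ^ (m - 2) * 16 := by
      refine (Finset.sum_le_sum fun j _ => hterm j).trans ?_
      rw [← Finset.mul_sum, ← Finset.mul_sum, Finset.sum_add_distrib, Finset.sum_const,
        Finset.card_range, nsmul_eq_mul]
      have : 2 * (∑ j ∈ Finset.range (Nat.clog 2 d), (1 / 2 : ℝ) ^ j
          + (Nat.clog 2 d : ℝ) * (1 / √d)) ≤ 16 := by linarith
      gcongr
    have : 0 ≤ √(d : ℝ) ^ (m - 2) := by positivity
    linarith

lemma rpow_eq_sqrt_pow {m d : ℕ} (hm : 2 ≤ m) :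
    (d : ℝ) ^ ((((2 * m + 1 : ℕ) : ℝ) - 1) / 4 - 1) = √d ^ (m - 2) := by
  rw [Real.sqrt_eq_rpow, ← Real.rpow_natCast, ← Real.rpow_mul (Nat.cast_nonneg _)]
  congr 1
  rw [Nat.cast_sub hm]
  push_cast
  ring

/-- The step-size rate dominates both log N and the growth time. For m = 2 the product (k-1)(k-5)
vanishes and the maximum in the denominator selects 1/log d; for m > 2 it selects the product. -/
lemma stepFactor_bounds {m d N : ℕ} (hm : 2 ≤ m) (hd : 5 ≤ d) (hN : 1 ≤ N) :
    Real.log N / 2 ≤ m * stepFactor (2 * m + 1) d N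
      ∧ growthTime m d / 2 ≤ m * stepFactor (2 * m + 1) d N
      ∧ m * stepFactor (2 * m + 1) d N
        ≤ 8 * (√d ^ (m - 2) * max (Real.log N / √d ^ (m - 2)) (Real.log d)) := by
  have hM : (2 : ℝ) ≤ m := by exact_mod_cast hm
  have hd1 := one_le_log_of_five_le hd
  have hd0 : (5 : ℝ) ≤ d := by exact_mod_cast hd
  have hN0 : 0 ≤ Real.log N := Real.log_nonneg (by exact_mod_cast hN)
  set q := √(d : ℝ) ^ (m - 2) with hq
  have hq0 : 0 < q := by positivity
  set x := max (Real.log N / q) (Real.log d) with hx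
  have hx1 : Real.log N ≤ q * x := by
    have : q * (Real.log N / q) ≤ q * x := by gcongr; exact le_max_left _ _
    rwa [mul_div_cancel₀ _ hq0.ne'] at this
  have hx2 : Real.log d ≤ x := le_max_right _ _
  have hform : (m : ℝ) * stepFactor (2 * m + 1) d N = max (Real.log N / 2)
      ((m : ℝ) * (2 * m * q / max (2 * (m : ℝ) * (2 * m - 4)) (Real.log d)⁻¹)) := by
    rw [stepFactor, rpow_eq_sqrt_pow hm, mul_max_of_nonneg _ _ (by positivity)]
    push_cast
    rw [add_sub_cancel_right, show (2 * (m : ℝ) + 1 - 5) = 2 * m - 4 by ring]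
    congr 1
    field_simp
  have hsec : growthTime m d / 2 ≤ (m : ℝ) * (2 * m * q / max (2 * (m : ℝ) * (2 * m - 4)) (Real.log d)⁻¹)
      ∧ (m : ℝ) * (2 * m * q / max (2 * (m : ℝ) * (2 * m - 4)) (Real.log d)⁻¹) ≤ 8 * (q * x) := by
    rcases hm.eq_or_lt with rfl | hm3
    · have e1 : max (2 * ((2 : ℕ) : ℝ) * (2 * ((2 : ℕ) : ℝ) - 4)) (Real.log d)⁻¹ = (Real.log d)⁻¹ := by
        apply max_eq_right
        push_cast
        norm_num
        linarith
      have e2 : q = 1 := by simp [hq]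
      rw [e1, e2, growthTime, if_pos rfl]
      push_cast
      rw [div_inv_eq_mul]
      constructor <;> linarith
    · have hM3 : (3 : ℝ) ≤ m := by exact_mod_cast hm3
      have e1 : max (2 * (m : ℝ) * (2 * m - 4)) (Real.log d)⁻¹ = 2 * m * (2 * m - 4) := by
        apply max_eq_left
        have := inv_le_one_of_one_le₀ hd1
        nlinarith
      have hm4 : 0 < 2 * (m : ℝ) - 4 := by linarith
      have e2 : (m : ℝ) * (2 * m * q / (2 * m * (2 * m - 4))) = m * q / (2 * m - 4) := by
        field_simp
      rw [e1, e2, growthTime, if_neg (by omega), ← hq]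
      constructor
      · rw [le_div_iff₀ hm4]
        nlinarith
      · rw [div_le_iff₀ hm4]
        have : q ≤ q * x := le_mul_of_one_le_right hq0.le (by linarith)
        nlinarith
  rw [hform]
  refine ⟨le_max_left _ _, hsec.1.trans (le_max_right _ _), max_le ?_ hsec.2⟩
  linarith

/-- Contraction over a multiple of the growth time must beat the admissible signal size d^{k/4}; for
m > 2 the growth time even exceeds a multiple of (m-2) log d. -/
lemma rpow_le_exp_growthTime {m d : ℕ} (hm : 2 ≤ m) (hd : 5 ≤ d) :
    (d : ℝ) ^ (((2 * m + 1 : ℕ) : ℝ) / 4) ≤ Real.exp (10 * growthTime m d) := by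
  have hd1 := one_le_log_of_five_le hd
  have hd0 : (5 : ℝ) ≤ d := by exact_mod_cast hd
  rw [Real.rpow_def_of_pos (by linarith), Real.exp_le_exp]
  push_cast
  rcases hm.eq_or_lt with rfl | hm3
  · rw [growthTime, if_pos rfl]
    push_cast
    linarith
  · rw [growthTime, if_neg (by omega)]
    have hM3 : (3 : ℝ) ≤ m := by exact_mod_cast hm3
    have h1 : ((m : ℝ) - 2) / 2 * Real.log d ≤ √d ^ (m - 2) := by
      have h2 : √(d : ℝ) ^ (m - 2) = Real.exp (((m : ℝ) - 2) / 2 * Real.log d) := by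
        rw [← Real.exp_log (by positivity : 0 < √(d : ℝ) ^ (m - 2)), Real.log_pow,
          Real.log_sqrt (by positivity), Nat.cast_sub hm]
        push_cast
        ring_nf
      rw [h2]
      have := Real.add_one_le_exp (((m : ℝ) - 2) / 2 * Real.log d)
      linarith
    nlinarith

end Parameters

/-! ### Consequences of the step-size and sample-size conditions. -/

section Rates

variable {m d N : ℕ} {g η₀ σ δ a b : ℝ}

lemma stepRate_eq (k d N : ℕ) (g : ℝ) :
    stepRate k d N g = stepFactor k d N * (⌈Real.log N⌉₊ / (g * N)) := rfl

lemma le_of_mul_stepRate_le (hm : 2 ≤ m) (hd : 5 ≤ d) (hN : 2 ≤ N) (hg : 0 < g) (ha : 0 ≤ a)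
    (h : a * stepRate (2 * m + 1) d N g ≤ η₀) :
    a * (m * stepFactor (2 * m + 1) d N) * (Real.log N / N) ≤ η₀ * g * m := by
  have hN0 : (0 : ℝ) < N := by exact_mod_cast (by omega : 0 < N)
  have hB := (stepFactor_bounds hm hd (by omega : 1 ≤ N)).1
  have hl : 0 ≤ Real.log N := Real.log_nonneg (by exact_mod_cast (by omega : 1 ≤ N))
  have hB0 : 0 ≤ m * stepFactor (2 * m + 1) d N := by linarith
  have h1 : a * stepRate (2 * m + 1) d N g * (g * m) ≤ η₀ * (g * m) := by gcongr
  have h2 : a * stepRate (2 * m + 1) d N g * (g * m)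
      = a * (m * stepFactor (2 * m + 1) d N) * (⌈Real.log N⌉₊ / N) := by
    rw [stepRate_eq]
    field_simp
  rw [h2] at h1
  calc _ ≤ a * (m * stepFactor (2 * m + 1) d N) * (⌈Real.log N⌉₊ / N) := by
        gcongr
        exact Nat.le_ceil _
    _ ≤ _ := by linarith

lemma le_of_le_mul_stepRate (hm : 2 ≤ m) (hd : 5 ≤ d) (hN : 2 ≤ N) (hN1 : 1 ≤ Real.log N)
    (hg : 0 < g) (hb : 0 ≤ b) (h : η₀ ≤ b * stepRate (2 * m + 1) d N g) :
    η₀ * g * m ≤ 16 * b * (√d ^ (m - 2) * max (Real.log N / √d ^ (m - 2)) (Real.log d))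
      * (Real.log N / N) := by
  have hN0 : (0 : ℝ) < N := by exact_mod_cast (by omega : 0 < N)
  obtain ⟨hB, -, hB2⟩ := stepFactor_bounds hm hd (by omega : 1 ≤ N)
  have hB0 : 0 ≤ m * stepFactor (2 * m + 1) d N := by linarith
  have h1 : η₀ * (g * m) ≤ b * stepRate (2 * m + 1) d N g * (g * m) := by gcongr
  have h2 : b * stepRate (2 * m + 1) d N g * (g * m)
      = b * (m * stepFactor (2 * m + 1) d N) * (⌈Real.log N⌉₊ / N) := by
    rw [stepRate_eq]
    field_simp
  have h3 : (⌈Real.log N⌉₊ : ℝ) ≤ 2 * Real.log N := by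
    have := Nat.ceil_lt_add_one (a := Real.log N) (by linarith)
    linarith
  set X := √(d : ℝ) ^ (m - 2) * max (Real.log N / √d ^ (m - 2)) (Real.log d)
  calc η₀ * g * m = η₀ * (g * m) := by ring
    _ ≤ b * (m * stepFactor (2 * m + 1) d N) * (⌈Real.log N⌉₊ / N) := h1.trans h2.le
    _ ≤ b * (8 * X) * (2 * Real.log N / N) := by
      have : 0 ≤ X := by linarith
      gcongr
    _ = _ := by ring

/-- A lower bound on η₀ proportional to a, together with η₀ g m ≤ e, forces N to be large when a is.
-/
lemma le_mul_of_stepRate (hm : 2 ≤ m) (hd : 5 ≤ d) (hN : 2 ≤ N) (hg : 0 < g) (ha : 0 ≤ a)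
    (h : a * stepRate (2 * m + 1) d N g ≤ η₀) (he : η₀ * g * m ≤ Real.exp 1) : a ≤ 16 * N := by
  have hN0 : (0 : ℝ) < N := by exact_mod_cast (by omega : 0 < N)
  have h1 := le_of_mul_stepRate_le hm hd hN hg ha h
  have hB := (stepFactor_bounds hm hd (by omega : 1 ≤ N)).1
  have hl : 0.69 ≤ Real.log N := by
    have h2 : Real.log 2 ≤ Real.log N := Real.log_le_log (by norm_num) (by exact_mod_cast hN)
    have := Real.log_two_gt_d9
    linarith
  have h2 : a * (0.69 / 2) * (0.69 / N) ≤ Real.exp 1 := by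
    refine le_trans ?_ (h1.trans he)
    have h3 : 0.69 / 2 ≤ m * stepFactor (2 * m + 1) d N := le_trans (by linarith) hB
    gcongr
  have h3 : a * (0.69 / 2) * (0.69 / N) = a * 0.23805 / N := by ring
  rw [h3, div_le_iff₀ hN0] at h2
  have := Real.exp_one_lt_d9
  nlinarith

lemma phaseLength_bounds (hN : 8 ≤ N) :
    (N : ℝ) / (2 * Real.log N) ≤ phaseLength N ∧ 2 * phaseLength N ≤ N ∧ 2 ≤ Real.log N := by
  have hN0 : (8 : ℝ) ≤ N := by exact_mod_cast hN
  have hl : 2 ≤ Real.log N := by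
    rw [Real.le_log_iff_exp_le (by linarith)]
    have h1 : Real.exp 2 = Real.exp 1 ^ 2 := by rw [← Real.exp_nat_mul]; norm_num
    have := Real.exp_one_lt_d9
    have := Real.exp_pos 1
    nlinarith
  have hl1 : Real.log N ≤ N - 1 := Real.log_le_sub_one_of_pos (by linarith)
  have h1 : 1 ≤ (N : ℝ) / Real.log N := by rw [one_le_div (by linarith)]; linarith
  refine ⟨?_, ?_, hl⟩
  · have h2 := Nat.lt_floor_add_one ((N : ℝ) / Real.log N)
    have h3 : 1 ≤ phaseLength N := Nat.le_floor (by simpa using h1)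
    have h4 : (1 : ℝ) ≤ phaseLength N := by exact_mod_cast h3
    have h5 : (N : ℝ) / Real.log N < phaseLength N + 1 := h2
    have h6 : (N : ℝ) / (2 * Real.log N) = N / Real.log N / 2 := by field_simp
    rw [h6]
    linarith
  · have h2 : (phaseLength N : ℝ) ≤ N / Real.log N := Nat.floor_le (by positivity)
    have h3 : (N : ℝ) / Real.log N ≤ N / 2 := by gcongr
    have h4 : (2 * phaseLength N : ℝ) ≤ N := by linarith
    exact_mod_cast h4

/-- The factor max{1,σ} supplies the second power of σ; of the logarithmic power 7/2 only 3 is kept.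
-/
lemma le_of_sampleRate (hd : 5 ≤ d) (hσ : 0 < σ) (hg : 0 < g) {C : ℝ} (hC : 0 ≤ C)
    (hm : 2 ≤ m) (hY : 1 ≤ Real.log (σ * (2 * m + 1 : ℕ) * N * d / δ))
    (h : C * max 1 σ * sampleRate (2 * m + 1) d N σ g δ ≤ N) :
    C * (σ ^ 2 * (2 * m) * max (Real.log N / √d ^ (m - 2)) (Real.log d) ^ 2
      * Real.log (σ * (2 * m + 1 : ℕ) * N * d / δ) ^ 3 * d ^ m) ≤ g ^ 2 * N := by
  rw [sampleRate, rpow_eq_sqrt_pow hm] at h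
  have e1 : (d : ℝ) ^ ((((2 * m + 1 : ℕ) : ℝ) - 1) / 2) = d ^ m := by
    rw [← Real.rpow_natCast]
    congr 1
    push_cast
    ring
  rw [e1] at h
  set l := Real.log (σ * (2 * m + 1 : ℕ) * N * d / δ)
  set X := max (Real.log N / √(d : ℝ) ^ (m - 2)) (Real.log d)
  have h1 : l ^ 3 ≤ l ^ (7 / 2 : ℝ) := by
    rw [← Real.rpow_natCast]
    exact Real.rpow_le_rpow_of_exponent_le hY (by norm_num)
  have h2 : σ ≤ max 1 σ := le_max_right _ _
  have h3 : g ^ 2 * (C * max 1 σ * (X ^ 2 * (σ * (2 * m + 1 : ℕ) * l ^ (7 / 2 : ℝ) / g ^ 2) * d ^ m))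
      ≤ g ^ 2 * N := by gcongr
  refine le_trans ?_ h3
  have h4 : g ^ 2 * (C * max 1 σ * (X ^ 2 * (σ * (2 * m + 1 : ℕ) * l ^ (7 / 2 : ℝ) / g ^ 2) * d ^ m))
      = C * ((max 1 σ * σ) * (2 * m + 1 : ℕ) * X ^ 2 * l ^ (7 / 2 : ℝ) * d ^ m) := by
    field_simp
  rw [h4]
  have h5 : σ ^ 2 ≤ max 1 σ * σ := by rw [sq]; gcongr
  have h6 : (2 * m : ℝ) ≤ (2 * m + 1 : ℕ) := by push_cast; linarith
  have h7 : 0 ≤ l := by linarith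
  gcongr

/-- A small σ is compensated by c²N ≥ 1: with Y the argument of the logarithm, Y² ≥ 25Nd/δ, so N and
the number of events are at most powers of Y. -/
lemma log_bounds {c : ℝ} (hm : 2 ≤ m) (hd : 5 ≤ d) (hN : 8 ≤ N) (hc : 0 < c) (hcN : 1 ≤ c ^ 2 * N)
    (hσ : c ≤ σ) (hδ : 0 < δ) (hδ1 : δ < 1) :
    1 ≤ Real.log (σ * (2 * m + 1 : ℕ) * N * d / δ)
      ∧ Real.log N ≤ 2 * Real.log (σ * (2 * m + 1 : ℕ) * N * d / δ)
      ∧ Real.log (2 * ((N * ((N + 1) * ((d + 1) * (d * d))) + ((N + 1) + d) : ℕ) : ℝ) / δ)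
        ≤ 6 * Real.log (σ * (2 * m + 1 : ℕ) * N * d / δ) := by
  have hN0 : (8 : ℝ) ≤ N := by exact_mod_cast hN
  have hd0 : (5 : ℝ) ≤ d := by exact_mod_cast hd
  have hk : (5 : ℝ) ≤ (2 * m + 1 : ℕ) := by exact_mod_cast (by omega : 5 ≤ 2 * m + 1)
  set w := (N : ℝ) * d / δ with hw
  have hw1 : N * d ≤ w := le_div_self (by positivity) hδ hδ1.le
  have hw0 : 0 < w := by positivity
  set Y := σ * (2 * m + 1 : ℕ) * N * d / δ with hY
  have hY0 : 5 * c * w ≤ Y := by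
    have : Y = (2 * m + 1 : ℕ) * σ * w := by rw [hY, hw]; ring
    rw [this]
    gcongr
  have hYpos : 0 < Y := lt_of_lt_of_le (by positivity) hY0
  have hY2 : 25 * w ≤ Y ^ 2 := by
    have h1 : (5 * c * w) ^ 2 ≤ Y ^ 2 := pow_le_pow_left₀ (by positivity) hY0 2
    have h2 : 1 ≤ c ^ 2 * w := hcN.trans (by
      have : (N : ℝ) ≤ w := le_trans (by nlinarith) hw1
      gcongr)
    nlinarith
  have hNw : (N : ℝ) ≤ w := le_trans (by nlinarith) hw1
  refine ⟨?_, ?_, ?_⟩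
  · rw [Real.le_log_iff_exp_le hYpos]
    have := Real.exp_one_lt_d9
    by_contra! h
    nlinarith
  · have : Real.log N ≤ Real.log (Y ^ 2) := Real.log_le_log (by linarith) (by linarith)
    rw [Real.log_pow] at this
    exact_mod_cast this
  · have h6 : (6 : ℝ) * Real.log Y = Real.log (Y ^ 6) := by rw [Real.log_pow]; norm_num
    rw [h6]
    refine Real.log_le_log (by positivity) ?_
    have h7 : ((N * ((N + 1) * ((d + 1) * (d * d))) + ((N + 1) + d) : ℕ) : ℝ) ≤ 7 * (N ^ 2 * d ^ 3) := by
      push_cast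
      have a1 : (N : ℝ) * ((N + 1) * ((d + 1) * (d * d))) ≤ N * ((2 * N) * ((2 * d) * (d * d))) := by
        gcongr <;> linarith
      have a2 : (N : ℝ) ≤ N ^ 2 * d ^ 3 := by
        have h : (1 : ℝ) ≤ N * d ^ 3 := by
          have : (1 : ℝ) ≤ d ^ 3 := one_le_pow₀ (by linarith)
          nlinarith
        nlinarith
      have a3 : (d : ℝ) ≤ N ^ 2 * d ^ 3 := by
        have h : (1 : ℝ) ≤ N ^ 2 * d ^ 2 := by
          have h1 : (1 : ℝ) ≤ N ^ 2 := one_le_pow₀ (by linarith)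
          have h2 : (1 : ℝ) ≤ d ^ 2 := one_le_pow₀ (by linarith)
          nlinarith
        nlinarith
      have a4 : (1 : ℝ) ≤ d := by linarith
      nlinarith
    have h8 : (N : ℝ) ^ 2 * d ^ 3 / δ ≤ w ^ 3 := by
      rw [hw, div_pow, mul_pow]
      have b1 : (N : ℝ) ^ 2 ≤ N ^ 3 := pow_le_pow_right₀ (by linarith) (by norm_num)
      have b2 : δ ^ 3 ≤ δ := by
        calc δ ^ 3 ≤ δ ^ 1 := pow_le_pow_of_le_one hδ.le hδ1.le (by norm_num)
          _ = δ := pow_one δ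
      gcongr
    calc 2 * ((N * ((N + 1) * ((d + 1) * (d * d))) + ((N + 1) + d) : ℕ) : ℝ) / δ
        ≤ 2 * (7 * (N ^ 2 * d ^ 3)) / δ := by gcongr
      _ = 14 * (N ^ 2 * d ^ 3 / δ) := by ring
      _ ≤ 14 * w ^ 3 := by gcongr
      _ ≤ (25 * w) ^ 3 := by nlinarith [pow_pos hw0 3]
      _ ≤ (Y ^ 2) ^ 3 := by gcongr
      _ = Y ^ 6 := by ring

end Rates

/-! ### Fitting the noise into the sample size. -/

section Budgets

variable {m d : ℕ} {N g η₀ σ b X lN l Λ : ℝ}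

lemma sqrt_pow_sub_two_sq_mul (hm : 2 ≤ m) : (√(d : ℝ) ^ (m - 2)) ^ 2 * (d : ℝ) ^ 2 = (d : ℝ) ^ m := by
  rw [← pow_mul, mul_comm (m - 2) 2, pow_mul, Real.sq_sqrt (Nat.cast_nonneg d), ← pow_add]
  congr 1
  omega

/-- The squared step-size contributes d^{m-2} and entrywise control d²; their product is the
d^{(k-1)/2} of the sample size. The three logarithms are lN² and Λ. -/
lemma entry_budget_le (hm : 2 ≤ m) (hN : 0 < N) (hg : 0 < g) (hη₀ : 0 < η₀) (hb : 0 < b)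
    (hlN : 0 ≤ lN) (hl : 1 ≤ l) (hlNl : lN ≤ 2 * l) (hΛ0 : 0 ≤ Λ) (hΛ : Λ ≤ 6 * l)
    (hx : η₀ * g * m ≤ 16 * b * (√(d : ℝ) ^ (m - 2) * X) * (lN / N))
    (hC : 10 ^ 12 * b ^ 2 * (σ ^ 2 * (2 * m) * X ^ 2 * l ^ 3 * d ^ m) ≤ g ^ 2 * N) :
    200 * σ ^ 2 * m * (N * η₀ ^ 2) * Λ * d ^ 2 ≤ (1 / (1000 * m)) ^ 2 := by
  have hm0 : (0 : ℝ) < m := by exact_mod_cast (by omega : 0 < m)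
  have h1 : (η₀ * g * m) ^ 2 ≤ (16 * b * (√(d : ℝ) ^ (m - 2) * X) * (lN / N)) ^ 2 :=
    pow_le_pow_left₀ (by positivity) hx 2
  have h2 : lN ^ 2 * Λ ≤ (2 * l) ^ 2 * (6 * l) := by gcongr
  have h3 : (200 * σ ^ 2 * m * (N * η₀ ^ 2) * Λ * d ^ 2) * (g ^ 2 * m ^ 2 * N)
      ≤ 10 ^ (-6 : ℤ) * (g ^ 2 * N) := by
    calc (200 * σ ^ 2 * m * (N * η₀ ^ 2) * Λ * d ^ 2) * (g ^ 2 * m ^ 2 * N)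
        = 200 * σ ^ 2 * m * N ^ 2 * Λ * d ^ 2 * (η₀ * g * m) ^ 2 := by ring
      _ ≤ 200 * σ ^ 2 * m * N ^ 2 * Λ * d ^ 2
          * (16 * b * (√(d : ℝ) ^ (m - 2) * X) * (lN / N)) ^ 2 := by gcongr
      _ = 51200 * σ ^ 2 * m * b ^ 2 * X ^ 2 * ((√(d : ℝ) ^ (m - 2)) ^ 2 * d ^ 2) * (lN ^ 2 * Λ) := by
        field_simp
        ring
      _ ≤ 51200 * σ ^ 2 * m * b ^ 2 * X ^ 2 * d ^ m * ((2 * l) ^ 2 * (6 * l)) := by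
        rw [sqrt_pow_sub_two_sq_mul hm]
        gcongr
      _ = 614400 * b ^ 2 * (σ ^ 2 * (2 * m) * X ^ 2 * l ^ 3 * d ^ m) := by ring
      _ ≤ 10 ^ (-6 : ℤ) * (10 ^ 12 * b ^ 2 * (σ ^ 2 * (2 * m) * X ^ 2 * l ^ 3 * d ^ m)) := by
        have : 0 ≤ b ^ 2 * (σ ^ 2 * (2 * m) * X ^ 2 * l ^ 3 * d ^ m) := by positivity
        norm_num
        nlinarith
      _ ≤ 10 ^ (-6 : ℤ) * (g ^ 2 * N) := by gcongr
  have h4 : (1 / (1000 * m) : ℝ) ^ 2 = 10 ^ (-6 : ℤ) / m ^ 2 := by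
    field_simp
    norm_num
  rw [h4, le_div_iff₀ (by positivity)]
  have h5 : 0 < g ^ 2 * N := by positivity
  nlinarith

/-- The left side is linear in η₀, so the square root of the sample-size condition suffices, leaving
σ/√N. -/
lemma cross_budget_le (hm : 2 ≤ m) (hN : 0 < N) (hg : 0 < g) (hσ : 0 < σ) (hb : 0 < b)
    (hX : 0 ≤ X) (hl : 1 ≤ l) (hlNl : lN ≤ 2 * l) (hΛ0 : 0 ≤ Λ) (hΛ : Λ ≤ 6 * l)
    (hx : η₀ * g * m ≤ 16 * b * (√(d : ℝ) ^ (m - 2) * X) * (lN / N))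
    (hC : 10 ^ 12 * b ^ 2 * (σ ^ 2 * (2 * m) * X ^ 2 * l ^ 3 * d ^ m) ≤ g ^ 2 * N) :
    3200 * d * σ ^ 2 * η₀ * Λ ≤ l ^ 2 * (σ / √N) := by
  have hm0 : (2 : ℝ) ≤ m := by exact_mod_cast hm
  have hs : 0 < √N := Real.sqrt_pos.2 hN
  have hs2 : √N ^ 2 = N := Real.sq_sqrt hN.le
  have h1 : 614400 * b * σ * X * (√(d : ℝ) ^ (m - 2) * d) ≤ g * √N := by
    refine le_of_abs_le (abs_le_of_sq_le_sq ?_ (by positivity))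
    have e1 : (614400 * b * σ * X * (√(d : ℝ) ^ (m - 2) * d)) ^ 2
        = 614400 ^ 2 * b ^ 2 * (σ ^ 2 * X ^ 2 * ((√(d : ℝ) ^ (m - 2)) ^ 2 * d ^ 2)) := by ring
    rw [e1, mul_pow, hs2, sqrt_pow_sub_two_sq_mul hm]
    refine le_trans ?_ hC
    have h2 : (1 : ℝ) ≤ (2 * m) * l ^ 3 := by
      have := one_le_pow₀ (n := 3) hl
      nlinarith
    have h3 : 0 ≤ b ^ 2 * (σ ^ 2 * X ^ 2 * d ^ m) := by positivity
    calc 614400 ^ 2 * b ^ 2 * (σ ^ 2 * X ^ 2 * (d : ℝ) ^ m)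
        ≤ 10 ^ 12 * (b ^ 2 * (σ ^ 2 * X ^ 2 * d ^ m)) * 1 := by nlinarith
      _ ≤ 10 ^ 12 * (b ^ 2 * (σ ^ 2 * X ^ 2 * d ^ m)) * ((2 * m) * l ^ 3) := by gcongr
      _ = _ := by ring
  have h2 : lN * Λ ≤ (2 * l) * (6 * l) := by gcongr
  have h3 : 3200 * d * σ ^ 2 * η₀ * Λ * (g * m * N) ≤ l ^ 2 * σ * √N * (g * m) := by
    calc 3200 * d * σ ^ 2 * η₀ * Λ * (g * m * N)
        = 3200 * d * σ ^ 2 * Λ * N * (η₀ * g * m) := by ring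
      _ ≤ 3200 * d * σ ^ 2 * Λ * N * (16 * b * (√(d : ℝ) ^ (m - 2) * X) * (lN / N)) := by gcongr
      _ = 51200 * b * σ ^ 2 * X * (√(d : ℝ) ^ (m - 2) * d) * (lN * Λ) := by
        field_simp
        ring
      _ ≤ 51200 * b * σ ^ 2 * X * (√(d : ℝ) ^ (m - 2) * d) * ((2 * l) * (6 * l)) := by gcongr
      _ = (614400 * b * σ * X * (√(d : ℝ) ^ (m - 2) * d)) * (σ * l ^ 2) := by ring
      _ ≤ (g * √N) * (σ * l ^ 2) := by gcongr
      _ ≤ (g * √N) * (σ * l ^ 2) * m := le_mul_of_one_le_right (by positivity) (by linarith)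
      _ = _ := by ring
  have h4 : 3200 * d * σ ^ 2 * η₀ * Λ * √N ≤ l ^ 2 * σ := by
    refine le_of_mul_le_mul_right ?_ (by positivity : 0 < g * m * √N)
    calc 3200 * d * σ ^ 2 * η₀ * Λ * √N * (g * m * √N)
        = 3200 * d * σ ^ 2 * η₀ * Λ * (g * m * √N ^ 2) := by ring
      _ ≤ l ^ 2 * σ * √N * (g * m) := by rw [hs2]; exact h3
      _ = _ := by ring
  rw [← mul_div_assoc, le_div_iff₀ hs]
  exact h4

/-- D stands for d^{k/4}: contraction to 1/(√N D) leaves C/(g√N), since g ≤ C D, and σ ≥ c supplies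
the factor σ. -/
lemma exp_neg_le {D C c G y : ℝ} (hN : 0 < N) (hg : 0 < g) (hD : 0 < D) (hDG : D ≤ Real.exp (10 * G))
    (hgD : g ≤ C * D) (hc : 0 < c) (hcσ : c ≤ σ) (hC : 0 < C)
    (hy : Real.log N / 2 + 10 * G ≤ y) :
    Real.exp (-y) ≤ C / c * (σ / (g * √N)) := by
  have hs : 0 < √N := Real.sqrt_pos.2 hN
  have h1 : √N = Real.exp (Real.log N / 2) := by
    rw [Real.exp_half, Real.exp_log hN]
  have h2 : √N * D ≤ Real.exp y := by
    calc √N * D ≤ Real.exp (Real.log N / 2) * Real.exp (10 * G) := by rw [← h1]; gcongr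
      _ = Real.exp (Real.log N / 2 + 10 * G) := (Real.exp_add _ _).symm
      _ ≤ Real.exp y := Real.exp_le_exp.2 hy
  have h3 : Real.exp (-y) ≤ 1 / (√N * D) := by
    rw [Real.exp_neg, ← one_div]
    exact one_div_le_one_div_of_le (by positivity) h2
  refine h3.trans ?_
  have h4 : 1 ≤ σ / c := by rwa [one_le_div hc]
  calc 1 / (√N * D) ≤ C / (g * √N) := by
        rw [div_le_div_iff₀ (by positivity) (by positivity)]
        nlinarith
    _ = C / (g * √N) * 1 := (mul_one _).symm
    _ ≤ C / (g * √N) * (σ / c) := by gcongr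
    _ = _ := by field_simp

end Budgets

/-- The third term of the rate, as δ^{1/2} ≤ 1. The hypothesis keeps the base of the first term
nonnegative. -/
lemma div_le_errorRate {k d N : ℕ} {σ g δ η₀ : ℝ} (hσ : 0 < σ) (hg : 0 < g) (hδ : 0 < δ) (hδ1 : δ < 1)
    (h : η₀ * g * ((k : ℝ) - 1) / (2 * Real.exp 1) ≤ 1) :
    σ / (g * √(N : ℝ)) ≤ errorRate k d N σ g δ η₀ := by
  have h1 : 0 ≤ (1 - η₀ * g * ((k : ℝ) - 1) / (2 * Real.exp 1)) ^ ((phaseLength N : ℝ) / 2)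
      * (1 / (k * δ ^ (1 / 2 : ℝ))) := mul_nonneg (Real.rpow_nonneg (by linarith) _) (by positivity)
  have h2 : 0 ≤ (g ^ 2 * k + σ * (d : ℝ) ^ 2) * (d : ℝ) ^ ((k : ℝ) / 8 - 5 / 8)
      / (g ^ 2 * k * δ ^ (1 / 2 : ℝ) * N) := by positivity
  have h3 : σ / (g * √(N : ℝ)) ≤ σ / (g * δ ^ (1 / 2 : ℝ) * √(N : ℝ)) := by
    rcases Nat.eq_zero_or_pos N with rfl | hN
    · simp
    have hs : 0 < √(N : ℝ) := Real.sqrt_pos.2 (by exact_mod_cast hN)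
    have h4 : δ ^ (1 / 2 : ℝ) ≤ 1 := Real.rpow_le_one hδ.le hδ1.le (by norm_num)
    have h5 : 0 < δ ^ (1 / 2 : ℝ) := Real.rpow_pos_of_pos hδ _
    refine div_le_div_of_nonneg_left hσ.le (by positivity) ?_
    nlinarith [mul_pos hg hs]
  rw [errorRate]
  linarith

/-! ### The thread with the correct sign. -/

section Thread

variable {m d N : ℕ}

set_option maxHeartbeats 2000000 in
/-- With high probability, the thread whose rewards have a positive signal recovers it. -/
theorem exists_forall_thread_error_le {cLam CLam cSig b : ℝ} (hcLam : 0 < cLam)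
    (hCLam : 0 < CLam) (hcSig : 0 < cSig) {a : ℝ} (ha : a = 400 * Real.exp 13 + 16 / cSig ^ 2)
    (hab : a ≤ b) (hm : 2 ≤ m) (hmd : 2 * m + 1 ≤ d) (hN : 2 ≤ N) {lam σ : ℝ} (hlam : cLam ≤ lam)
    (hlam2 : lam ≤ CLam * (d : ℝ) ^ (((2 * m + 1 : ℕ) : ℝ) / 4)) (hσ : cSig ≤ σ)
    {v u : EuclideanSpace ℝ (Fin d)} (hv : ‖v‖ = 1) (hu : ‖u‖ = 1) {r g : ℝ} (hr : r ^ 2 = 1)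
    (hg : 0 < g) (hgr : g = r * (lam * inner ℝ v u)) (hg2 : g = lam * |inner ℝ v u|)
    {Ω : Type*} [MeasurableSpace Ω] {P : Measure Ω} [IsProbabilityMeasure P]
    {E : Fin N → Ω → Tensor d (2 * m + 1)} (hE : IsSubGaussianNoise P E σ) {δ η₀ : ℝ} (hδ : 0 < δ)
    (hδ1 : δ < 1) (hC : 10 ^ 12 * b ^ 2 * max 1 σ * sampleRate (2 * m + 1) d N σ g δ ≤ N)
    (hη : a * stepRate (2 * m + 1) d N g ≤ η₀) (hη2 : η₀ ≤ b * stepRate (2 * m + 1) d N g)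
    (he : η₀ * g * (((2 * m + 1 : ℕ) : ℝ) - 1) / (2 * Real.exp 1) ≤ 1) :
    ∃ A : Set Ω, MeasurableSet A ∧ 1 - δ ≤ P.real A ∧ ∀ ω ∈ A, ∀ w : EuclideanSpace ℝ (Fin d),
      IsThreadOutput u η₀ (fun t => observation lam v (E t ω)) r w →
      signedSqError w v ≤ (208 * (CLam / cSig) + 2 * Real.exp 13)
        * Real.log (Real.exp 1 + σ * (2 * m + 1 : ℕ) * N * d / δ) ^ 2
        * errorRate (2 * m + 1) d N σ g δ η₀ := by
  have hd : 5 ≤ d := by omega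
  have hσ0 : 0 < σ := hcSig.trans_le hσ
  have hlam0 : 0 < lam := hcLam.trans_le hlam
  have hd0 : (5 : ℝ) ≤ d := by exact_mod_cast hd
  have hN0 : (0 : ℝ) < N := by exact_mod_cast (by omega : 0 < N)
  have hm0 : (2 : ℝ) ≤ m := by exact_mod_cast hm
  have ha3 : 400 * Real.exp 13 ≤ a := by
    have : 0 < 16 / cSig ^ 2 := by positivity
    linarith
  have hexp13 : 14 ≤ Real.exp 13 := by
    have := Real.add_one_le_exp (13 : ℝ)
    linarith
  have ha0 : 0 < a := by linarith
  have hb0 : 0 < b := ha0.trans_le hab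
  have hxe : η₀ * g * m ≤ Real.exp 1 := by
    rw [div_le_one (by positivity)] at he
    push_cast at he
    linarith
  have haN := le_mul_of_stepRate hm hd hN hg ha0.le hη hxe
  have hN200 : 8 ≤ N := by
    have : (8 : ℝ) ≤ N := by linarith
    exact_mod_cast this
  have hcN : 1 ≤ cSig ^ 2 * N := by
    have h1 : 16 / cSig ^ 2 ≤ 16 * N := by linarith
    rw [div_le_iff₀ (by positivity)] at h1
    linarith
  obtain ⟨hT1, hT2, hlN⟩ := phaseLength_bounds hN200
  obtain ⟨hl, hlNl, hcount⟩ := log_bounds hm hd hN200 hcSig hcN hσ hδ hδ1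
  have hC' := le_of_sampleRate hd hσ0 hg (by positivity) hm hl hC
  have hxl := le_of_mul_stepRate_le hm hd hN hg ha0.le hη
  have hxu := le_of_le_mul_stepRate hm hd hN (by linarith) hg hb0.le hη2
  obtain ⟨hs1, hs2, -⟩ := stepFactor_bounds hm hd (by omega : 1 ≤ N)
  set Y := σ * (2 * m + 1 : ℕ) * N * d / δ with hY
  have hY0 : 0 < Y := by positivity
  set T := phaseLength N with hT
  set X := max (Real.log N / √(d : ℝ) ^ (m - 2)) (Real.log d) with hX
  have hX0 : 0 ≤ X := le_max_of_le_right (by linarith [one_le_log_of_five_le hd])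
  set c := Real.exp (-13) / 2 with hc
  have hc0 : 0 < c := by positivity
  have hc13 : c * Real.exp 13 = 1 / 2 := by
    rw [hc, div_mul_eq_mul_div, ← Real.exp_add]
    norm_num
  set x := η₀ * g * m with hx
  have hx0 : 0 < x := by
    refine lt_of_lt_of_le ?_ hxl
    have : 0 < (m : ℝ) * stepFactor (2 * m + 1) d N := by linarith
    have : 0 < Real.log N := by linarith
    positivity
  have hη₀ : 0 < η₀ := by
    by_contra! h
    have : η₀ * g * m ≤ 0 :=
      mul_nonpos_of_nonpos_of_nonneg (mul_nonpos_of_nonpos_of_nonneg h hg.le) (by linarith)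
    linarith
  -- The phase length is at least N/(2 log N), which costs half of a.
  have hxT : a / 2 * (m * stepFactor (2 * m + 1) d N) ≤ x * T := by
    have h0 : 0 ≤ (m : ℝ) * stepFactor (2 * m + 1) d N := by linarith
    have h1 : 0 < Real.log N := by linarith
    calc a / 2 * (m * stepFactor (2 * m + 1) d N)
        = a * (m * stepFactor (2 * m + 1) d N) * (Real.log N / N) * (N / (2 * Real.log N)) := by
          field_simp
      _ ≤ x * T := by gcongr
  have hG0 : 0 ≤ growthTime m d := by
    rw [growthTime]
    split_ifs
    · linarith [one_le_log_of_five_le hd]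
    · positivity
  have hcxT : Real.log N / 2 + 10 * growthTime m d ≤ c * (x * T) ∧ 8 ≤ c * (x * T) := by
    -- 400e¹³ in a, halved and multiplied by c = e^{-13}/2, gives 100.
    have h1 : 100 * (m * stepFactor (2 * m + 1) d N) ≤ c * (x * T) := by
      calc 100 * (m * stepFactor (2 * m + 1) d N)
          = (c * Real.exp 13) * (200 * (m * stepFactor (2 * m + 1) d N)) := by rw [hc13]; ring
        _ = c * ((400 * Real.exp 13) / 2 * (m * stepFactor (2 * m + 1) d N)) := by ring
        _ ≤ c * (a / 2 * (m * stepFactor (2 * m + 1) d N)) := by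
          have h0 : 0 ≤ (m : ℝ) * stepFactor (2 * m + 1) d N := by linarith
          gcongr
        _ ≤ c * (x * T) := by gcongr
    constructor <;> linarith
  set Λ := Real.log (2 * ((N * ((N + 1) * ((d + 1) * (d * d))) + ((N + 1) + d) : ℕ) : ℝ) / δ)
    with hΛ
  have hcnt : (1 : ℝ) ≤ ((N * ((N + 1) * ((d + 1) * (d * d))) + ((N + 1) + d) : ℕ) : ℝ) := by
    exact_mod_cast (by omega :
      1 ≤ N * ((N + 1) * ((d + 1) * (d * d))) + ((N + 1) + d))
  have hΛ0 : 0 ≤ Λ := Real.log_nonneg (by rw [le_div_iff₀ hδ]; linarith)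
  have hq : 1 ≤ (2 * m + 1 - 1) / 2 ∧ (2 * m + 1 - 1) / 2 = m := by omega
  have hηt : ∀ t : ℕ, 0 ≤ η₀ / 2 ^ (t / T) := fun t => by positivity
  have hηle : ∀ t : ℕ, η₀ / 2 ^ (t / T) ≤ η₀ := fun t =>
    div_le_self hη₀.le (one_le_pow₀ (by norm_num))
  have hζ0 : 0 ≤ 800 * σ ^ 2 * η₀ / (c * g) * Λ := by positivity
  obtain ⟨A, hA, hPA, hbounds⟩ := exists_forall_noiseBounds (T := T) (E := E) (δ := δ)
    (η := fun t => η₀ / 2 ^ (t / T)) (c := c) (ε := 1 / (1000 * m))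
    (ζ := √(800 * σ ^ 2 * η₀ / (c * g) * Λ)) hE (by simp) (by omega) hd (by omega) hσ0 hr hu hv
    hηt hηle hη₀ hg hc0
    (by
      rw [hq.2]
      calc c * x ≤ c * Real.exp 13 := by
            gcongr
            exact hxe.trans (Real.exp_le_exp.2 (by norm_num))
        _ ≤ 1 := by rw [hc13]; norm_num)
    (by positivity) (Real.sqrt_nonneg _) hΛ0
    (by
      rw [hq.2]
      exact entry_budget_le hm hN0 hg hη₀ hb0 (by linarith) hl hlNl hΛ0 hcount hxu hC')
    (by rw [Real.sq_sqrt hζ0])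
    (by
      -- Λ is the logarithm of twice the number of bad events over δ, so the union bound gives
      -- exactly δ.
      rw [Real.exp_neg, Real.exp_log (by positivity), inv_div]
      field_simp
      rfl)
  refine ⟨A, hA, hPA, fun ω hω w hw => ?_⟩
  obtain ⟨D, hD, hDN⟩ := nsga_eq_smul_normIter (n := 2 * m + 1 - 1) (by simp) (by omega) (N := N) η₀ g v
    (contractedNoise r u E ω) (fun t W => r * oddReward u (observation lam v (E t ω)) W)
    (fun t => by
      funext W
      rw [oddReward, contractFirst_observation (by omega), ← tensorInner_smul_right, smul_add,
        smul_smul, ← hgr, contractedNoise, dif_pos t.2]) N le_rfl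
  rw [IsThreadOutput, hDN] at hw
  have hsm : 0 < √(m : ℝ) := Real.sqrt_pos.2 (by linarith)
  have hTpos : 0 < T := by
    rcases Nat.eq_zero_or_pos T with h | h
    · have := hcxT.2
      rw [h] at this
      norm_num at this
    · exact h
  have herr := (hbounds ω hω).signedSqError_le hc (by simp) (by omega) hd hv hg hηt hx0 hxe
    (fun t ht => by simp [Nat.div_eq_of_lt ht, hx])
    (fun t ht => by
      rw [hq.2]
      have h1 : 1 ≤ t / T := (Nat.one_le_div_iff hTpos).2 ht
      have h2 : (2 : ℝ) ≤ 2 ^ (t / T) := le_self_pow₀ (by norm_num) (by omega)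
      calc η₀ / 2 ^ (t / T) * g * m = x / 2 ^ (t / T) := by rw [hx]; ring
        _ ≤ x / 2 := by gcongr)
    (by positivity)
    (by
      rw [hq.2]
      field_simp
      norm_num)
    (fun t h1 h2 => by
      rw [hq.2]
      have h3 : t / T = 1 := by
        rw [Nat.div_eq_iff hTpos]
        omega
      rw [h3, hx]
      ring)
    -- With 2^L ≥ d the last scale is √d/2^L ≤ 1/√d, below 3/√m.
    hT2 (L := Nat.clog 2 d) (Nat.clog_le_of_le_pow (Nat.lt_two_pow_self).le)
    (by
      rw [hq.2]
      have h1 : (d : ℝ) ≤ 2 ^ Nat.clog 2 d := by exact_mod_cast Nat.le_pow_clog (by norm_num) d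
      have h2 : √(m : ℝ) ≤ √d := Real.sqrt_le_sqrt (by exact_mod_cast (by omega : m ≤ d))
      have h3 : √(d : ℝ) * √d = d := Real.mul_self_sqrt (by linarith)
      rw [div_le_div_iff₀ (by positivity) hsm]
      nlinarith [Real.sqrt_nonneg (d : ℝ)])
    (by
      rw [hq.2]
      refine (sum_sqrt_pow_le hm (by omega) hd).trans (le_trans ?_ hxT)
      nlinarith)
    hcxT.2 hD hw
  refine herr.trans ?_
  have hinner : |inner ℝ v u| ≤ 1 := by
    have := abs_real_inner_le_norm v u
    rwa [hv, hu, one_mul] at this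
  have hglam : g ≤ CLam * (d : ℝ) ^ (((2 * m + 1 : ℕ) : ℝ) / 4) := by
    rw [hg2]
    exact (mul_le_of_le_one_right hlam0.le hinner).trans hlam2
  have e1 : Real.exp (-(c * (x * T))) ≤ CLam / cSig * (σ / (g * √(N : ℝ))) :=
    exp_neg_le hN0 hg (Real.rpow_pos_of_pos (by linarith) _) (rpow_le_exp_growthTime hm hd)
      hglam hcSig hσ hCLam hcxT.1
  have e2 := cross_budget_le hm hN0 hg hσ0 hb0 hX0 hl hlNl hΛ0 hcount hxu hC'
  have e3 : 4 * d * √(800 * σ ^ 2 * η₀ / (c * g) * Λ) ^ 2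
      ≤ 2 * Real.exp 13 * Real.log Y ^ 2 * (σ / (g * √(N : ℝ))) := by
    rw [Real.sq_sqrt hζ0]
    have hcinv : 1 / c = 2 * Real.exp 13 := by
      rw [div_eq_iff hc0.ne']
      linarith
    calc 4 * d * (800 * σ ^ 2 * η₀ / (c * g) * Λ)
        = 1 / c * (3200 * d * σ ^ 2 * η₀ * Λ) / g := by
          field_simp
          ring
      _ ≤ 1 / c * (Real.log Y ^ 2 * (σ / √(N : ℝ))) / g := by gcongr
      _ = _ := by
        rw [hcinv]
        have : 0 < √(N : ℝ) := Real.sqrt_pos.2 hN0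
        field_simp
  have e4 := div_le_errorRate (k := 2 * m + 1) (d := d) (N := N) hσ0 hg hδ hδ1 he
  have e5 : Real.log Y ≤ Real.log (Real.exp 1 + Y) :=
    Real.log_le_log hY0 (by linarith [Real.exp_pos 1])
  have e6 : 1 ≤ Real.log Y ^ 2 := one_le_pow₀ hl
  have e7 : 0 ≤ σ / (g * √(N : ℝ)) := by positivity
  calc 208 * Real.exp (-(c * (x * T))) + 4 * d * √(800 * σ ^ 2 * η₀ / (c * g) * Λ) ^ 2
      ≤ 208 * (CLam / cSig * (σ / (g * √(N : ℝ))))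
        + 2 * Real.exp 13 * Real.log Y ^ 2 * (σ / (g * √(N : ℝ))) := by gcongr
    _ = 208 * (CLam / cSig) * (σ / (g * √(N : ℝ))) * 1
        + 2 * Real.exp 13 * Real.log Y ^ 2 * (σ / (g * √(N : ℝ))) := by ring
    _ ≤ 208 * (CLam / cSig) * (σ / (g * √(N : ℝ))) * Real.log Y ^ 2
        + 2 * Real.exp 13 * Real.log Y ^ 2 * (σ / (g * √(N : ℝ))) := by gcongr
    _ = (208 * (CLam / cSig) + 2 * Real.exp 13) * Real.log Y ^ 2 * (σ / (g * √(N : ℝ))) := by ring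
    _ ≤ _ := by
      have : 0 ≤ Real.log Y := by linarith
      gcongr

end Thread

end

/-! ### The bi-threaded guarantee. -/

theorem mainTheorem4 (cLam CLam cSig : ℝ) (hcLam : 0 < cLam) (hCLam : 0 < CLam)
    (hcSig : 0 < cSig) :
    -- the constants of the step-size window, of the sample size and of the rate
    ∃ a : ℝ, 0 < a ∧ ∀ b : ℝ, a ≤ b →
    ∃ (C₁ C₂ : ℝ) (p : ℕ), 0 < C₁ ∧ 0 < C₂ ∧
    -- the tensor PCA problem
    ∀ (k d N : ℕ), Odd k → 5 ≤ k → k ≤ d → 2 ≤ N →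
    ∀ (lam σ : ℝ), cLam ≤ lam → lam ≤ CLam * (d : ℝ) ^ ((k : ℝ) / 4) → cSig ≤ σ →
    ∀ (vstar u : EuclideanSpace ℝ (Fin d)), ‖vstar‖ = 1 → ‖u‖ = 1 → inner ℝ vstar u ≠ 0 →
    ∀ (Ω : Type*) [MeasurableSpace Ω] (P : Measure Ω) [IsProbabilityMeasure P]
      (E : Fin N → Ω → Tensor d k), IsSubGaussianNoise P E σ →
    ∀ (δ η₀ : ℝ), 0 < δ → δ < 1 →
    -- the sample size
    C₁ * max 1 σ * sampleRate k d N σ (lam * |inner ℝ vstar u|) δ ≤ N →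
    -- the initial step-size, for which the decay factor is not negative
    a * stepRate k d N (lam * |inner ℝ vstar u|) ≤ η₀ →
    η₀ ≤ b * stepRate k d N (lam * |inner ℝ vstar u|) →
    η₀ * (lam * |inner ℝ vstar u|) * ((k : ℝ) - 1) / (2 * Real.exp 1) ≤ 1 →
    -- with probability at least `1 - δ`, whatever top eigenvectors the two threads return
    ∃ A : Set Ω, MeasurableSet A ∧ 1 - δ ≤ P.real A ∧ ∀ ω ∈ A,
      ∀ v₁ v₂ : EuclideanSpace ℝ (Fin d),
        IsThreadOutput u η₀ (fun t => observation lam vstar (E t ω)) 1 v₁ →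
        IsThreadOutput u η₀ (fun t => observation lam vstar (E t ω)) (-1) v₂ →
        min (signedSqError v₁ vstar) (signedSqError v₂ vstar) ≤
          C₂ * Real.log (Real.exp 1 + σ * k * N * d / δ) ^ p
            * errorRate k d N σ (lam * |inner ℝ vstar u|) δ η₀ := by
  have hapos : 0 < 400 * Real.exp 13 + 16 / cSig ^ 2 := by positivity
  -- In a, the term 400e¹³ pays for both phases and 16/cSig² forces cSig² N ≥ 1. The factor b² in C₁
  -- offsets the squared step-size.
  refine ⟨_, hapos, fun b hab => ⟨10 ^ 12 * b ^ 2, 208 * (CLam / cSig) + 2 * Real.exp 13, 2, ?_,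
    by positivity, ?_⟩⟩
  · have := hapos.trans_le hab
    positivity
  intro k d N hk h5 hkd hN lam σ hlam hlam2 hσ v u hv hu hvu Ω _ P _ E hE δ η₀ hδ hδ1 hC hη hη2 he
  obtain ⟨m, rfl⟩ := hk
  have hlam0 : 0 < lam := hcLam.trans_le hlam
  have hg : 0 < lam * |inner ℝ v u| := mul_pos hlam0 (abs_pos.2 hvu)
  -- The sign of ⟨v,u⟩ decides which thread sees a positive signal; nothing is claimed about the
  -- other.
  rcases lt_or_gt_of_ne hvu with hneg | hpos
  · obtain ⟨A, hA, hPA, h⟩ := exists_forall_thread_error_le hcLam hCLam hcSig rfl hab (by omega) hkd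
      hN hlam hlam2 hσ hv hu (r := -1) (by norm_num) hg (by rw [abs_of_neg hneg]; ring) rfl hE hδ
      hδ1 hC hη hη2 he
    exact ⟨A, hA, hPA, fun ω hω v₁ v₂ _ h₂ => (min_le_right _ _).trans (h ω hω v₂ h₂)⟩
  · obtain ⟨A, hA, hPA, h⟩ := exists_forall_thread_error_le hcLam hCLam hcSig rfl hab (by omega) hkd
      hN hlam hlam2 hσ hv hu (r := 1) (by norm_num) hg (by rw [abs_of_pos hpos]; ring) rfl hE hδ
      hδ1 hC hη hη2 he
    exact ⟨A, hA, hPA, fun ω hω v₁ v₂ h₁ _ => (min_le_left _ _).trans (h ω hω v₁ h₁)⟩
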